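/- Let $n\ge 1$, $d\ge 0$ be integers and let $X_{ij}$, $1\le i\le n$, $1\le j\le d$, be real random variables on a probability space with $\mathbb{E}X_{ij}=0$, such that the vectors $\mathbf{X}_i=(X_{i1},\ldots,X_{id})$, $i=1,\ldots,n$, are independent (for fixed $i$ the components $X_{i1},\ldots,X_{id}$ may be dependent, and no identical distribution is assumed). Put $W_j=n^{-1/2}\sum_{i=1}^nX_{ij}$, $\mathbf{W}=(W_1,\ldots,W_d)^T$, let $\Sigma$ be the (automatically non-negative definite) covariance matrix of $\mathbf{W}$, $\Sigma^{1/2}$ its non-negative definite square root, $\mathbf{Z}$ a standard $d$-dimensional normal vector, and $Z_t=(\Sigma^{1/2}\mathbf{Z})_t$. For an integer $m\ge1$ and $P(\mathbf{w})=A+\sum_{t=1}^dB_t|w_t|^{r_t}$ with $A,B_t,r_t\ge0$, say that $g:\mathbb{R}^d\to\mathbb{R}$ belongs to $C_P^m(\mathbb{R}^d)$ with dominating function $P$ if all partial derivatives of $g$ up to order $m$ exist and $$\bigg|\frac{\partial^kg(\mathbf{w})}{\partial w_{i_1}\cdots\partial w_{i_k}}\bigg|^{m/k}\le P(\mathbf{w})\qquad\text{for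 all }\mathbf{w}\in\mathbb{R}^d,\ 1\le k\le m,\ 1\le i_1,\ldots,i_k\le d .$$ Say that $h:\mathbb{R}\to\mathbb{R}$ belongs to $C_b^6(\mathbb{R})$ if $h',\ldots,h^{(6)}$ exist and are bounded, and put $h_m=\sum_{j=1}^m{m\brace j}\sup_{x\in\mathbb{R}}|h^{(j)}(x)|$, where ${m\brace j}$ are the Stirling numbers of the second kind. For $c,\kappa\ge0$, $1\le i\le n$ and a random variable $u$, write $$T^{A}_{c,\kappa,i}(u)=A\,\mathbb{E}|u|+\sum_{t=1}^dc^{r_t}B_t\Big(2^{r_t}\,\mathbb{E}|u|\,\mathbb{E}|W_t|^{r_t}+\frac{2^{r_t}}{n^{r_t/2}}\mathbb{E}\big[|u|\,|X_{it}|^{r_t}\big]+\kappa\,\mathbb{E}|Z_t|^{r_t}\,\mathbb{E}|u|\Big)$$ and $$\begin{aligned}M_A={}&\frac{h_4}{24n^2}\sum_{i=1}^n\sum_{j,k,l,m=1}^d\Big\{T^A_{2,1,i}(X_{ij}X_{ik}X_{il}X_{im})+9|\mathbb{E}X_{ij}X_{ik}|\,T^A_{2,1,i}(X_{il}X_{im})+3|\mathbb{E}X_{ij}X_{ik}X_{il}|\,T^A_{2,1,i}(X_{im})\Big\}\\&+\frac{h_6}{72n^3}\sum_{\alpha=1}^n\sum_{a,b,c=1}^d|\mathbb{E}X_{\alpha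 a}X_{\alpha b}X_{\alpha c}|\sum_{i=1}^n\sum_{j,k,l=1}^d\Big\{T^A_{3,2,i}(X_{ij}X_{ik}X_{il})+2|\mathbb{E}X_{ij}X_{ik}|\,T^A_{3,2,i}(X_{il})\Big\}.\end{aligned}$$ Suppose that $g\in C_P^6(\mathbb{R}^d)$ with dominating function $P(\mathbf{w})=A+\sum_tB_t|w_t|^{r_t}$, that $g$ is even, i.e. $g(-\mathbf{w})=g(\mathbf{w})$ for all $\mathbf{w}$, that $\mathbb{E}|X_{ij}|^{r_k+4}<\infty$ for all $1\le i\le n$ and $1\le j,k\le d$, and that $h\in C_b^6(\mathbb{R})$. Then $h(g(\mathbf{W}))$ and $h(g(\Sigma^{1/2}\mathbf{Z}))$ are integrable and $$|\mathbb{E}h(g(\mathbf{W}))-\mathbb{E}h(g(\Sigma^{1/2}\mathbf{Z}))|\le M_{\max(A,1)} .$$ If, moreover, $g\in C_P^4(\mathbb{R}^d)$ with the same dominating function $P$ (which is automatic when $A\ge1$), then $$|\mathbb{E}h(g(\mathbf{W}))-\mathbb{E}h(g(\Sigma^{1/2}\mathbf{Z}))|\le M_A .$$ -/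

import Mathlib

open MeasureTheory ProbabilityTheory
open scoped MatrixOrder

namespace EvenStein

/-- The iterated partial derivative `∂^k g / ∂w_{i_1} ⋯ ∂w_{i_k}` of a function on `ℝ^d`,
for the list of indices `[i_1, …, i_k]`. -/
noncomputable def iterPartial {d : ℕ} (g : EuclideanSpace ℝ (Fin d) → ℝ) :
    List (Fin d) → EuclideanSpace ℝ (Fin d) → ℝ
  | [] => g
  | j :: s => fun w => lineDeriv ℝ (iterPartial g s) w (EuclideanSpace.single j 1)

/-- The dominating function `P(w) = A + ∑ i, B_i |w_i|^{r_i}`. -/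
noncomputable def polyDom {d : ℕ} (A : ℝ) (B r : Fin d → ℝ) (w : EuclideanSpace ℝ (Fin d)) : ℝ :=
  A + ∑ i, B i * |w i| ^ r i

/-- `g` belongs to the class `C_P^m(ℝ^d)`, with the dominating function `P = polyDom A B r`:
all partial derivatives of `g` up to order `m` exist, and
`|∂^k g / ∂w_{i_1} ⋯ ∂w_{i_k}| ^ (m / k) ≤ P` for `k = 1, …, m`. -/
structure MemCP {d : ℕ} (m : ℕ) (A : ℝ) (B r : Fin d → ℝ)
    (g : EuclideanSpace ℝ (Fin d) → ℝ) : Prop where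
  nonneg_A : 0 ≤ A
  nonneg_B : ∀ i, 0 ≤ B i
  nonneg_r : ∀ i, 0 ≤ r i
  exists_partial : ∀ s : List (Fin d), s.length < m → ∀ (j : Fin d) (w : EuclideanSpace ℝ (Fin d)),
    LineDifferentiableAt ℝ (iterPartial g s) w (EuclideanSpace.single j 1)
  dominated : ∀ s : List (Fin d), 1 ≤ s.length → s.length ≤ m →
    ∀ w : EuclideanSpace ℝ (Fin d),
      |iterPartial g s w| ^ ((m : ℝ) / (s.length : ℝ)) ≤ polyDom A B r w

/-- `h` belongs to the class `C_b^m(ℝ)`: its derivatives of order `1, …, m` exist and are bounded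
(`h` itself need not be bounded). -/
structure MemCb (m : ℕ) (h : ℝ → ℝ) : Prop where
  differentiable : ∀ k < m, Differentiable ℝ (iteratedDeriv k h)
  bounded : ∀ k, 1 ≤ k → k ≤ m → ∃ C : ℝ, ∀ x, |iteratedDeriv k h x| ≤ C

/-- `h_m = ∑_{j=1}^m S(m,j) ‖h^{(j)}‖_∞`, with the Stirling numbers of the second kind. -/
noncomputable def hSum (m : ℕ) (h : ℝ → ℝ) : ℝ :=
  ∑ j ∈ Finset.Icc 1 m, (Nat.stirlingSecond m j : ℝ) * ⨆ x : ℝ, |iteratedDeriv j h x|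

/-- The vector `W` with the entries `W_j = n^{-1/2} ∑ i, X_{ij}`. -/
noncomputable def blockSum {Ω : Type*} {n d : ℕ} (X : Fin n → Fin d → Ω → ℝ) (ω : Ω) :
    EuclideanSpace ℝ (Fin d) :=
  WithLp.toLp 2 fun j => (√(n : ℝ))⁻¹ * ∑ i, X i j ω

/-- The covariance matrix `Σ` of `W`. -/
noncomputable def blockCov {Ω : Type*} [MeasurableSpace Ω] (P : Measure Ω) {n d : ℕ}
    (X : Fin n → Fin d → Ω → ℝ) : Matrix (Fin d) (Fin d) ℝ :=
  Matrix.of fun j k => covariance (fun ω => blockSum X ω j) (fun ω => blockSum X ω k) P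

/-- The vector `Σ^{1/2} z`, where `Σ^{1/2}` is the non-negative definite square root of `Σ`. -/
noncomputable def sqrtMul {d : ℕ} (S : Matrix (Fin d) (Fin d) ℝ) (z : EuclideanSpace ℝ (Fin d)) :
    EuclideanSpace ℝ (Fin d) :=
  Matrix.toEuclideanCLM (𝕜 := ℝ) (CFC.sqrt S) z

/-- For a random variable `u` and the `i`-th row of `X`, with `ζ t` standing for `E|Z_t|^{r_t}`:
`A E|u| + ∑ t, c^{r_t} B_t (2^{r_t} E|u| E|W_t|^{r_t} + 2^{r_t} n^{-r_t/2} E|u X_{it}^{r_t}|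
  + κ E|Z_t|^{r_t} E|u|)`. -/
noncomputable def momentBracket {Ω : Type*} [MeasurableSpace Ω] (P : Measure Ω) {n d : ℕ}
    (X : Fin n → Fin d → Ω → ℝ) (A : ℝ) (B r ζ : Fin d → ℝ) (c κ : ℝ) (i : Fin n) (u : Ω → ℝ) :
    ℝ :=
  A * (∫ ω, |u ω| ∂P) +
    ∑ t, c ^ r t * B t *
      (2 ^ r t * (∫ ω, |u ω| ∂P) * (∫ ω, |blockSum X ω t| ^ r t ∂P)
        + 2 ^ r t / (n : ℝ) ^ (r t / 2) * (∫ ω, |u ω| * |X i t ω| ^ r t ∂P)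
        + κ * ζ t * (∫ ω, |u ω| ∂P))

/-- The bound `M`, with `ζ t` standing for `E|Z_t|^{r_t}`. -/
noncomputable def boundM {Ω : Type*} [MeasurableSpace Ω] (P : Measure Ω) {n d : ℕ}
    (X : Fin n → Fin d → Ω → ℝ) (A : ℝ) (B r ζ : Fin d → ℝ) (h : ℝ → ℝ) : ℝ :=
  hSum 4 h / (24 * (n : ℝ) ^ 2) *
    ∑ i, ∑ j, ∑ k, ∑ l, ∑ m,
      (momentBracket P X A B r ζ 2 1 i (fun ω => X i j ω * X i k ω * X i l ω * X i m ω)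
        + 9 * |∫ ω, X i j ω * X i k ω ∂P| *
            momentBracket P X A B r ζ 2 1 i (fun ω => X i l ω * X i m ω)
        + 3 * |∫ ω, X i j ω * X i k ω * X i l ω ∂P| *
            momentBracket P X A B r ζ 2 1 i (fun ω => X i m ω))
  + hSum 6 h / (72 * (n : ℝ) ^ 3) *
    ∑ α, ∑ a, ∑ b, ∑ c, |∫ ω, X α a ω * X α b ω * X α c ω ∂P| *
      ∑ i, ∑ j, ∑ k, ∑ l,
        (momentBracket P X A B r ζ 3 2 i (fun ω => X i j ω * X i k ω * X i l ω)
          + 2 * |∫ ω, X i j ω * X i k ω ∂P| *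
              momentBracket P X A B r ζ 3 2 i (fun ω => X i l ω))

end EvenStein

/-!
The law of `W` is joined to the normal law by a rotation. Write `x_i = X_i / √n`, so that
`W = ∑ x_i`, let `Y` be a normal vector with covariance matrix `Σ`, independent of `W`, and for a
function `q` put `Ψ_q(θ) = E q(cos θ W + sin θ Y)`. Gaussian integration by parts in `Y` gives
`Ψ_q'(θ) = sin θ ∑ S_i(θ)`, where `S_i` compares `cos θ ∑_{jk} E[x_ij x_ik] E ∂_jk q` with
`∑_j E[x_ij ∂_j q]` (`SumData.hasDerivAt_integral_interp`). Expanding `S_i` around the vector with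
the `i`-th summand left out, which is independent of `x_i`, cancels the first and second moments of
`x_i` (`SplitData.abs_step_le_of_fourth`). What remains, for `q = h ∘ g`, is a remainder with fourth
order derivatives of `q`, of size `1 / n` in total, and third moments of `x_i` times `Ψ_G(θ)`, where
`G` is a third order partial derivative of `q`.

This is where evenness enters. `G` is odd, so `Ψ_G(π / 2) = E G(Y) = 0`, and running the same
argument on `[θ, π / 2]` with an expansion of one order less (`SplitData.abs_step_le_of_third`)
bounds `Ψ_G(θ)` by sixth order derivatives of `q` (`SumData.abs_integral_third_le`). So the
third moments too contribute only at the order `1 / n`. Integrating the bounds for `Ψ_q'` over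
`[0, π / 2]`, where the powers of `cos θ` give the constants, yields `SumData.abs_integral_sub_le`.

The derivatives of `h ∘ g` are controlled by Faà di Bruno's formula, `abs_iterPartial_comp_le`: its
terms are indexed by the set partitions, which the Stirling numbers in `hSum` count, and the
exponents in the definition of `C_P^m` make each term a multiple of the same power of `P`. A bound
for the derivatives of order four by `P` itself comes from `g ∈ C_P^4`, or from `g ∈ C_P^6` once the
constant term of `P` is at least one.

The Taylor remainders contain `P` along the interpolation, multiplied by products of the entries of
`x_i`. Since the partial derivatives are taken coordinatewise, they are bounded by `P` at a corner
of a box, with `|V_t| + |x_it|` in the place of `|w_t|` and `V` the vector without `x_i`. The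
moments of `|V_t| + |x_it|` are compared with those of `W_t`, `X_it` and `Y_t` in
`SumData.integral_mul_box_le`. For `r ≥ 1` the moments of a partial sum are at most those of the
full sum. For `r < 1` this fails; then `E|V_t|^r ≤ (Σ_tt)^(r / 2)` by concavity, and the normal
moment takes over, because `(Σ_tt)^(r / 2) ≤ 2^r E|Y_t|^r`
(`one_le_two_rpow_mul_integral_abs_rpow`).
-/

namespace EvenStein

/-! ### Calculus with partial derivatives -/

section Calculus

/-- If `|φ'| ≤ B'` on `[a, b]`, the increment of `φ` is bounded by that of `B`. -/
lemma abs_sub_le_of_abs_deriv_le {φ φ' B B' : ℝ → ℝ} {a b : ℝ} (hab : a ≤ b)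
    (hφ : ∀ t, HasDerivAt φ (φ' t) t) (hB : ∀ t, HasDerivAt B (B' t) t)
    (h : ∀ t ∈ Set.Icc a b, |φ' t| ≤ B' t) : |φ b - φ a| ≤ B b - B a := by
  have key := image_norm_le_of_norm_deriv_right_le_deriv_boundary (f := fun t => φ t - φ a)
    (f' := φ') (a := a) (b := b) (B := fun t => B t - B a) (B' := B')
    (fun t _ => ((hφ t).sub_const _).continuousAt.continuousWithinAt)
    (fun t _ => ((hφ t).sub_const _).hasDerivWithinAt) (by simp)
    (fun t => (hB t).sub_const _) (fun t ht => h t ⟨ht.1, ht.2.le⟩)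
  exact key (Set.right_mem_Icc.2 hab)

variable {d : ℕ}

lemma hasDerivAt_of_hasLineDerivAt {q : EuclideanSpace ℝ (Fin d) → ℝ}
    {e : EuclideanSpace ℝ (Fin d)} {q' : EuclideanSpace ℝ (Fin d) → ℝ}
    (hq : ∀ w, HasLineDerivAt ℝ q (q' w) w e) (w : EuclideanSpace ℝ (Fin d)) (t : ℝ) :
    HasDerivAt (fun t : ℝ => q (w + t • e)) (q' (w + t • e)) t := by
  have h := hq (w + t • e)
  unfold HasLineDerivAt at h
  have h2 : HasDerivAt (fun u : ℝ => q (w + t • e + (u - t) • e)) (q' (w + t • e)) t := by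
    have := HasDerivAt.comp_sub_const (f := fun u : ℝ => q (w + t • e + u • e))
      (f' := q' (w + t • e)) t t (by simpa using h)
    simpa using this
  refine h2.congr_of_eventuallyEq (Filter.Eventually.of_forall fun u => ?_)
  simp only [sub_smul]
  congr 1
  abel

/-- Mean value inequality for a function that only has partial derivatives: moving from `v` to
`v + x` one coordinate at a time stays in the box spanned by the two points. -/
lemma abs_add_sub_le_of_partial {q : EuclideanSpace ℝ (Fin d) → ℝ}
    {q' : Fin d → EuclideanSpace ℝ (Fin d) → ℝ}
    (hq : ∀ l w, HasLineDerivAt ℝ q (q' l w) w (EuclideanSpace.single l 1))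
    (v x : EuclideanSpace ℝ (Fin d)) {K : ℝ}
    (hK : ∀ w : EuclideanSpace ℝ (Fin d), (∀ t, |w t - v t| ≤ |x t|) → ∀ l, |q' l w| ≤ K) :
    |q (v + x) - q v| ≤ K * ∑ l, |x l| := by
  classical
  -- `S` is the set of the coordinates that have already been moved.
  have key : ∀ S : Finset (Fin d),
      |q (v + ∑ l ∈ S, x l • EuclideanSpace.single l (1 : ℝ)) - q v| ≤ K * ∑ l ∈ S, |x l| := by
    intro S
    induction S using Finset.induction_on with
    | empty => simp
    | insert l S hl ih =>
      rw [Finset.sum_insert hl, Finset.sum_insert hl, mul_add]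
      set y := v + ∑ l ∈ S, x l • EuclideanSpace.single l (1 : ℝ) with hy
      have hys : ∀ t, y t = v t + if t ∈ S then x t else 0 := by
        intro t
        simp [hy, Pi.single_apply]
      have hstep : |q (y + x l • EuclideanSpace.single l (1 : ℝ)) - q y| ≤ K * |x l| := by
        have hφ : ∀ t : ℝ, HasDerivAt
            (fun t : ℝ => q (y + t • (x l • EuclideanSpace.single l (1 : ℝ))))
            (x l * q' l (y + (t * x l) • EuclideanSpace.single l (1 : ℝ))) t := by
          intro t
          have h1 := hasDerivAt_of_hasLineDerivAt (hq l) y (t * x l)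
          have h2 := h1.comp t ((hasDerivAt_id t).mul_const (x l))
          simpa [Function.comp_def, smul_smul, mul_comm] using h2
        have h3 := abs_sub_le_of_abs_deriv_le (B := fun t => (K * |x l|) * t)
          (B' := fun _ => K * |x l|) zero_le_one hφ
          (fun t => by simpa using (hasDerivAt_id t).const_mul (K * |x l|)) (by
            intro t ht
            rw [abs_mul, mul_comm]
            refine mul_le_mul_of_nonneg_right (hK _ (fun s => ?_) l) (abs_nonneg _)
            simp only [PiLp.add_apply, PiLp.smul_apply, hys, PiLp.single_apply,
              smul_eq_mul]
            by_cases hsl : s = l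
            · subst hsl
              simp only [hl, if_false, if_true, add_zero, mul_one, add_sub_cancel_left, abs_mul]
              rw [abs_of_nonneg ht.1]
              exact mul_le_of_le_one_left (abs_nonneg _) ht.2
            · by_cases hsS : s ∈ S <;> simp [hsl, hsS])
        simpa using h3
      have : v + (x l • EuclideanSpace.single l (1 : ℝ)
          + ∑ l ∈ S, x l • EuclideanSpace.single l (1 : ℝ))
          = y + x l • EuclideanSpace.single l (1 : ℝ) := by rw [hy]; abel
      rw [this]
      calc |q (y + x l • EuclideanSpace.single l (1 : ℝ)) - q v|
          ≤ |q (y + x l • EuclideanSpace.single l (1 : ℝ)) - q y| + |q y - q v| :=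
            abs_sub_le _ _ _
        _ ≤ _ := add_le_add hstep ih
  have hx : ∑ l, x l • EuclideanSpace.single l (1 : ℝ) = x := by
    ext t
    simp [Pi.single_apply]
  simpa [hx] using key Finset.univ

/-- Continuous partial derivatives give Fréchet differentiability. -/
lemma hasFDerivAt_of_partial {q : EuclideanSpace ℝ (Fin d) → ℝ}
    {q' : Fin d → EuclideanSpace ℝ (Fin d) → ℝ}
    (hq : ∀ l w, HasLineDerivAt ℝ q (q' l w) w (EuclideanSpace.single l 1))
    (hc : ∀ l, Continuous (q' l)) (v : EuclideanSpace ℝ (Fin d)) :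
    HasFDerivAt q (∑ l, q' l v • (EuclideanSpace.proj l : EuclideanSpace ℝ (Fin d) →L[ℝ] ℝ)) v := by
  rw [hasFDerivAt_iff_isLittleO_nhds_zero, Asymptotics.isLittleO_iff]
  intro ε hε
  obtain ⟨δ, hδ, hδ'⟩ : ∃ δ > 0, ∀ w, dist w v < δ → ∀ l, |q' l w - q' l v| ≤ ε / (d + 1) := by
    have h1 : ∀ᶠ w in nhds v, ∀ l, |q' l w - q' l v| ≤ ε / (d + 1) := by
      rw [Filter.eventually_all]
      intro l
      have := (hc l).continuousAt (x := v)
      have h2 := Metric.tendsto_nhds.1 this (ε / (d + 1)) (by positivity)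
      filter_upwards [h2] with w hw
      rw [Real.dist_eq] at hw
      exact hw.le
    obtain ⟨δ, hδ, h⟩ := Metric.eventually_nhds_iff.1 h1
    exact ⟨δ, hδ, fun w hw => h hw⟩
  filter_upwards [Metric.ball_mem_nhds (0 : EuclideanSpace ℝ (Fin d)) hδ] with x hx
  have hx' : ‖x‖ < δ := by simpa using hx
  let p : EuclideanSpace ℝ (Fin d) → ℝ := fun w => q w - ∑ l, q' l v * w l
  have hp : ∀ l w, HasLineDerivAt ℝ p (q' l w - q' l v) w (EuclideanSpace.single l 1) := by
    intro l w
    have h1 := hq l w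
    unfold HasLineDerivAt at h1 ⊢
    refine h1.sub ?_
    have : (fun t : ℝ => ∑ m, q' m v * (w + t • EuclideanSpace.single l (1 : ℝ)) m)
        = fun t => (∑ m, q' m v * w m) + t * q' l v := by
      funext t
      simp [mul_add, Finset.sum_add_distrib, mul_comm]
    rw [this]
    simpa using ((hasDerivAt_id (0 : ℝ)).mul_const (q' l v)).const_add (∑ m, q' m v * w m)
  have h1 := abs_add_sub_le_of_partial hp v x (K := ε / (d + 1)) (by
    intro w hw l
    refine hδ' w ?_ l
    refine lt_of_le_of_lt ?_ hx'
    rw [EuclideanSpace.dist_eq, EuclideanSpace.norm_eq]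
    refine Real.sqrt_le_sqrt (Finset.sum_le_sum fun t _ => ?_)
    rw [Real.dist_eq, Real.norm_eq_abs]
    exact pow_le_pow_left₀ (abs_nonneg _) (hw t) 2)
  have h2 : q (v + x) - q v
      - (∑ l, q' l v • (EuclideanSpace.proj l : EuclideanSpace ℝ (Fin d) →L[ℝ] ℝ)) x
      = p (v + x) - p v := by
    simp only [p, sum_apply, smul_apply,
      PiLp.proj_apply, smul_eq_mul, PiLp.add_apply, mul_add, Finset.sum_add_distrib]
    ring
  rw [h2, Real.norm_eq_abs]
  refine h1.trans ?_
  have h3 : ∑ l, |x l| ≤ d * ‖x‖ := by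
    calc ∑ l, |x l| ≤ ∑ _l : Fin d, ‖x‖ := Finset.sum_le_sum fun l _ => by
          simpa using PiLp.norm_apply_le x l
      _ = d * ‖x‖ := by simp
  calc ε / (d + 1) * ∑ l, |x l| ≤ ε / (d + 1) * (d * ‖x‖) := by gcongr
    _ = ε * ‖x‖ * (d / (d + 1)) := by ring
    _ ≤ ε * ‖x‖ * 1 := by
        gcongr
        rw [div_le_one (by positivity)]
        linarith
    _ = ε * ‖x‖ := mul_one _

lemma continuous_of_continuous_partial {q : EuclideanSpace ℝ (Fin d) → ℝ}
    {q' : Fin d → EuclideanSpace ℝ (Fin d) → ℝ}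
    (hq : ∀ l w, HasLineDerivAt ℝ q (q' l w) w (EuclideanSpace.single l 1))
    (hc : ∀ l, Continuous (q' l)) : Continuous q :=
  continuous_iff_continuousAt.2 fun v => (hasFDerivAt_of_partial hq hc v).continuousAt

/-- Chain rule along a curve. -/
lemma hasDerivAt_comp_of_partial {q : EuclideanSpace ℝ (Fin d) → ℝ}
    {q' : Fin d → EuclideanSpace ℝ (Fin d) → ℝ}
    (hq : ∀ l w, HasLineDerivAt ℝ q (q' l w) w (EuclideanSpace.single l 1))
    (hc : ∀ l, Continuous (q' l)) {c : ℝ → EuclideanSpace ℝ (Fin d)}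
    {c' : EuclideanSpace ℝ (Fin d)} {t : ℝ} (h : HasDerivAt c c' t) :
    HasDerivAt (fun t => q (c t)) (∑ l, c' l * q' l (c t)) t := by
  have := (hasFDerivAt_of_partial hq hc (c t)).comp_hasDerivAt t h
  simpa [Function.comp_def, mul_comm] using this

lemma box_smul {v x w : EuclideanSpace ℝ (Fin d)} {τ : ℝ} (hτ : τ ∈ Set.Icc (0 : ℝ) 1)
    (hw : ∀ t, |w t - v t| ≤ |(τ • x) t|) (t : Fin d) : |w t - v t| ≤ |x t| := by
  refine (hw t).trans ?_
  rw [PiLp.smul_apply, smul_eq_mul, abs_mul, abs_of_nonneg hτ.1]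
  exact mul_le_of_le_one_left (abs_nonneg _) hτ.2

/-- First order Taylor estimate, with the second partial derivatives bounded on a box. -/
lemma abs_taylor_one_le {q : EuclideanSpace ℝ (Fin d) → ℝ}
    {q' : Fin d → EuclideanSpace ℝ (Fin d) → ℝ}
    {q'' : Fin d → Fin d → EuclideanSpace ℝ (Fin d) → ℝ}
    (hq : ∀ l w, HasLineDerivAt ℝ q (q' l w) w (EuclideanSpace.single l 1))
    (hq' : ∀ m l w, HasLineDerivAt ℝ (q' l) (q'' m l w) w (EuclideanSpace.single m 1))
    (hc : ∀ l, Continuous (q' l)) (v x : EuclideanSpace ℝ (Fin d)) {K : ℝ}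
    (hK : ∀ w : EuclideanSpace ℝ (Fin d), (∀ t, |w t - v t| ≤ |x t|) → ∀ m l, |q'' m l w| ≤ K) :
    |q (v + x) - q v - ∑ l, x l * q' l v| ≤ K / 2 * (∑ l, |x l|) ^ 2 := by
  set s := ∑ l, |x l| with hs
  have hφ : ∀ t : ℝ, HasDerivAt (fun t : ℝ => q (v + t • x) - t * ∑ l, x l * q' l v)
      (∑ l, x l * (q' l (v + t • x) - q' l v)) t := by
    intro t
    have h1 : HasDerivAt (fun t : ℝ => v + t • x) x t := by
      simpa using ((hasDerivAt_id t).smul_const x).const_add v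
    have h2 := (hasDerivAt_comp_of_partial hq hc h1).sub
      ((hasDerivAt_id t).mul_const (∑ l, x l * q' l v))
    convert! h2 using 1
    simp [mul_sub, Finset.sum_sub_distrib]
  have h3 := abs_sub_le_of_abs_deriv_le (B := fun t => K / 2 * s ^ 2 * t ^ 2)
    (B' := fun t => K * s ^ 2 * t) zero_le_one hφ
    (fun t => by
      convert! (hasDerivAt_pow 2 t).const_mul (K / 2 * s ^ 2) using 1
      simp; ring) (by
      intro t ht
      refine (Finset.abs_sum_le_sum_abs _ _).trans ?_
      have h4 : ∀ l, |x l * (q' l (v + t • x) - q' l v)| ≤ |x l| * (K * s * t) := by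
        intro l
        rw [abs_mul]
        refine mul_le_mul_of_nonneg_left ?_ (abs_nonneg _)
        refine (abs_add_sub_le_of_partial (fun m w => hq' m l w) v (t • x) (K := K)
          (fun w hw m => hK w (box_smul ht hw) m l)).trans (le_of_eq ?_)
        simp only [PiLp.smul_apply, smul_eq_mul, abs_mul, abs_of_nonneg ht.1, ← Finset.mul_sum]
        ring
      refine (Finset.sum_le_sum fun l _ => h4 l).trans (le_of_eq ?_)
      rw [← Finset.sum_mul]
      ring)
  have e : q (v + x) - q v - ∑ l, x l * q' l v
      = q (v + (1 : ℝ) • x) - 1 * ∑ l, x l * q' l v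
        - (q (v + (0 : ℝ) • x) - 0 * ∑ l, x l * q' l v) := by
    simp; ring
  rw [e]
  refine h3.trans (le_of_eq ?_)
  ring

/-- Second order Taylor estimate, with the third partial derivatives bounded on a box. -/
lemma abs_taylor_two_le {q : EuclideanSpace ℝ (Fin d) → ℝ}
    {q' : Fin d → EuclideanSpace ℝ (Fin d) → ℝ}
    {q'' : Fin d → Fin d → EuclideanSpace ℝ (Fin d) → ℝ}
    {q''' : Fin d → Fin d → Fin d → EuclideanSpace ℝ (Fin d) → ℝ}
    (hq : ∀ l w, HasLineDerivAt ℝ q (q' l w) w (EuclideanSpace.single l 1))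
    (hq' : ∀ m l w, HasLineDerivAt ℝ (q' l) (q'' m l w) w (EuclideanSpace.single m 1))
    (hq'' : ∀ k m l w, HasLineDerivAt ℝ (q'' m l) (q''' k m l w) w (EuclideanSpace.single k 1))
    (hc : ∀ l, Continuous (q' l)) (hc' : ∀ m l, Continuous (q'' m l))
    (v x : EuclideanSpace ℝ (Fin d)) {K : ℝ}
    (hK : ∀ w : EuclideanSpace ℝ (Fin d), (∀ t, |w t - v t| ≤ |x t|) →
      ∀ k m l, |q''' k m l w| ≤ K) :
    |q (v + x) - q v - ∑ l, x l * q' l v - (∑ l, ∑ m, x l * x m * q'' m l v) / 2|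
      ≤ K / 6 * (∑ l, |x l|) ^ 3 := by
  set s := ∑ l, |x l| with hs
  have hφ : ∀ t : ℝ, HasDerivAt (fun t : ℝ => q (v + t • x) - t * ∑ l, x l * q' l v
        - t ^ 2 * ((∑ l, ∑ m, x l * x m * q'' m l v) / 2))
      (∑ l, x l * (q' l (v + t • x) - q' l v - ∑ m, (t • x) m * q'' m l v)) t := by
    intro t
    have h1 : HasDerivAt (fun t : ℝ => v + t • x) x t := by
      simpa using ((hasDerivAt_id t).smul_const x).const_add v
    have h2 := ((hasDerivAt_comp_of_partial hq hc h1).sub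
      ((hasDerivAt_id t).mul_const (∑ l, x l * q' l v))).sub
      ((hasDerivAt_pow 2 t).mul_const ((∑ l, ∑ m, x l * x m * q'' m l v) / 2))
    convert! h2 using 1
    have h3 : ∑ l, x l * ∑ m, (t • x) m * q'' m l v
        = t * ∑ l, ∑ m, x l * x m * q'' m l v := by
      simp only [Finset.mul_sum, PiLp.smul_apply, smul_eq_mul]
      refine Finset.sum_congr rfl fun l _ => Finset.sum_congr rfl fun m _ => ?_
      ring
    simp only [mul_sub, Finset.sum_sub_distrib, h3]
    simp
    ring
  have h3 := abs_sub_le_of_abs_deriv_le (B := fun t => K / 6 * s ^ 3 * t ^ 3)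
    (B' := fun t => K / 2 * s ^ 3 * t ^ 2) zero_le_one hφ
    (fun t => by
      convert! (hasDerivAt_pow 3 t).const_mul (K / 6 * s ^ 3) using 1
      simp; ring) (by
      intro t ht
      refine (Finset.abs_sum_le_sum_abs _ _).trans ?_
      have h4 : ∀ l, |x l * (q' l (v + t • x) - q' l v - ∑ m, (t • x) m * q'' m l v)|
          ≤ |x l| * (K / 2 * s ^ 2 * t ^ 2) := by
        intro l
        rw [abs_mul]
        refine mul_le_mul_of_nonneg_left ?_ (abs_nonneg _)
        refine (abs_taylor_one_le (fun m w => hq' m l w) (fun k m w => hq'' k m l w)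
          (fun m => hc' m l) v (t • x) (K := K)
          (fun w hw k m => hK w (box_smul ht hw) k m l)).trans (le_of_eq ?_)
        simp only [PiLp.smul_apply, smul_eq_mul, abs_mul, abs_of_nonneg ht.1, ← Finset.mul_sum]
        ring
      refine (Finset.sum_le_sum fun l _ => h4 l).trans (le_of_eq ?_)
      rw [← Finset.sum_mul]
      ring)
  have e : q (v + x) - q v - ∑ l, x l * q' l v - (∑ l, ∑ m, x l * x m * q'' m l v) / 2
      = q (v + (1 : ℝ) • x) - 1 * ∑ l, x l * q' l v
        - 1 ^ 2 * ((∑ l, ∑ m, x l * x m * q'' m l v) / 2)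
        - (q (v + (0 : ℝ) • x) - 0 * ∑ l, x l * q' l v
          - 0 ^ 2 * ((∑ l, ∑ m, x l * x m * q'' m l v) / 2)) := by
    simp; ring
  rw [e]
  refine h3.trans (le_of_eq ?_)
  ring

end Calculus

/-! ### Derivatives of a composition -/

section Composition

/-- All ways of putting the new element `j` in front of one of the blocks of `π`. -/
def blockInsertions {α : Type*} (j : α) : List (List α) → List (List (List α))
  | [] => []
  | b :: π => ((j :: b) :: π) :: (blockInsertions j π).map (b :: ·)

/-- The partitions of the positions of a list into nonempty blocks, each block recorded as the
list of the entries at its positions. -/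
def blockPartitions {α : Type*} : List α → List (List (List α))
  | [] => [[]]
  | j :: s => (blockPartitions s).flatMap fun π => ([j] :: π) :: blockInsertions j π

section Combinatorics

variable {α : Type*}

lemma sum_map_flatMap {β : Type*} (l : List α) (f : α → List β) (φ : β → ℝ) :
    ((l.flatMap f).map φ).sum = (l.map fun a => ((f a).map φ).sum).sum := by
  induction l with
  | nil => rfl
  | cons a l ih => simp [List.flatMap_cons, ih]

lemma length_blockInsertions (j : α) (π : List (List α)) :
    (blockInsertions j π).length = π.length := by
  induction π with
  | nil => rfl
  | cons b π ih => simp [blockInsertions, ih]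

lemma blockInsertions_spec (j : α) {π π' : List (List α)} (h : π' ∈ blockInsertions j π) :
    π'.length = π.length ∧ (π'.map List.length).sum = (π.map List.length).sum + 1 ∧
      ((∀ b ∈ π, b ≠ []) → ∀ b ∈ π', b ≠ []) := by
  induction π generalizing π' with
  | nil => simp [blockInsertions] at h
  | cons b π ih =>
    simp only [blockInsertions, List.mem_cons, List.mem_map] at h
    rcases h with rfl | ⟨π₁, h₁, rfl⟩
    · refine ⟨by simp, by simp; ring, fun hb c hc => ?_⟩
      rcases List.mem_cons.1 hc with rfl | hc
      · simp
      · exact hb c (List.mem_cons_of_mem _ hc)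
    · obtain ⟨h2, h3, h4⟩ := ih h₁
      refine ⟨by simp [h2], by simp [h3]; ring, fun hb c hc => ?_⟩
      rcases List.mem_cons.1 hc with rfl | hc
      · exact hb _ List.mem_cons_self
      · exact h4 (fun b hb' => hb b (List.mem_cons_of_mem _ hb')) c hc

lemma blockPartitions_spec {s : List α} {π : List (List α)} (h : π ∈ blockPartitions s) :
    (π.map List.length).sum = s.length ∧ ∀ b ∈ π, b ≠ [] := by
  induction s generalizing π with
  | nil =>
    obtain rfl : π = [] := by simpa [blockPartitions] using h
    simp
  | cons j s ih =>
    simp only [blockPartitions, List.mem_flatMap, List.mem_cons] at h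
    obtain ⟨π₁, h₁, rfl | h⟩ := h
    · obtain ⟨h2, h3⟩ := ih h₁
      refine ⟨by simp [h2]; ring, fun b hb => ?_⟩
      rcases List.mem_cons.1 hb with rfl | hb
      · simp
      · exact h3 b hb
    · obtain ⟨h2, h3⟩ := ih h₁
      obtain ⟨h4, h5, h6⟩ := blockInsertions_spec j h
      exact ⟨by simp [h5, h2], h6 h3⟩

lemma length_le_of_mem_blockPartitions {s b : List α} {π : List (List α)}
    (h : π ∈ blockPartitions s) (hb : b ∈ π) : b.length ≤ s.length := by
  rw [← (blockPartitions_spec h).1]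
  exact List.le_sum_of_mem (List.mem_map_of_mem hb)

lemma card_le_of_mem_blockPartitions {s : List α} {π : List (List α)}
    (h : π ∈ blockPartitions s) : π.length ≤ s.length := by
  obtain ⟨h1, h2⟩ := blockPartitions_spec h
  rw [← h1]
  clear h1 h
  induction π with
  | nil => simp
  | cons b π ih =>
    have h3 := ih fun c hc => h2 c (List.mem_cons_of_mem _ hc)
    have h4 := List.length_pos_of_ne_nil (h2 b List.mem_cons_self)
    simp only [List.length_cons, List.map_cons, List.sum_cons]
    omega

/-- There are `S(m, k)` partitions of `m` positions into `k` blocks. -/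
lemma sum_blockPartitions (s : List α) (φ : ℕ → ℝ) :
    ((blockPartitions s).map fun π => φ π.length).sum
      = ∑ k ∈ Finset.range (s.length + 1), (Nat.stirlingSecond s.length k : ℝ) * φ k := by
  induction s generalizing φ with
  | nil => simp [blockPartitions]
  | cons j s ih =>
    have h1 : ∀ π : List (List α),
        ((([j] :: π) :: blockInsertions j π).map fun π => φ π.length).sum
          = φ (π.length + 1) + π.length * φ π.length := by
      intro π
      have h2 : (blockInsertions j π).map (fun π => φ π.length)
          = (blockInsertions j π).map fun _ => φ π.length :=
        List.map_congr_left fun π' h => by rw [(blockInsertions_spec j h).1]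
      simp [h2, length_blockInsertions]
    have h3 : ((blockPartitions (j :: s)).map fun π => φ π.length).sum
        = ((blockPartitions s).map fun π =>
            (fun k : ℕ => φ (k + 1) + k * φ k) π.length).sum := by
      rw [blockPartitions, sum_map_flatMap]
      congr 1
      exact List.map_congr_left fun π _ => h1 π
    rw [h3, ih (fun k : ℕ => φ (k + 1) + k * φ k)]
    -- The rest is the recursion `S(m + 1, k + 1) = (k + 1) S(m, k + 1) + S(m, k)`.
    set m := s.length
    have h4 : (j :: s).length = m + 1 := rfl
    rw [h4, Finset.sum_range_succ' _ (m + 1)]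
    simp only [Nat.stirlingSecond_succ_zero, Nat.stirlingSecond_succ_succ, mul_add,
      Finset.sum_add_distrib, Nat.cast_add, Nat.cast_mul, add_mul, Nat.cast_zero, zero_mul,
      add_zero, Nat.cast_one]
    have h5 : ∑ k ∈ Finset.range (m + 1), (Nat.stirlingSecond m k : ℝ) * (k * φ k)
        = ∑ k ∈ Finset.range (m + 1), ((k : ℝ) * (Nat.stirlingSecond m (k + 1)) * φ (k + 1)
            + 1 * (Nat.stirlingSecond m (k + 1)) * φ (k + 1)) := by
      rw [Finset.sum_range_succ' _ m, Finset.sum_range_succ _ m,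
        Nat.stirlingSecond_eq_zero_of_lt (Nat.lt_succ_self m)]
      simp only [Nat.cast_zero, zero_mul, mul_zero, add_zero, Nat.cast_add, Nat.cast_one]
      exact Finset.sum_congr rfl fun k _ => by ring
    have h6 : ∑ k ∈ Finset.range (m + 1), (Nat.stirlingSecond m k : ℝ) * φ (k + 1)
        + ∑ k ∈ Finset.range (m + 1), (Nat.stirlingSecond m k : ℝ) * (k * φ k)
        = ∑ k ∈ Finset.range (m + 1), ((k : ℝ) * (Nat.stirlingSecond m (k + 1)) * φ (k + 1)
            + 1 * (Nat.stirlingSecond m (k + 1)) * φ (k + 1))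
          + ∑ k ∈ Finset.range (m + 1), (Nat.stirlingSecond m k : ℝ) * φ (k + 1) := by
      rw [h5, add_comm]
    rw [h6, Finset.sum_add_distrib]

end Combinatorics

variable {d : ℕ}

lemma hasLineDerivAt_iterPartial {m : ℕ} {A : ℝ} {B r : Fin d → ℝ}
    {g : EuclideanSpace ℝ (Fin d) → ℝ} (hg : MemCP m A B r g) {s : List (Fin d)}
    (hs : s.length < m) (j : Fin d) (w : EuclideanSpace ℝ (Fin d)) :
    HasLineDerivAt ℝ (iterPartial g s) (iterPartial g (j :: s) w) w
      (EuclideanSpace.single j 1) :=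
  (hg.exists_partial s hs j w).hasLineDerivAt

lemma hasLineDerivAt_prod_blocks {g : EuclideanSpace ℝ (Fin d) → ℝ} {j : Fin d}
    {w : EuclideanSpace ℝ (Fin d)} {π : List (List (Fin d))}
    (h : ∀ b ∈ π, HasLineDerivAt ℝ (iterPartial g b) (iterPartial g (j :: b) w) w
      (EuclideanSpace.single j 1)) :
    HasLineDerivAt ℝ (fun w => (π.map fun b => iterPartial g b w).prod)
      ((blockInsertions j π).map fun π' => (π'.map fun b => iterPartial g b w).prod).sum w
      (EuclideanSpace.single j 1) := by
  induction π with
  | nil => simpa [HasLineDerivAt, blockInsertions] using hasDerivAt_const (0 : ℝ) (1 : ℝ)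
  | cons b π ih =>
    have h1 := h b List.mem_cons_self
    have h2 := ih fun c hc => h c (List.mem_cons_of_mem _ hc)
    unfold HasLineDerivAt at h1 h2 ⊢
    simp only [blockInsertions, List.map_cons, List.prod_cons, List.sum_cons, List.map_map,
      Function.comp_def, List.sum_map_mul_left]
    convert! h1.mul h2 using 1
    simp

/-- Faà di Bruno's formula for the iterated partial derivatives of `h ∘ g`. -/
lemma iterPartial_comp {m : ℕ} {A : ℝ} {B r : Fin d → ℝ}
    {g : EuclideanSpace ℝ (Fin d) → ℝ} (hg : MemCP m A B r g) {h : ℝ → ℝ} (hh : MemCb m h)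
    (s : List (Fin d)) (hs : s.length ≤ m) :
    (iterPartial (fun w => h (g w)) s = fun w => ((blockPartitions s).map fun π =>
      iteratedDeriv π.length h (g w) * (π.map fun b => iterPartial g b w).prod).sum) ∧
    (s.length < m → ∀ j w, LineDifferentiableAt ℝ (iterPartial (fun w => h (g w)) s) w
      (EuclideanSpace.single j 1)) := by
  have key : ∀ s : List (Fin d), s.length < m → ∀ j w, HasLineDerivAt ℝ
      (fun w => ((blockPartitions s).map fun π =>
        iteratedDeriv π.length h (g w) * (π.map fun b => iterPartial g b w).prod).sum)
      ((blockPartitions (j :: s)).map fun π =>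
        iteratedDeriv π.length h (g w) * (π.map fun b => iterPartial g b w).prod).sum
      w (EuclideanSpace.single j 1) := by
    intro s hs j w
    rw [blockPartitions, sum_map_flatMap]
    have hterm : ∀ π ∈ blockPartitions s, HasLineDerivAt ℝ
        (fun w => iteratedDeriv π.length h (g w) * (π.map fun b => iterPartial g b w).prod)
        ((([j] :: π) :: blockInsertions j π).map fun π =>
          iteratedDeriv π.length h (g w) * (π.map fun b => iterPartial g b w).prod).sum
        w (EuclideanSpace.single j 1) := by
      intro π hπ
      have h1 := hasLineDerivAt_prod_blocks (g := g) (j := j) (w := w) (π := π) fun b hb =>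
        hasLineDerivAt_iterPartial hg
          ((length_le_of_mem_blockPartitions hπ hb).trans_lt hs) j w
      have h2 := hasLineDerivAt_iterPartial hg (s := []) (by simp; omega) j w
      have h3 := hh.differentiable π.length
        ((card_le_of_mem_blockPartitions hπ).trans_lt hs) (g w)
      have h4 : (blockInsertions j π).map (fun π =>
            iteratedDeriv π.length h (g w) * (π.map fun b => iterPartial g b w).prod)
          = (blockInsertions j π).map (fun π' =>
            iteratedDeriv π.length h (g w) * (π'.map fun b => iterPartial g b w).prod) :=
        List.map_congr_left fun π' h => by rw [(blockInsertions_spec j h).1]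
      unfold HasLineDerivAt at h1 h2 ⊢
      have h5 : HasDerivAt (fun t : ℝ => iteratedDeriv π.length h
          (g (w + t • EuclideanSpace.single j (1 : ℝ))))
          (iteratedDeriv (π.length + 1) h (g w) * iterPartial g [j] w) 0 := by
        have h6 := h3.hasDerivAt
        rw [← iteratedDeriv_succ] at h6
        refine HasDerivAt.comp (h₂ := iteratedDeriv π.length h) (0 : ℝ) ?_ h2
        simpa [iterPartial] using h6
      have h7 := h5.mul h1
      simp only [List.map_cons, List.sum_cons, h4, List.length_cons, List.prod_cons,
        List.sum_map_mul_left]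
      convert! h7 using 1
      simp only [zero_smul, add_zero]
      ring
    unfold HasLineDerivAt at hterm ⊢
    generalize blockPartitions s = Q at hterm
    induction Q with
    | nil => simpa using hasDerivAt_const (0 : ℝ) (0 : ℝ)
    | cons π Q ih =>
      simp only [List.map_cons, List.sum_cons]
      exact (hterm π List.mem_cons_self).add
        (ih fun c hc => hterm c (List.mem_cons_of_mem _ hc))
  have heq : iterPartial (fun w => h (g w)) s = fun w => ((blockPartitions s).map fun π =>
      iteratedDeriv π.length h (g w) * (π.map fun b => iterPartial g b w).prod).sum := by
    induction s with
    | nil => simp [iterPartial, blockPartitions]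
    | cons j s ih =>
      have hs' : s.length < m := by simpa using hs
      rw [iterPartial, ih hs'.le]
      exact funext fun w => (key s hs' j w).lineDeriv
  refine ⟨heq, fun hs' j w => ?_⟩
  rw [heq]
  exact (key s hs' j w).lineDifferentiableAt

lemma polyDom_nonneg {A : ℝ} {B r : Fin d → ℝ} (hA : 0 ≤ A) (hB : ∀ i, 0 ≤ B i)
    (w : EuclideanSpace ℝ (Fin d)) : 0 ≤ polyDom A B r w :=
  add_nonneg hA (Finset.sum_nonneg fun i _ =>
    mul_nonneg (hB i) (Real.rpow_nonneg (abs_nonneg _) _))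

lemma abs_iteratedDeriv_le_iSup {m : ℕ} {h : ℝ → ℝ} (hh : MemCb m h) {k : ℕ} (hk : 1 ≤ k)
    (hkm : k ≤ m) (x : ℝ) : |iteratedDeriv k h x| ≤ ⨆ x : ℝ, |iteratedDeriv k h x| := by
  obtain ⟨C, hC⟩ := hh.bounded k hk hkm
  exact le_ciSup (f := fun x : ℝ => |iteratedDeriv k h x|)
    ⟨C, by rintro _ ⟨y, rfl⟩; exact hC y⟩ x

lemma hSum_nonneg (m : ℕ) (h : ℝ → ℝ) : 0 ≤ hSum m h :=
  Finset.sum_nonneg fun _ _ => mul_nonneg (Nat.cast_nonneg _)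
    (Real.iSup_nonneg fun _ => abs_nonneg _)

/-- Every term of Faà di Bruno's formula is homogeneous of total order `s.length`, so that the
domination `|∂^k g| ≤ P ^ (k / m)` multiplies up to `P ^ (s.length / m)`. -/
lemma abs_iterPartial_comp_le {m : ℕ} {A : ℝ} {B r : Fin d → ℝ}
    {g : EuclideanSpace ℝ (Fin d) → ℝ} (hg : MemCP m A B r g) {h : ℝ → ℝ} (hh : MemCb m h)
    {s : List (Fin d)} (hs1 : 1 ≤ s.length) (hs : s.length ≤ m) (w : EuclideanSpace ℝ (Fin d)) :
    |iterPartial (fun w => h (g w)) s w|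
      ≤ hSum s.length h * polyDom A B r w ^ ((s.length : ℝ) / m) := by
  set p := polyDom A B r w with hp
  have hp0 : 0 ≤ p := polyDom_nonneg hg.nonneg_A hg.nonneg_B w
  have hm : (0 : ℝ) < m := by exact_mod_cast (by omega : 0 < m)
  have hb : ∀ b : List (Fin d), b ≠ [] → b.length ≤ m →
      |iterPartial g b w| ≤ p ^ ((b.length : ℝ) / m) := by
    intro b hb hbm
    have hb1 : 1 ≤ b.length := List.length_pos_of_ne_nil hb
    have hbp : (0 : ℝ) < b.length := by exact_mod_cast hb1
    have h1 := hg.dominated b hb1 hbm w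
    calc |iterPartial g b w|
        = (|iterPartial g b w| ^ ((m : ℝ) / b.length)) ^ ((b.length : ℝ) / m) := by
          rw [← Real.rpow_mul (abs_nonneg _)]
          rw [show (m : ℝ) / b.length * (b.length / m) = 1 by field_simp, Real.rpow_one]
      _ ≤ _ := Real.rpow_le_rpow (Real.rpow_nonneg (abs_nonneg _) _) h1 (by positivity)
  have hprod : ∀ π : List (List (Fin d)), (∀ b ∈ π, b ≠ []) → (∀ b ∈ π, b.length ≤ m) →
      |(π.map fun b => iterPartial g b w).prod| ≤ p ^ (((π.map List.length).sum : ℝ) / m) := by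
    intro π h1 h2
    induction π with
    | nil => simp
    | cons b π ih =>
      have h3 := ih (fun c hc => h1 c (List.mem_cons_of_mem _ hc))
        (fun c hc => h2 c (List.mem_cons_of_mem _ hc))
      have h4 := hb b (h1 b List.mem_cons_self) (h2 b List.mem_cons_self)
      simp only [List.map_cons, List.prod_cons, List.sum_cons, abs_mul, Nat.cast_add, add_div]
      rw [Real.rpow_add_of_nonneg hp0 (by positivity) (by positivity)]
      exact mul_le_mul h4 h3 (abs_nonneg _) (Real.rpow_nonneg hp0 _)
  -- A nonempty list has no partition into `0` blocks, so the undifferentiated `h`, which may be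
  -- unbounded, does not occur.
  let φ : ℕ → ℝ := fun k => if k = 0 then 0 else ⨆ x : ℝ, |iteratedDeriv k h x|
  have hterm : ∀ π ∈ blockPartitions s,
      |iteratedDeriv π.length h (g w) * (π.map fun b => iterPartial g b w).prod|
        ≤ φ π.length * p ^ ((s.length : ℝ) / m) := by
    intro π hπ
    obtain ⟨h1, h2⟩ := blockPartitions_spec hπ
    have h3 : π.length ≠ 0 := by
      intro h0
      have : π = [] := List.eq_nil_of_length_eq_zero h0
      subst this
      simp at h1
      omega
    rw [abs_mul]
    refine mul_le_mul ?_ ?_ (abs_nonneg _) ?_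
    · simp only [φ, h3, if_false]
      exact abs_iteratedDeriv_le_iSup hh (Nat.one_le_iff_ne_zero.2 h3)
        ((card_le_of_mem_blockPartitions hπ).trans hs) _
    · rw [← h1]
      exact hprod π h2 fun b hb => (length_le_of_mem_blockPartitions hπ hb).trans hs
    · simp only [φ, h3, if_false]
      exact Real.iSup_nonneg fun _ => abs_nonneg _
  rw [(iterPartial_comp hg hh s hs).1]
  have habs : ∀ Q : List (List (List (Fin d))), (∀ π ∈ Q,
      |iteratedDeriv π.length h (g w) * (π.map fun b => iterPartial g b w).prod|
        ≤ φ π.length * p ^ ((s.length : ℝ) / m)) →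
      |(Q.map fun π => iteratedDeriv π.length h (g w)
        * (π.map fun b => iterPartial g b w).prod).sum|
      ≤ (Q.map fun π => φ π.length * p ^ ((s.length : ℝ) / m)).sum := by
    intro Q hQ
    induction Q with
    | nil => simp
    | cons π Q ih =>
      simp only [List.map_cons, List.sum_cons]
      exact (abs_add_le _ _).trans (add_le_add (hQ π List.mem_cons_self)
        (ih fun c hc => hQ c (List.mem_cons_of_mem _ hc)))
  refine (habs _ hterm).trans (le_of_eq ?_)
  rw [List.sum_map_mul_right, sum_blockPartitions s φ]
  congr 1
  rw [hSum, Finset.sum_range_succ', Finset.range_eq_Ico,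
    Finset.sum_Ico_add' (fun k => (Nat.stirlingSecond s.length k : ℝ) * φ k)]
  simp only [φ, if_true, mul_zero, add_zero, zero_add]
  refine Finset.sum_congr (by ext; simp) fun k hk => ?_
  rw [if_neg (by simp at hk; omega)]

lemma hasLineDerivAt_iterPartial_comp {m : ℕ} {A : ℝ} {B r : Fin d → ℝ}
    {g : EuclideanSpace ℝ (Fin d) → ℝ} (hg : MemCP m A B r g) {h : ℝ → ℝ} (hh : MemCb m h)
    {s : List (Fin d)} (hs : s.length < m) (j : Fin d) (w : EuclideanSpace ℝ (Fin d)) :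
    HasLineDerivAt ℝ (iterPartial (fun w => h (g w)) s)
      (iterPartial (fun w => h (g w)) (j :: s) w) w (EuclideanSpace.single j 1) :=
  ((iterPartial_comp hg hh s hs.le).2 hs j w).hasLineDerivAt

/-- The iterated partial derivatives of odd order of an even function are odd, those of even
order are even. -/
lemma iterPartial_neg {f : EuclideanSpace ℝ (Fin d) → ℝ} (hf : ∀ w, f (-w) = f w)
    (s : List (Fin d)) (w : EuclideanSpace ℝ (Fin d)) :
    iterPartial f s (-w) = (-1) ^ s.length * iterPartial f s w := by
  induction s generalizing w with
  | nil => simp [iterPartial, hf]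
  | cons j s ih =>
    simp only [iterPartial, lineDeriv, List.length_cons, pow_succ]
    have h1 : (fun t : ℝ => iterPartial f s (-w + t • EuclideanSpace.single j (1 : ℝ)))
        = fun t => (-1) ^ s.length *
          (fun t => iterPartial f s (w + t • EuclideanSpace.single j (1 : ℝ))) (-t) := by
      funext t
      rw [← ih]
      congr 1
      simp
      abel
    rw [h1, deriv_const_mul_field, deriv_comp_neg (f := fun t : ℝ =>
      iterPartial f s (w + t • EuclideanSpace.single j (1 : ℝ)))]
    simp

end Composition

/-! ### Gaussian measures -/

section Gaussian

lemma integrable_gaussianReal_iff {f : ℝ → ℝ} :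
    Integrable f (gaussianReal 0 1) ↔ Integrable (fun x => gaussianPDFReal 0 1 x * f x) := by
  rw [gaussianReal_of_var_ne_zero _ one_ne_zero,
    integrable_withDensity_iff_integrable_smul' (measurable_gaussianPDF _ _)
      (Filter.Eventually.of_forall fun _ => gaussianPDF_lt_top)]
  simp [toReal_gaussianPDF]

/-- Gaussian integration by parts on the line. -/
lemma integral_mul_gaussianReal {f f' : ℝ → ℝ} (hf : ∀ x, HasDerivAt f (f' x) x)
    (h0 : Integrable f (gaussianReal 0 1)) (h1 : Integrable (fun x => x * f x) (gaussianReal 0 1))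
    (h2 : Integrable f' (gaussianReal 0 1)) :
    ∫ x, x * f x ∂(gaussianReal 0 1) = ∫ x, f' x ∂(gaussianReal 0 1) := by
  rw [integrable_gaussianReal_iff] at h0 h1 h2
  rw [integral_gaussianReal_eq_integral_smul one_ne_zero,
    integral_gaussianReal_eq_integral_smul one_ne_zero]
  simp only [smul_eq_mul]
  have hp : ∀ x, HasDerivAt (gaussianPDFReal 0 1) (-x * gaussianPDFReal 0 1 x) x := by
    intro x
    rw [gaussianPDFReal_def]
    have h3 : HasDerivAt (fun x : ℝ => -(x - 0) ^ 2 / (2 * ((1 : NNReal) : ℝ))) (-x) x := by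
      have := ((((hasDerivAt_id x).sub_const 0).pow 2).neg).div_const (2 * ((1 : NNReal) : ℝ))
      convert! this using 1
      simp
      ring
    have h4 := h3.exp.const_mul ((√(2 * Real.pi * ((1 : NNReal) : ℝ)))⁻¹)
    convert! h4 using 1
    ring
  have key := integral_eq_zero_of_hasDerivAt_of_integrable
    (f := fun x => gaussianPDFReal 0 1 x * f x)
    (f' := fun x => gaussianPDFReal 0 1 x * f' x - gaussianPDFReal 0 1 x * (x * f x))
    (fun x => by
      convert! (hp x).mul (hf x) using 1
      ring) (h2.sub h1) h0
  rw [integral_sub h2 h1] at key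
  linarith

/-- The absolute moments of the standard normal law satisfy `E|2N|^r ≥ 1`. By log-convexity of
the Gamma function this reduces to the sign of the derivative at `r = 0`, where it amounts to
`γ ≤ log 2` for the Euler–Mascheroni constant `γ`. -/
lemma one_le_two_rpow_mul_integral_abs_rpow {r : ℝ} (hr : 0 ≤ r) :
    1 ≤ 2 ^ r * ∫ x, |x| ^ r ∂(gaussianReal 0 1) := by
  have h1 : ∫ x, |x| ^ r ∂(gaussianReal 0 1)
      = 2 ^ (r / 2) * Real.Gamma ((r + 1) / 2) / √Real.pi := by
    rw [integral_gaussianReal_eq_integral_smul one_ne_zero]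
    have h2 : ∀ x : ℝ, gaussianPDFReal 0 1 x • |x| ^ r
        = (fun y : ℝ => (√(2 * Real.pi))⁻¹ * (y ^ r * Real.exp (-(1 / 2) * y ^ (2 : ℝ)))) |x| := by
      intro x
      simp only [gaussianPDFReal_def, smul_eq_mul, NNReal.coe_one, mul_one, sub_zero,
        Real.rpow_two, sq_abs]
      rw [show -x ^ 2 / 2 = -(1 / 2) * x ^ 2 by ring]
      ring
    simp only [h2]
    rw [integral_comp_abs (f := fun y : ℝ =>
      (√(2 * Real.pi))⁻¹ * (y ^ r * Real.exp (-(1 / 2) * y ^ (2 : ℝ)))),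
      integral_const_mul, integral_rpow_mul_exp_neg_mul_rpow (by norm_num) (by linarith)
        (by norm_num)]
    have h3 : (1 / 2 : ℝ) ^ (-(r + 1) / 2) = 2 ^ (r / 2) * √2 := by
      rw [one_div, Real.inv_rpow (by norm_num), ← Real.rpow_neg (by norm_num),
        Real.sqrt_eq_rpow, ← Real.rpow_add (by norm_num)]
      congr 1
      ring
    rw [h3, Real.sqrt_mul (by norm_num)]
    field_simp
  -- The tangent to `log Γ` at `1 / 2` lies below the graph.
  have h4 : Real.log (Real.Gamma (1 / 2)) + r / 2 * (-(Real.eulerMascheroniConstant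
      + 2 * Real.log 2)) ≤ Real.log (Real.Gamma ((r + 1) / 2)) := by
    rcases hr.eq_or_lt with rfl | hr
    · simp
    have hd : HasDerivAt (Real.log ∘ Real.Gamma)
        (-(Real.eulerMascheroniConstant + 2 * Real.log 2)) (1 / 2) := by
      have hG : Real.Gamma (1 / 2) ≠ 0 := (Real.Gamma_pos_of_pos (by norm_num)).ne'
      have := (Real.hasDerivAt_log hG).comp (1 / 2 : ℝ) Real.hasDerivAt_Gamma_one_half
      convert! this using 1
      rw [Real.Gamma_one_half_eq]
      have : √Real.pi ≠ 0 := (Real.sqrt_pos.2 Real.pi_pos).ne'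
      field_simp
    have h5 := Real.convexOn_log_Gamma.le_slope_of_hasDerivAt (x := 1 / 2) (y := (r + 1) / 2)
      (by norm_num) (by simp; linarith) (by linarith) hd
    rw [slope_def_field, le_div_iff₀ (by linarith)] at h5
    simp only [Function.comp_apply] at h5
    linarith
  have h6 : Real.eulerMascheroniConstant ≤ Real.log 2 := by
    have := Real.eulerMascheroniConstant_lt_two_thirds
    have := Real.log_two_gt_d9
    linarith
  have hG : 0 < Real.Gamma ((r + 1) / 2) := Real.Gamma_pos_of_pos (by linarith)
  have hpi : 0 < √Real.pi := Real.sqrt_pos.2 Real.pi_pos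
  rw [h1, ← mul_div_assoc, one_le_div hpi, ← mul_assoc, ← Real.rpow_add (by norm_num),
    ← Real.Gamma_one_half_eq, ← Real.log_le_log_iff (by rw [Real.Gamma_one_half_eq]; exact hpi)
      (by positivity), Real.log_mul (by positivity) hG.ne', Real.log_rpow (by norm_num)]
  nlinarith

variable {d : ℕ}

/-- Gaussian integration by parts in the direction of one coordinate. -/
lemma integral_coord_mul_stdGaussian {G G' : EuclideanSpace ℝ (Fin d) → ℝ} {l : Fin d}
    (hG : ∀ w, HasLineDerivAt ℝ G (G' w) w (EuclideanSpace.single l 1))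
    (h0 : Integrable G (stdGaussian (EuclideanSpace ℝ (Fin d))))
    (h1 : Integrable (fun z => z l * G z) (stdGaussian (EuclideanSpace ℝ (Fin d))))
    (h2 : Integrable G' (stdGaussian (EuclideanSpace ℝ (Fin d)))) :
    ∫ z, z l * G z ∂(stdGaussian (EuclideanSpace ℝ (Fin d)))
      = ∫ z, G' z ∂(stdGaussian (EuclideanSpace ℝ (Fin d))) := by
  obtain ⟨m, rfl⟩ : ∃ m, d = m + 1 := ⟨d - 1, by have := l.pos; omega⟩
  let ψ : ℝ × (Fin m → ℝ) → EuclideanSpace ℝ (Fin (m + 1)) :=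
    fun p => WithLp.toLp 2 (l.insertNth p.1 p.2 : Fin (m + 1) → ℝ)
  have hψ : MeasurePreserving ψ
      ((gaussianReal 0 1).prod (Measure.pi fun _ : Fin m => gaussianReal 0 1))
      (stdGaussian (EuclideanSpace ℝ (Fin (m + 1)))) := by
    have ha := (measurePreserving_piFinSuccAbove (α := fun _ : Fin (m + 1) => ℝ)
      (fun _ => gaussianReal 0 1) l).symm
    have hb : MeasurePreserving (WithLp.toLp 2 : (Fin (m + 1) → ℝ) → _)
        (Measure.pi (fun _ : Fin (m + 1) => gaussianReal 0 1))
        (stdGaussian (EuclideanSpace ℝ (Fin (m + 1)))) :=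
      ⟨by fun_prop, map_pi_eq_stdGaussian⟩
    exact hb.comp ha
  have i0 := hψ.integrable_comp_of_integrable h0
  have i1 := hψ.integrable_comp_of_integrable h1
  have i2 := hψ.integrable_comp_of_integrable h2
  have e1 := integral_map (μ := (gaussianReal 0 1).prod (Measure.pi fun _ : Fin m =>
    gaussianReal 0 1)) hψ.measurable.aemeasurable (by rw [hψ.map_eq]; exact h1.aestronglyMeasurable)
  have e2 := integral_map (μ := (gaussianReal 0 1).prod (Measure.pi fun _ : Fin m =>
    gaussianReal 0 1)) hψ.measurable.aemeasurable (by rw [hψ.map_eq]; exact h2.aestronglyMeasurable)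
  rw [hψ.map_eq] at e1 e2
  rw [e1, e2]
  have f1 := integral_prod_symm _ i1
  have f2 := integral_prod_symm _ i2
  simp only [Function.comp_def] at f1 f2
  rw [f1, f2]
  refine integral_congr_ae ?_
  filter_upwards [i0.prod_left_ae, i1.prod_left_ae, i2.prod_left_ae] with y j0 j1 j2
  have hl : ∀ x, (ψ (x, y)) l = x := fun x => by simp [ψ]
  simp only [Function.comp_def, hl] at j0 j1 j2 ⊢
  refine integral_mul_gaussianReal (fun x => ?_) j0 j1 j2
  have h3 := hasDerivAt_of_hasLineDerivAt hG (ψ (0, y)) x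
  have h4 : ∀ x : ℝ, ψ (0, y) + x • EuclideanSpace.single l (1 : ℝ) = ψ (x, y) := by
    intro x
    ext t
    refine Fin.succAboveCases l ?_ (fun i => ?_) t
    · simp [ψ]
    · simp [ψ, Fin.succAbove_ne]
  simpa only [h4] using h3

lemma integrable_one_add_norm_rpow (ν : Measure (EuclideanSpace ℝ (Fin d))) [IsGaussian ν] (a : ℝ) :
    Integrable (fun z => (1 + ‖z‖) ^ a) ν := by
  have h1 : Integrable (fun z => (1 + ‖z‖) ^ (max a 1)) ν := by
    have hp : ENNReal.ofReal (max a 1) ≠ ⊤ := ENNReal.ofReal_ne_top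
    have h := (memLp_const (1 : ℝ)).add (IsGaussian.memLp_id ν _ hp).norm
    have h' := h.integrable_norm_rpow (by simp) hp
    rw [ENNReal.toReal_ofReal (by positivity)] at h'
    refine h'.congr (Filter.Eventually.of_forall fun z => ?_)
    simp only [Pi.add_apply, id_eq, Real.norm_eq_abs]
    rw [abs_of_nonneg (by positivity)]
  refine h1.mono' (Measurable.aestronglyMeasurable (by fun_prop)) (Filter.Eventually.of_forall fun z => ?_)
  rw [Real.norm_eq_abs, abs_of_nonneg (by positivity)]
  exact Real.rpow_le_rpow_of_exponent_le (by linarith [norm_nonneg z]) (le_max_left _ _)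

lemma integrable_of_growth (ν : Measure (EuclideanSpace ℝ (Fin d))) [IsGaussian ν]
    {f : EuclideanSpace ℝ (Fin d) → ℝ} (hf : Measurable f) {C a : ℝ}
    (h : ∀ z, |f z| ≤ C * (1 + ‖z‖) ^ a) : Integrable f ν :=
  ((integrable_one_add_norm_rpow ν a).const_mul C).mono' hf.aestronglyMeasurable
    (Filter.Eventually.of_forall h)

lemma isHermitian_sqrt (S : Matrix (Fin d) (Fin d) ℝ) : (CFC.sqrt S).IsHermitian :=
  (CFC.sqrt_nonneg S).isSelfAdjoint

lemma sqrtMul_apply (S : Matrix (Fin d) (Fin d) ℝ) (z : EuclideanSpace ℝ (Fin d)) (j : Fin d) :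
    sqrtMul S z j = ∑ l, CFC.sqrt S j l * z l := by
  simp [sqrtMul, Matrix.mulVec, dotProduct]

lemma map_sqrtMul_stdGaussian (S : Matrix (Fin d) (Fin d) ℝ) :
    (stdGaussian (EuclideanSpace ℝ (Fin d))).map (sqrtMul S) = multivariateGaussian 0 S := by
  simp only [multivariateGaussian, zero_add]
  rfl

lemma continuous_sqrtMul (S : Matrix (Fin d) (Fin d) ℝ) : Continuous (sqrtMul S) :=
  (Matrix.toEuclideanCLM (𝕜 := ℝ) (CFC.sqrt S)).continuous

lemma integral_multivariateGaussian (S : Matrix (Fin d) (Fin d) ℝ)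
    {F : EuclideanSpace ℝ (Fin d) → ℝ} (hF : Measurable F) :
    ∫ y, F y ∂(multivariateGaussian 0 S)
      = ∫ z, F (sqrtMul S z) ∂(stdGaussian (EuclideanSpace ℝ (Fin d))) := by
  rw [← map_sqrtMul_stdGaussian, integral_map (continuous_sqrtMul S).measurable.aemeasurable
    hF.aestronglyMeasurable]

/-- Gaussian integration by parts (Stein's identity) for a centred multivariate normal law. -/
lemma integral_coord_mul_multivariateGaussian {S : Matrix (Fin d) (Fin d) ℝ} (hS : S.PosSemidef)
    {F : EuclideanSpace ℝ (Fin d) → ℝ} {F' : Fin d → EuclideanSpace ℝ (Fin d) → ℝ}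
    (hF : ∀ k w, HasLineDerivAt ℝ F (F' k w) w (EuclideanSpace.single k 1))
    (hc : ∀ k, Continuous (F' k)) {C a : ℝ} (ha : 0 ≤ a)
    (hg : ∀ z, |F z| ≤ C * (1 + ‖z‖) ^ a) (hg' : ∀ k z, |F' k z| ≤ C * (1 + ‖z‖) ^ a)
    (j : Fin d) :
    ∫ y, y j * F y ∂(multivariateGaussian 0 S)
      = ∑ k, S j k * ∫ y, F' k y ∂(multivariateGaussian 0 S) := by
  have hFc : Continuous F := continuous_of_continuous_partial hF hc
  set R := CFC.sqrt S with hR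
  have hRR : ∀ j k, ∑ l, R j l * R k l = S j k := by
    intro j k
    have h1 : R * R = S := CFC.sqrt_mul_sqrt_self S hS.nonneg
    conv_rhs => rw [← h1, Matrix.mul_apply]
    refine Finset.sum_congr rfl fun l _ => ?_
    have := (isHermitian_sqrt S).apply l k
    simp only [star_trivial] at this
    rw [hR, this]
  have hgrow : ∀ {f : EuclideanSpace ℝ (Fin d) → ℝ}, Continuous f →
      (∀ z, |f z| ≤ C * (1 + ‖z‖) ^ a) → ∃ C', ∀ z, |f (sqrtMul S z)| ≤ C' * (1 + ‖z‖) ^ a := by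
    intro f _ hf
    set N := ‖Matrix.toEuclideanCLM (𝕜 := ℝ) R‖
    have hC : 0 ≤ C := by
      have := (abs_nonneg _).trans (hf 0)
      simpa using this
    refine ⟨C * (1 + N) ^ a, fun z => (hf _).trans ?_⟩
    rw [mul_assoc, ← Real.mul_rpow (by positivity) (by positivity)]
    refine mul_le_mul_of_nonneg_left (Real.rpow_le_rpow (by positivity) ?_ ha) hC
    have h1 : ‖sqrtMul S z‖ ≤ N * ‖z‖ := ContinuousLinearMap.le_opNorm _ _
    nlinarith [norm_nonneg z, norm_nonneg (Matrix.toEuclideanCLM (𝕜 := ℝ) R)]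
  have hcoord : ∀ {f : EuclideanSpace ℝ (Fin d) → ℝ}, Continuous f →
      (∀ z, |f z| ≤ C * (1 + ‖z‖) ^ a) → ∀ l : Fin d, Integrable (fun z => z l * f (sqrtMul S z))
        (stdGaussian (EuclideanSpace ℝ (Fin d))) := by
    intro f hfc hf l
    obtain ⟨C', h⟩ := hgrow hfc hf
    have hm : Measurable (fun z : EuclideanSpace ℝ (Fin d) => z l * f (sqrtMul S z)) :=
      Measurable.mul (by fun_prop) (hfc.comp (continuous_sqrtMul S)).measurable
    refine integrable_of_growth _ hm (C := C') (a := a + 1) fun z => ?_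
    rw [Real.rpow_add_one (by positivity), ← mul_assoc, abs_mul, mul_comm]
    have hz : |z l| ≤ 1 + ‖z‖ := by
      have := PiLp.norm_apply_le z l
      rw [Real.norm_eq_abs] at this
      linarith
    exact mul_le_mul (h z) hz (abs_nonneg _) ((abs_nonneg _).trans (h z))
  have hint : ∀ {f : EuclideanSpace ℝ (Fin d) → ℝ}, Continuous f →
      (∀ z, |f z| ≤ C * (1 + ‖z‖) ^ a) → Integrable (fun z => f (sqrtMul S z))
        (stdGaussian (EuclideanSpace ℝ (Fin d))) := by
    intro f hfc hf
    obtain ⟨C', h⟩ := hgrow hfc hf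
    exact integrable_of_growth _ (hfc.comp (continuous_sqrtMul S)).measurable h
  rw [integral_multivariateGaussian S (F := fun y => y j * F y)
    (Measurable.mul (by fun_prop) hFc.measurable)]
  have hstep : ∀ l, ∫ z, z l * F (sqrtMul S z) ∂(stdGaussian (EuclideanSpace ℝ (Fin d)))
      = ∑ k, R k l * ∫ y, F' k y ∂(multivariateGaussian 0 S) := by
    intro l
    rw [integral_coord_mul_stdGaussian (G := fun z => F (sqrtMul S z))
      (G' := fun z => ∑ k, R k l * F' k (sqrtMul S z)) ?_ (hint hFc hg) (hcoord hFc hg l)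
      (integrable_finsetSum _ fun k _ => (hint (hc k) (hg' k)).const_mul _)]
    · rw [integral_finsetSum _ fun k _ => (hint (hc k) (hg' k)).const_mul _]
      refine Finset.sum_congr rfl fun k _ => ?_
      rw [integral_const_mul, integral_multivariateGaussian S (hc k).measurable]
    · intro w
      unfold HasLineDerivAt
      have h1 : HasDerivAt (fun t : ℝ => sqrtMul S (w + t • EuclideanSpace.single l (1 : ℝ)))
          (sqrtMul S (EuclideanSpace.single l (1 : ℝ))) 0 := by
        have h2 : HasDerivAt (fun t : ℝ => w + t • EuclideanSpace.single l (1 : ℝ))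
            (EuclideanSpace.single l (1 : ℝ)) 0 := by
          simpa using ((hasDerivAt_id (0 : ℝ)).smul_const
            (EuclideanSpace.single l (1 : ℝ))).const_add w
        exact (Matrix.toEuclideanCLM (𝕜 := ℝ) R).hasFDerivAt.comp_hasDerivAt (0 : ℝ) h2
      have h3 := hasDerivAt_comp_of_partial hF hc h1
      convert! h3 using 1
      refine Finset.sum_congr rfl fun k _ => ?_
      rw [sqrtMul_apply]
      simp [hR]
  have h4 : ∀ z, sqrtMul S z j * F (sqrtMul S z)
      = ∑ l, R j l * (z l * F (sqrtMul S z)) := by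
    intro z
    rw [sqrtMul_apply, Finset.sum_mul]
    exact Finset.sum_congr rfl fun l _ => by ring
  simp only [h4]
  rw [integral_finsetSum _ fun l _ => (hcoord hFc hg l).const_mul _]
  simp only [integral_const_mul, hstep, Finset.mul_sum]
  rw [Finset.sum_comm]
  refine Finset.sum_congr rfl fun k _ => ?_
  rw [← hRR j k, Finset.sum_mul]
  exact Finset.sum_congr rfl fun l _ => by ring

/-- A centred normal law is symmetric, so it annihilates odd functions. -/
lemma integral_multivariateGaussian_of_odd (S : Matrix (Fin d) (Fin d) ℝ)
    {F : EuclideanSpace ℝ (Fin d) → ℝ} (hF : Measurable F) (hodd : ∀ w, F (-w) = -F w) :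
    ∫ y, F y ∂(multivariateGaussian 0 S) = 0 := by
  have h1 : (stdGaussian (EuclideanSpace ℝ (Fin d))).map (fun z => -z)
      = stdGaussian (EuclideanSpace ℝ (Fin d)) :=
    stdGaussian_map (LinearIsometryEquiv.neg ℝ)
  have hm : Measurable fun z => F (sqrtMul S z) := hF.comp (continuous_sqrtMul S).measurable
  have h2 : ∫ z, F (sqrtMul S z) ∂(stdGaussian (EuclideanSpace ℝ (Fin d)))
      = -∫ z, F (sqrtMul S z) ∂(stdGaussian (EuclideanSpace ℝ (Fin d))) := by
    conv_lhs => rw [← h1]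
    rw [integral_map (by fun_prop) hm.aestronglyMeasurable, ← integral_neg]
    refine integral_congr_ae (Filter.Eventually.of_forall fun z => ?_)
    have : sqrtMul S (-z) = -sqrtMul S z := map_neg _ _
    simp only [this, hodd]
  rw [integral_multivariateGaussian S hF]
  linarith

lemma rpow_half_le_integral_abs_rpow {S : Matrix (Fin d) (Fin d) ℝ} (hS : S.PosSemidef)
    {r : ℝ} (hr : 0 ≤ r) (t : Fin d) :
    (S t t) ^ (r / 2) ≤ 2 ^ r * ∫ y, |y t| ^ r ∂(multivariateGaussian 0 S) := by
  have hm : Measurable fun x : ℝ => |x| ^ r := by fun_prop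
  have hv : 0 ≤ S t t := hS.diag_nonneg
  have h1 := measurePreserving_eval_multivariateGaussian (μ := 0) hS (i := t)
  have h2 : ∫ y, |y t| ^ r ∂(multivariateGaussian 0 S)
      = ∫ x, |x| ^ r ∂(gaussianReal 0 (S t t).toNNReal) := by
    have h1' := h1.map_eq
    simp only [PiLp.zero_apply] at h1'
    rw [← h1', integral_map (by fun_prop) hm.aestronglyMeasurable]
  have h3 : gaussianReal 0 (S t t).toNNReal = (gaussianReal 0 1).map (√(S t t) * ·) := by
    rw [gaussianReal_map_const_mul]
    simp only [mul_zero, mul_one]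
    congr 1
    ext
    simp [Real.sq_sqrt hv, hv]
  rw [h2, h3, integral_map (by fun_prop) hm.aestronglyMeasurable]
  simp only [abs_mul]
  have h4 : ∀ x : ℝ, (|√(S t t)| * |x|) ^ r = (S t t) ^ (r / 2) * |x| ^ r := by
    intro x
    rw [Real.mul_rpow (abs_nonneg _) (abs_nonneg _), abs_of_nonneg (Real.sqrt_nonneg _),
      Real.sqrt_eq_rpow, ← Real.rpow_mul hv]
    congr 2
    ring
  simp only [h4]
  rw [integral_const_mul]
  have h5 := one_le_two_rpow_mul_integral_abs_rpow hr
  have h6 : 0 ≤ (S t t) ^ (r / 2) := Real.rpow_nonneg hv _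
  nlinarith

end Gaussian

/-! ### Functions of bounded order -/

section Expansion

/-- `f` is measurable and bounded by a multiple of `R ^ a`. With `R ^ b` integrable for one large
`b`, this is the bookkeeping that makes all the integrals below converge. -/
structure OrderLE {Γ : Type*} [MeasurableSpace Γ] (R : Γ → ℝ) (a : ℝ) (f : Γ → ℝ) : Prop where
  measurable : Measurable f
  bound : ∃ C, ∀ p, |f p| ≤ C * R p ^ a

namespace OrderLE

variable {Γ : Type*} [MeasurableSpace Γ] {R : Γ → ℝ} {a b : ℝ} {f g : Γ → ℝ}

lemma exists_nonneg (hf : OrderLE R a f) (hR : ∀ p, 1 ≤ R p) :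
    ∃ C, 0 ≤ C ∧ ∀ p, |f p| ≤ C * R p ^ a := by
  obtain ⟨C, hC⟩ := hf.bound
  refine ⟨|C|, abs_nonneg _, fun p => (hC p).trans ?_⟩
  exact mul_le_mul_of_nonneg_right (le_abs_self _)
    (Real.rpow_nonneg (zero_le_one.trans (hR p)) _)

lemma mono (hf : OrderLE R a f) (hR : ∀ p, 1 ≤ R p) (hab : a ≤ b) : OrderLE R b f := by
  obtain ⟨C, hC0, hC⟩ := hf.exists_nonneg hR
  exact ⟨hf.measurable, C, fun p => (hC p).trans
    (mul_le_mul_of_nonneg_left (Real.rpow_le_rpow_of_exponent_le (hR p) hab) hC0)⟩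

lemma mul (hf : OrderLE R a f) (hg : OrderLE R b g) (hR : ∀ p, 1 ≤ R p) :
    OrderLE R (a + b) fun p => f p * g p := by
  obtain ⟨C, hC0, hC⟩ := hf.exists_nonneg hR
  obtain ⟨D, hD0, hD⟩ := hg.exists_nonneg hR
  refine ⟨hf.measurable.mul hg.measurable, C * D, fun p => ?_⟩
  have hp : 0 < R p := zero_lt_one.trans_le (hR p)
  rw [abs_mul, Real.rpow_add hp]
  calc |f p| * |g p| ≤ (C * R p ^ a) * (D * R p ^ b) :=
        mul_le_mul (hC p) (hD p) (abs_nonneg _) ((abs_nonneg _).trans (hC p))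
    _ = _ := by ring

lemma add (hf : OrderLE R a f) (hg : OrderLE R a g) : OrderLE R a fun p => f p + g p := by
  obtain ⟨C, hC⟩ := hf.bound
  obtain ⟨D, hD⟩ := hg.bound
  refine ⟨hf.measurable.add hg.measurable, C + D, fun p => ?_⟩
  rw [add_mul]
  exact (abs_add_le _ _).trans (add_le_add (hC p) (hD p))

lemma const_mul (c : ℝ) (hf : OrderLE R a f) : OrderLE R a fun p => c * f p := by
  obtain ⟨C, hC⟩ := hf.bound
  refine ⟨hf.measurable.const_mul c, |c| * C, fun p => ?_⟩
  rw [abs_mul, mul_assoc]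
  exact mul_le_mul_of_nonneg_left (hC p) (abs_nonneg _)

lemma sub (hf : OrderLE R a f) (hg : OrderLE R a g) : OrderLE R a fun p => f p - g p := by
  simpa [sub_eq_add_neg] using hf.add (hg.const_mul (-1))

lemma abs (hf : OrderLE R a f) : OrderLE R a fun p => |f p| := by
  obtain ⟨C, hC⟩ := hf.bound
  exact ⟨by have := hf.measurable; fun_prop, C, fun p => by simpa using hC p⟩

lemma zero : OrderLE R a fun _ => 0 := ⟨measurable_const, 0, fun p => by simp⟩

lemma one (hR : ∀ p, 1 ≤ R p) (ha : 0 ≤ a) : OrderLE R a fun _ => 1 :=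
  ⟨measurable_const, 1, fun p => by simpa using Real.one_le_rpow (hR p) ha⟩

lemma sum {ι : Type*} (s : Finset ι) {f : ι → Γ → ℝ} (hf : ∀ i ∈ s, OrderLE R a (f i)) :
    OrderLE R a fun p => ∑ i ∈ s, f i p := by
  classical
  induction s using Finset.induction_on with
  | empty => simpa using zero
  | insert i s hi ih =>
    simp only [Finset.sum_insert hi]
    exact (hf i (Finset.mem_insert_self _ _)).add
      (ih fun j hj => hf j (Finset.mem_insert_of_mem hj))

lemma pow (hf : OrderLE R 1 f) (hR : ∀ p, 1 ≤ R p) (k : ℕ) : OrderLE R k fun p => f p ^ k := by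
  induction k with
  | zero => simpa using one hR le_rfl
  | succ k ih =>
    simp only [pow_succ, Nat.cast_succ]
    exact ih.mul hf hR

lemma abs_rpow (hf : OrderLE R 1 f) (hR : ∀ p, 1 ≤ R p) (ha : 0 ≤ a) :
    OrderLE R a fun p => |f p| ^ a := by
  obtain ⟨C, hC0, hC⟩ := hf.exists_nonneg hR
  refine ⟨by have := hf.measurable; fun_prop, C ^ a, fun p => ?_⟩
  have hp : 0 ≤ R p := zero_le_one.trans (hR p)
  rw [abs_of_nonneg (Real.rpow_nonneg (abs_nonneg _) _), ← Real.mul_rpow hC0 hp]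
  have := hC p
  rw [Real.rpow_one] at this
  exact Real.rpow_le_rpow (abs_nonneg _) this ha

lemma integrable {μ : Measure Γ} (hf : OrderLE R a f) (hR : ∀ p, 1 ≤ R p)
    (hb : Integrable (fun p => R p ^ b) μ) (hab : a ≤ b) : Integrable f μ := by
  obtain ⟨C, hC⟩ := (hf.mono hR hab).bound
  exact (hb.const_mul C).mono' hf.measurable.aestronglyMeasurable
    (Filter.Eventually.of_forall hC)

end OrderLE

variable {d : ℕ}

/-- `q` is continuous and grows at most like `‖w‖ ^ a`. -/
structure GrowthLE (a : ℝ) (q : EuclideanSpace ℝ (Fin d) → ℝ) : Prop where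
  continuous : Continuous q
  bound : ∃ C, ∀ w, |q w| ≤ C * (1 + ‖w‖) ^ a

lemma GrowthLE.orderLE {Γ : Type*} [MeasurableSpace Γ] {R : Γ → ℝ} {a : ℝ} (ha : 0 ≤ a)
    {q : EuclideanSpace ℝ (Fin d) → ℝ} (hq : GrowthLE a q) {T : Γ → EuclideanSpace ℝ (Fin d)}
    (hT : Measurable T) (hTR : ∀ p, 1 + ‖T p‖ ≤ R p) : OrderLE R a fun p => q (T p) := by
  obtain ⟨C, hC⟩ := hq.bound
  have hC0 : 0 ≤ C := by simpa using (abs_nonneg _).trans (hC 0)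
  exact ⟨hq.continuous.measurable.comp hT, C, fun p => (hC _).trans
    (mul_le_mul_of_nonneg_left (Real.rpow_le_rpow (by positivity) (hTR p) ha) hC0)⟩

lemma abs_integral_le_of_abs_le {Γ : Type*} [MeasurableSpace Γ] {μ : Measure Γ} {f g : Γ → ℝ}
    (hg : Integrable g μ) (h : ∀ p, |f p| ≤ g p) : |∫ p, f p ∂μ| ≤ ∫ p, g p ∂μ := by
  rw [← Real.norm_eq_abs]
  exact norm_integral_le_of_norm_le hg (Filter.Eventually.of_forall h)

lemma integral_add₃ {Γ : Type*} [MeasurableSpace Γ] {μ : Measure Γ} {f g h : Γ → ℝ}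
    (hf : Integrable f μ) (hg : Integrable g μ) (hh : Integrable h μ) :
    ∫ p, f p + g p + h p ∂μ = ∫ p, f p ∂μ + ∫ p, g p ∂μ + ∫ p, h p ∂μ := by
  rw [integral_add (f := fun p => f p + g p) (hf.add hg) hh, integral_add hf hg]

/-! ### Taylor expansion around an independent vector -/

/-- One independent summand `x` of a random vector `T = V + c x`, with `V` independent of `x`;
the function `R` controls the sizes, and its powers up to `ρ + 4` are integrable. -/
structure SplitData {Γ : Type*} [MeasurableSpace Γ] (μ : Measure Γ) (R : Γ → ℝ) (ρ c : ℝ)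
    (x V : Γ → EuclideanSpace ℝ (Fin d)) : Prop where
  nonneg_ρ : 0 ≤ ρ
  nonneg_c : 0 ≤ c
  one_le : ∀ p, 1 ≤ R p
  integrable : Integrable (fun p => R p ^ (ρ + 4)) μ
  measurable_x : Measurable x
  measurable_V : Measurable V
  indep : IndepFun x V μ
  mean : ∀ j, ∫ p, x p j ∂μ = 0
  norm_x : ∀ p, ‖x p‖ ≤ R p
  norm_V : ∀ p, 1 + ‖V p‖ ≤ R p
  norm_T : ∀ p, 1 + ‖V p + c • x p‖ ≤ R p

namespace SplitData

variable {Γ : Type*} [MeasurableSpace Γ] {μ : Measure Γ} {R : Γ → ℝ}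
  {ρ c : ℝ} {x V : Γ → EuclideanSpace ℝ (Fin d)}

lemma order_x (D : SplitData μ R ρ c x V) (j : Fin d) : OrderLE R 1 fun p => x p j := by
  refine ⟨by have := D.measurable_x; fun_prop, 1, fun p => ?_⟩
  rw [one_mul, Real.rpow_one]
  exact (PiLp.norm_apply_le (x p) j).trans (D.norm_x p)

lemma order_V (D : SplitData μ R ρ c x V) {a : ℝ} (ha : 0 ≤ a)
    {q : EuclideanSpace ℝ (Fin d) → ℝ} (hq : GrowthLE a q) : OrderLE R a fun p => q (V p) :=
  hq.orderLE ha D.measurable_V D.norm_V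

lemma order_T (D : SplitData μ R ρ c x V) {a : ℝ} (ha : 0 ≤ a)
    {q : EuclideanSpace ℝ (Fin d) → ℝ} (hq : GrowthLE a q) :
    OrderLE R a fun p => q (V p + c • x p) :=
  hq.orderLE ha (D.measurable_V.add (D.measurable_x.const_smul c)) D.norm_T

lemma order_l1 (D : SplitData μ R ρ c x V) : OrderLE R 1 fun p => ∑ l, |x p l| :=
  OrderLE.sum _ fun l _ => (D.order_x l).abs

lemma integral_mul (D : SplitData μ R ρ c x V) {f q : EuclideanSpace ℝ (Fin d) → ℝ}
    (hf : Measurable f) (hq : Measurable q) :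
    ∫ p, f (x p) * q (V p) ∂μ = (∫ p, f (x p) ∂μ) * ∫ p, q (V p) ∂μ :=
  (D.indep.comp hf hq).integral_mul_eq_mul_integral
    (hf.comp D.measurable_x).aestronglyMeasurable (hq.comp D.measurable_V).aestronglyMeasurable

/-- First order expansion of one summand of the Stein operator. The second moments of `x` cancel,
and only third derivatives of `q` remain. -/
lemma abs_step_le_of_third (D : SplitData μ R ρ c x V)
    {q' : Fin d → EuclideanSpace ℝ (Fin d) → ℝ}
    {q'' : Fin d → Fin d → EuclideanSpace ℝ (Fin d) → ℝ}
    {q3 : Fin d → Fin d → Fin d → EuclideanSpace ℝ (Fin d) → ℝ}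
    (hq' : ∀ k j w, HasLineDerivAt ℝ (q' j) (q'' k j w) w (EuclideanSpace.single k 1))
    (hq'' : ∀ l k j w, HasLineDerivAt ℝ (q'' k j) (q3 l k j w) w (EuclideanSpace.single l 1))
    (hg' : ∀ j, GrowthLE ρ (q' j)) (hg'' : ∀ k j, GrowthLE ρ (q'' k j))
    {K : ℝ} {M : Γ → ℝ} (hM : OrderLE R ρ M)
    (hq3 : ∀ p w, (∀ t, |w t - V p t| ≤ |(c • x p) t|) → ∀ l k j, |q3 l k j w| ≤ K * M p) :
    |c * ∑ j, ∑ k, (∫ p, x p j * x p k ∂μ) * ∫ p, q'' k j (V p + c • x p) ∂μ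
        - ∑ j, ∫ p, x p j * q' j (V p + c • x p) ∂μ|
      ≤ c ^ 2 * K * (∑ j, ∑ k, |∫ p, x p j * x p k ∂μ| * ∫ p, (∑ l, |x p l|) * M p ∂μ
        + 1 / 2 * ∫ p, (∑ l, |x p l|) ^ 3 * M p ∂μ) := by
  have hR := D.one_le
  have hρ := D.nonneg_ρ
  have hc := D.nonneg_c
  have int : ∀ {a : ℝ} {f : Γ → ℝ}, OrderLE R a f → a ≤ ρ + 4 → Integrable f μ :=
    fun hf ha => hf.integrable hR D.integrable ha
  -- Taylor remainders of `q''` and `q'` around `V`.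
  set ρ2 : Fin d → Fin d → Γ → ℝ := fun k j p => q'' k j (V p + c • x p) - q'' k j (V p) with hρ2
  set ρ1 : Fin d → Γ → ℝ := fun j p =>
    q' j (V p + c • x p) - q' j (V p) - ∑ k, (c • x p) k * q'' k j (V p) with hρ1
  have o2 : ∀ k j, OrderLE R ρ (ρ2 k j) := fun k j =>
    (D.order_T hρ (hg'' k j)).sub (D.order_V hρ (hg'' k j))
  have oxx : ∀ k j, OrderLE R (1 + ρ) fun p => (c • x p) k * q'' k j (V p) := fun k j => by
    simp only [PiLp.smul_apply, smul_eq_mul]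
    exact ((D.order_x k).const_mul c).mul (D.order_V hρ (hg'' k j)) hR
  have o1 : ∀ j, OrderLE R (1 + ρ) (ρ1 j) := fun j =>
    (((D.order_T hρ (hg' j)).sub (D.order_V hρ (hg' j))).mono hR (by linarith)).sub
      (OrderLE.sum _ fun k _ => oxx k j)
  have b2 : ∀ k j p, |ρ2 k j p| ≤ c * K * ((∑ l, |x p l|) * M p) := by
    intro k j p
    refine (abs_add_sub_le_of_partial (fun l w => hq'' l k j w) (V p) (c • x p) (K := K * M p)
      (fun w hw l => hq3 p w hw l k j)).trans (le_of_eq ?_)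
    simp only [PiLp.smul_apply, smul_eq_mul, abs_mul, abs_of_nonneg hc, ← Finset.mul_sum]
    ring
  have b1 : ∀ j p, |ρ1 j p| ≤ c ^ 2 * K / 2 * ((∑ l, |x p l|) ^ 2 * M p) := by
    intro j p
    refine (abs_taylor_one_le (fun k w => hq' k j w) (fun l k w => hq'' l k j w)
      (fun k => (hg'' k j).continuous) (V p) (c • x p) (K := K * M p)
      (fun w hw l k => hq3 p w hw l k j)).trans (le_of_eq ?_)
    simp only [PiLp.smul_apply, smul_eq_mul, abs_mul, abs_of_nonneg hc, ← Finset.mul_sum]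
    ring
  have e2 : ∀ k j, ∫ p, q'' k j (V p + c • x p) ∂μ
      = ∫ p, ρ2 k j p ∂μ + ∫ p, q'' k j (V p) ∂μ := by
    intro k j
    rw [← integral_add (int (o2 k j) (by linarith)) (int (D.order_V hρ (hg'' k j)) (by linarith))]
    simp [hρ2]
  have e1 : ∀ j, ∫ p, x p j * q' j (V p + c • x p) ∂μ = ∫ p, x p j * ρ1 j p ∂μ
      + c * ∑ k, (∫ p, x p j * x p k ∂μ) * ∫ p, q'' k j (V p) ∂μ := by
    intro j
    have h1 : ∀ p, x p j * q' j (V p + c • x p) = x p j * ρ1 j p + x p j * q' j (V p)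
        + ∑ k, c * ((x p j * x p k) * q'' k j (V p)) := by
      intro p
      have : ∑ k, c * ((x p j * x p k) * q'' k j (V p))
          = x p j * ∑ k, (c • x p) k * q'' k j (V p) := by
        rw [Finset.mul_sum]
        refine Finset.sum_congr rfl fun k _ => ?_
        simp only [PiLp.smul_apply, smul_eq_mul]
        ring
      rw [this, hρ1]
      ring
    have i1 : Integrable (fun p => x p j * ρ1 j p) μ :=
      int ((D.order_x j).mul (o1 j) hR) (by linarith)
    have i2 : Integrable (fun p => x p j * q' j (V p)) μ :=
      int ((D.order_x j).mul (D.order_V hρ (hg' j)) hR) (by linarith)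
    have i3 : ∀ k, Integrable (fun p => c * ((x p j * x p k) * q'' k j (V p))) μ := fun k =>
      int ((((D.order_x j).mul (D.order_x k) hR).mul (D.order_V hρ (hg'' k j)) hR).const_mul c)
        (by linarith)
    simp only [h1]
    rw [integral_add₃ i1 i2 (integrable_finsetSum _ fun k _ => i3 k),
      integral_finsetSum _ fun k _ => i3 k,
      D.integral_mul (f := fun z => z j) (by fun_prop) (hg' j).continuous.measurable, D.mean j,
      zero_mul, add_zero, Finset.mul_sum]
    congr 1
    refine Finset.sum_congr rfl fun k _ => ?_
    rw [integral_const_mul, D.integral_mul (f := fun z => z j * z k) (by fun_prop)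
      (hg'' k j).continuous.measurable]
  -- The second moments of `x` cancel between the two parts.
  have key : c * ∑ j, ∑ k, (∫ p, x p j * x p k ∂μ) * ∫ p, q'' k j (V p + c • x p) ∂μ
        - ∑ j, ∫ p, x p j * q' j (V p + c • x p) ∂μ
      = c * ∑ j, ∑ k, (∫ p, x p j * x p k ∂μ) * ∫ p, ρ2 k j p ∂μ
        - ∑ j, ∫ p, x p j * ρ1 j p ∂μ := by
    simp only [e1, e2, mul_add, Finset.sum_add_distrib, Finset.mul_sum]
    ring
  rw [key]
  have f2 : ∀ k j, |∫ p, ρ2 k j p ∂μ| ≤ c * K * ∫ p, (∑ l, |x p l|) * M p ∂μ := by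
    intro k j
    rw [← integral_const_mul]
    exact abs_integral_le_of_abs_le (int ((D.order_l1.mul hM hR).const_mul _) (by linarith))
      fun p => b2 k j p
  have f1 : |∑ j, ∫ p, x p j * ρ1 j p ∂μ|
      ≤ c ^ 2 * K / 2 * ∫ p, (∑ l, |x p l|) ^ 3 * M p ∂μ := by
    rw [← integral_finsetSum _ fun j _ => int ((D.order_x j).mul (o1 j) hR) (by linarith),
      ← integral_const_mul]
    refine abs_integral_le_of_abs_le (int (((D.order_l1.pow hR 3).mul hM hR).const_mul _)
      (by norm_num; linarith)) fun p => ?_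
    refine (Finset.abs_sum_le_sum_abs _ _).trans ?_
    have : ∀ j, |x p j * ρ1 j p| ≤ |x p j| * (c ^ 2 * K / 2 * ((∑ l, |x p l|) ^ 2 * M p)) := by
      intro j
      rw [abs_mul]
      exact mul_le_mul_of_nonneg_left (b1 j p) (abs_nonneg _)
    refine (Finset.sum_le_sum fun j _ => this j).trans (le_of_eq ?_)
    rw [← Finset.sum_mul]
    ring
  refine (abs_sub _ _).trans ?_
  rw [abs_mul, abs_of_nonneg hc]
  have f3 : |∑ j, ∑ k, (∫ p, x p j * x p k ∂μ) * ∫ p, ρ2 k j p ∂μ|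
      ≤ c * K * ∑ j, ∑ k, |∫ p, x p j * x p k ∂μ| * ∫ p, (∑ l, |x p l|) * M p ∂μ := by
    refine (Finset.abs_sum_le_sum_abs _ _).trans ?_
    rw [Finset.mul_sum]
    refine Finset.sum_le_sum fun j _ => (Finset.abs_sum_le_sum_abs _ _).trans ?_
    rw [Finset.mul_sum]
    refine Finset.sum_le_sum fun k _ => ?_
    rw [abs_mul]
    refine (mul_le_mul_of_nonneg_left (f2 k j) (abs_nonneg _)).trans (le_of_eq ?_)
    ring
  refine (add_le_add (mul_le_mul_of_nonneg_left f3 hc) f1).trans (le_of_eq ?_)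
  ring

/-- Second order expansion of one summand of the Stein operator. The third moments of `x` are
kept, multiplied by the expected third derivatives at `T`. -/
lemma abs_step_le_of_fourth (D : SplitData μ R ρ c x V)
    {q' : Fin d → EuclideanSpace ℝ (Fin d) → ℝ}
    {q'' : Fin d → Fin d → EuclideanSpace ℝ (Fin d) → ℝ}
    {q3 : Fin d → Fin d → Fin d → EuclideanSpace ℝ (Fin d) → ℝ}
    {q4 : Fin d → Fin d → Fin d → Fin d → EuclideanSpace ℝ (Fin d) → ℝ}
    (hq' : ∀ k j w, HasLineDerivAt ℝ (q' j) (q'' k j w) w (EuclideanSpace.single k 1))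
    (hq'' : ∀ l k j w, HasLineDerivAt ℝ (q'' k j) (q3 l k j w) w (EuclideanSpace.single l 1))
    (hq3 : ∀ m l k j w, HasLineDerivAt ℝ (q3 l k j) (q4 m l k j w) w (EuclideanSpace.single m 1))
    (hg' : ∀ j, GrowthLE ρ (q' j)) (hg'' : ∀ k j, GrowthLE ρ (q'' k j))
    (hg3 : ∀ l k j, GrowthLE ρ (q3 l k j))
    {K : ℝ} {M : Γ → ℝ} (hM : OrderLE R ρ M)
    (hq4 : ∀ p w, (∀ t, |w t - V p t| ≤ |(c • x p) t|) →
      ∀ m l k j, |q4 m l k j w| ≤ K * M p) :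
    |c * ∑ j, ∑ k, (∫ p, x p j * x p k ∂μ) * ∫ p, q'' k j (V p + c • x p) ∂μ
        - ∑ j, ∫ p, x p j * q' j (V p + c • x p) ∂μ|
      ≤ c ^ 3 * K * (1 / 2 * ∑ j, ∑ k, |∫ p, x p j * x p k ∂μ| *
            ∫ p, (∑ l, |x p l|) ^ 2 * M p ∂μ
          + 1 / 2 * ∑ j, ∑ k, ∑ l, |∫ p, x p j * x p k * x p l ∂μ| *
            ∫ p, (∑ l, |x p l|) * M p ∂μ
          + 1 / 6 * ∫ p, (∑ l, |x p l|) ^ 4 * M p ∂μ)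
        + c ^ 2 / 2 * ∑ j, ∑ k, ∑ l, |∫ p, x p j * x p k * x p l ∂μ| *
            |∫ p, q3 l k j (V p + c • x p) ∂μ| := by
  have hR := D.one_le
  have hρ := D.nonneg_ρ
  have hc := D.nonneg_c
  have int : ∀ {a : ℝ} {f : Γ → ℝ}, OrderLE R a f → a ≤ ρ + 4 → Integrable f μ :=
    fun hf ha => hf.integrable hR D.integrable ha
  -- Taylor remainders of `q3`, `q''` and `q'` around `V`.
  set ρ3 : Fin d → Fin d → Fin d → Γ → ℝ :=
    fun l k j p => q3 l k j (V p + c • x p) - q3 l k j (V p) with hρ3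
  set ρ2 : Fin d → Fin d → Γ → ℝ := fun k j p =>
    q'' k j (V p + c • x p) - q'' k j (V p) - ∑ l, (c • x p) l * q3 l k j (V p) with hρ2
  set ρ1 : Fin d → Γ → ℝ := fun j p =>
    q' j (V p + c • x p) - q' j (V p) - ∑ k, (c • x p) k * q'' k j (V p)
      - (∑ k, ∑ l, (c • x p) k * (c • x p) l * q3 l k j (V p)) / 2 with hρ1
  have o3 : ∀ l k j, OrderLE R ρ (ρ3 l k j) := fun l k j =>
    (D.order_T hρ (hg3 l k j)).sub (D.order_V hρ (hg3 l k j))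
  have ox3 : ∀ l k j, OrderLE R (1 + ρ) fun p => (c • x p) l * q3 l k j (V p) := fun l k j => by
    simp only [PiLp.smul_apply, smul_eq_mul]
    exact ((D.order_x l).const_mul c).mul (D.order_V hρ (hg3 l k j)) hR
  have ox2 : ∀ k j, OrderLE R (1 + ρ) fun p => (c • x p) k * q'' k j (V p) := fun k j => by
    simp only [PiLp.smul_apply, smul_eq_mul]
    exact ((D.order_x k).const_mul c).mul (D.order_V hρ (hg'' k j)) hR
  have oxx3 : ∀ l k j, OrderLE R (1 + 1 + ρ) fun p =>
      (c • x p) k * (c • x p) l * q3 l k j (V p) := fun l k j => by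
    simp only [PiLp.smul_apply, smul_eq_mul]
    exact (((D.order_x k).const_mul c).mul ((D.order_x l).const_mul c) hR).mul
      (D.order_V hρ (hg3 l k j)) hR
  have o2 : ∀ k j, OrderLE R (1 + ρ) (ρ2 k j) := fun k j =>
    (((D.order_T hρ (hg'' k j)).sub (D.order_V hρ (hg'' k j))).mono hR (by linarith)).sub
      (OrderLE.sum _ fun l _ => ox3 l k j)
  have o1 : ∀ j, OrderLE R (1 + 1 + ρ) (ρ1 j) := fun j =>
    ((((D.order_T hρ (hg' j)).sub (D.order_V hρ (hg' j))).mono hR (by linarith)).sub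
      (OrderLE.sum _ fun k _ => (ox2 k j).mono hR (by linarith))).sub (by
        simp only [div_eq_inv_mul]
        exact (OrderLE.sum _ fun k _ => OrderLE.sum _ fun l _ => oxx3 l k j).const_mul _)
  have b3 : ∀ l k j p, |ρ3 l k j p| ≤ c * K * ((∑ l, |x p l|) * M p) := by
    intro l k j p
    refine (abs_add_sub_le_of_partial (fun m w => hq3 m l k j w) (V p) (c • x p) (K := K * M p)
      (fun w hw m => hq4 p w hw m l k j)).trans (le_of_eq ?_)
    simp only [PiLp.smul_apply, smul_eq_mul, abs_mul, abs_of_nonneg hc, ← Finset.mul_sum]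
    ring
  have b2 : ∀ k j p, |ρ2 k j p| ≤ c ^ 2 * K / 2 * ((∑ l, |x p l|) ^ 2 * M p) := by
    intro k j p
    refine (abs_taylor_one_le (fun l w => hq'' l k j w) (fun m l w => hq3 m l k j w)
      (fun l => (hg3 l k j).continuous) (V p) (c • x p) (K := K * M p)
      (fun w hw m l => hq4 p w hw m l k j)).trans (le_of_eq ?_)
    simp only [PiLp.smul_apply, smul_eq_mul, abs_mul, abs_of_nonneg hc, ← Finset.mul_sum]
    ring
  have b1 : ∀ j p, |ρ1 j p| ≤ c ^ 3 * K / 6 * ((∑ l, |x p l|) ^ 3 * M p) := by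
    intro j p
    refine (abs_taylor_two_le (fun k w => hq' k j w) (fun l k w => hq'' l k j w)
      (fun m l k w => hq3 m l k j w)
      (fun k => (hg'' k j).continuous) (fun l k => (hg3 l k j).continuous)
      (V p) (c • x p) (K := K * M p)
      (fun w hw m l k => hq4 p w hw m l k j)).trans (le_of_eq ?_)
    simp only [PiLp.smul_apply, smul_eq_mul, abs_mul, abs_of_nonneg hc, ← Finset.mul_sum]
    ring
  -- The third derivative is moved back from `V` to `V + c x`, where its expectation can be
  -- estimated by a second interpolation.
  have e3 : ∀ l k j, ∫ p, q3 l k j (V p) ∂μ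
      = ∫ p, q3 l k j (V p + c • x p) ∂μ - ∫ p, ρ3 l k j p ∂μ := by
    intro l k j
    rw [← integral_sub (int (D.order_T hρ (hg3 l k j)) (by linarith))
      (int (o3 l k j) (by linarith))]
    simp [hρ3]
  have e2 : ∀ k j, ∫ p, q'' k j (V p + c • x p) ∂μ
      = ∫ p, ρ2 k j p ∂μ + ∫ p, q'' k j (V p) ∂μ := by
    intro k j
    have h1 : ∀ p, q'' k j (V p + c • x p) = ρ2 k j p + q'' k j (V p)
        + ∑ l, c * (x p l * q3 l k j (V p)) := by
      intro p
      simp only [hρ2, PiLp.smul_apply, smul_eq_mul, mul_assoc]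
      ring
    have i1 := int (o2 k j) (by linarith)
    have i2 := int (D.order_V hρ (hg'' k j)) (by linarith)
    have i3 : ∀ l, Integrable (fun p => c * (x p l * q3 l k j (V p))) μ := fun l =>
      int (((D.order_x l).mul (D.order_V hρ (hg3 l k j)) hR).const_mul c) (by linarith)
    simp only [h1]
    rw [integral_add₃ i1 i2 (integrable_finsetSum _ fun l _ => i3 l),
      integral_finsetSum _ fun l _ => i3 l]
    -- The first order term vanishes, since `x` is centred and independent of `V`.
    refine add_eq_left.2 (Finset.sum_eq_zero fun l _ => ?_)
    rw [integral_const_mul, D.integral_mul (f := fun z => z l) (by fun_prop)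
      (hg3 l k j).continuous.measurable, D.mean l, zero_mul, mul_zero]
  have e1 : ∀ j, ∫ p, x p j * q' j (V p + c • x p) ∂μ = ∫ p, x p j * ρ1 j p ∂μ
      + c * ∑ k, (∫ p, x p j * x p k ∂μ) * ∫ p, q'' k j (V p) ∂μ
      + c ^ 2 / 2 * ∑ k, ∑ l, (∫ p, x p j * x p k * x p l ∂μ) * ∫ p, q3 l k j (V p) ∂μ := by
    intro j
    have h1 : ∀ p, x p j * q' j (V p + c • x p) = x p j * ρ1 j p + x p j * q' j (V p)
        + ∑ k, c * ((x p j * x p k) * q'' k j (V p))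
        + ∑ k, ∑ l, c ^ 2 / 2 * ((x p j * x p k * x p l) * q3 l k j (V p)) := by
      intro p
      have h2 : ∑ k, c * ((x p j * x p k) * q'' k j (V p))
          = x p j * ∑ k, (c • x p) k * q'' k j (V p) := by
        rw [Finset.mul_sum]
        refine Finset.sum_congr rfl fun k _ => ?_
        simp only [PiLp.smul_apply, smul_eq_mul]
        ring
      have h3 : ∑ k, ∑ l, c ^ 2 / 2 * ((x p j * x p k * x p l) * q3 l k j (V p))
          = x p j * ((∑ k, ∑ l, (c • x p) k * (c • x p) l * q3 l k j (V p)) / 2) := by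
        rw [Finset.sum_div, Finset.mul_sum]
        refine Finset.sum_congr rfl fun k _ => ?_
        rw [Finset.sum_div, Finset.mul_sum]
        refine Finset.sum_congr rfl fun l _ => ?_
        simp only [PiLp.smul_apply, smul_eq_mul]
        ring
      rw [h2, h3, hρ1]
      ring
    have i1 : Integrable (fun p => x p j * ρ1 j p) μ :=
      int ((D.order_x j).mul (o1 j) hR) (by linarith)
    have i2 : Integrable (fun p => x p j * q' j (V p)) μ :=
      int ((D.order_x j).mul (D.order_V hρ (hg' j)) hR) (by linarith)
    have i3 : ∀ k, Integrable (fun p => c * ((x p j * x p k) * q'' k j (V p))) μ := fun k =>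
      int ((((D.order_x j).mul (D.order_x k) hR).mul (D.order_V hρ (hg'' k j)) hR).const_mul c)
        (by linarith)
    have i4 : ∀ k l, Integrable
        (fun p => c ^ 2 / 2 * ((x p j * x p k * x p l) * q3 l k j (V p))) μ := fun k l =>
      int (((((D.order_x j).mul (D.order_x k) hR).mul (D.order_x l) hR).mul
        (D.order_V hρ (hg3 l k j)) hR).const_mul _) (by linarith)
    have i5 : ∀ k, Integrable
        (fun p => ∑ l, c ^ 2 / 2 * ((x p j * x p k * x p l) * q3 l k j (V p))) μ := fun k =>
      integrable_finsetSum _ fun l _ => i4 k l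
    simp only [h1]
    rw [integral_add₃ (f := fun p => x p j * ρ1 j p + x p j * q' j (V p)) (i1.add i2)
        (integrable_finsetSum _ fun k _ => i3 k) (integrable_finsetSum _ fun k _ => i5 k),
      integral_add i1 i2,
      integral_finsetSum _ fun k _ => i3 k, integral_finsetSum _ fun k _ => i5 k,
      D.integral_mul (f := fun z => z j) (by fun_prop) (hg' j).continuous.measurable, D.mean j,
      zero_mul, add_zero, Finset.mul_sum, Finset.mul_sum]
    congr 1
    · congr 1
      refine Finset.sum_congr rfl fun k _ => ?_
      rw [integral_const_mul, D.integral_mul (f := fun z => z j * z k) (by fun_prop)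
        (hg'' k j).continuous.measurable]
    · refine Finset.sum_congr rfl fun k _ => ?_
      rw [integral_finsetSum _ fun l _ => i4 k l, Finset.mul_sum]
      refine Finset.sum_congr rfl fun l _ => ?_
      rw [integral_const_mul, D.integral_mul (f := fun z => z j * z k * z l) (by fun_prop)
        (hg3 l k j).continuous.measurable]
  -- The second moments of `x` cancel between the two parts.
  have key : c * ∑ j, ∑ k, (∫ p, x p j * x p k ∂μ) * ∫ p, q'' k j (V p + c • x p) ∂μ
        - ∑ j, ∫ p, x p j * q' j (V p + c • x p) ∂μ
      = c * ∑ j, ∑ k, (∫ p, x p j * x p k ∂μ) * ∫ p, ρ2 k j p ∂μ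
        + c ^ 2 / 2 * ∑ j, ∑ k, ∑ l, (∫ p, x p j * x p k * x p l ∂μ) * ∫ p, ρ3 l k j p ∂μ
        - c ^ 2 / 2 * ∑ j, ∑ k, ∑ l, (∫ p, x p j * x p k * x p l ∂μ) *
            ∫ p, q3 l k j (V p + c • x p) ∂μ
        - ∑ j, ∫ p, x p j * ρ1 j p ∂μ := by
    simp only [e1, e2, e3, mul_add, mul_sub, Finset.sum_add_distrib, Finset.sum_sub_distrib,
      Finset.mul_sum]
    ring
  rw [key]
  have f3 : ∀ l k j, |∫ p, ρ3 l k j p ∂μ| ≤ c * K * ∫ p, (∑ l, |x p l|) * M p ∂μ := by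
    intro l k j
    rw [← integral_const_mul]
    exact abs_integral_le_of_abs_le (int ((D.order_l1.mul hM hR).const_mul _) (by linarith))
      fun p => b3 l k j p
  have f2 : ∀ k j, |∫ p, ρ2 k j p ∂μ| ≤ c ^ 2 * K / 2 * ∫ p, (∑ l, |x p l|) ^ 2 * M p ∂μ := by
    intro k j
    rw [← integral_const_mul]
    exact abs_integral_le_of_abs_le (int (((D.order_l1.pow hR 2).mul hM hR).const_mul _)
      (by norm_num; linarith)) fun p => b2 k j p
  have f1 : |∑ j, ∫ p, x p j * ρ1 j p ∂μ|
      ≤ c ^ 3 * K / 6 * ∫ p, (∑ l, |x p l|) ^ 4 * M p ∂μ := by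
    rw [← integral_finsetSum _ fun j _ => int ((D.order_x j).mul (o1 j) hR) (by linarith),
      ← integral_const_mul]
    refine abs_integral_le_of_abs_le (int (((D.order_l1.pow hR 4).mul hM hR).const_mul _)
      (by norm_num; linarith)) fun p => ?_
    refine (Finset.abs_sum_le_sum_abs _ _).trans ?_
    have : ∀ j, |x p j * ρ1 j p| ≤ |x p j| * (c ^ 3 * K / 6 * ((∑ l, |x p l|) ^ 3 * M p)) := by
      intro j
      rw [abs_mul]
      exact mul_le_mul_of_nonneg_left (b1 j p) (abs_nonneg _)
    refine (Finset.sum_le_sum fun j _ => this j).trans (le_of_eq ?_)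
    rw [← Finset.sum_mul]
    ring
  have g2 : |∑ j, ∑ k, (∫ p, x p j * x p k ∂μ) * ∫ p, ρ2 k j p ∂μ|
      ≤ c ^ 2 * K / 2 * ∑ j, ∑ k, |∫ p, x p j * x p k ∂μ| *
        ∫ p, (∑ l, |x p l|) ^ 2 * M p ∂μ := by
    refine (Finset.abs_sum_le_sum_abs _ _).trans ?_
    rw [Finset.mul_sum]
    refine Finset.sum_le_sum fun j _ => (Finset.abs_sum_le_sum_abs _ _).trans ?_
    rw [Finset.mul_sum]
    refine Finset.sum_le_sum fun k _ => ?_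
    rw [abs_mul]
    refine (mul_le_mul_of_nonneg_left (f2 k j) (abs_nonneg _)).trans (le_of_eq ?_)
    ring
  have g3 : |∑ j, ∑ k, ∑ l, (∫ p, x p j * x p k * x p l ∂μ) * ∫ p, ρ3 l k j p ∂μ|
      ≤ c * K * ∑ j, ∑ k, ∑ l, |∫ p, x p j * x p k * x p l ∂μ| *
        ∫ p, (∑ l, |x p l|) * M p ∂μ := by
    refine (Finset.abs_sum_le_sum_abs _ _).trans ?_
    rw [Finset.mul_sum]
    refine Finset.sum_le_sum fun j _ => (Finset.abs_sum_le_sum_abs _ _).trans ?_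
    rw [Finset.mul_sum]
    refine Finset.sum_le_sum fun k _ => (Finset.abs_sum_le_sum_abs _ _).trans ?_
    rw [Finset.mul_sum]
    refine Finset.sum_le_sum fun l _ => ?_
    rw [abs_mul]
    refine (mul_le_mul_of_nonneg_left (f3 l k j) (abs_nonneg _)).trans (le_of_eq ?_)
    ring
  have g4 : |∑ j, ∑ k, ∑ l, (∫ p, x p j * x p k * x p l ∂μ) *
        ∫ p, q3 l k j (V p + c • x p) ∂μ|
      ≤ ∑ j, ∑ k, ∑ l, |∫ p, x p j * x p k * x p l ∂μ| *
        |∫ p, q3 l k j (V p + c • x p) ∂μ| := by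
    refine (Finset.abs_sum_le_sum_abs _ _).trans ?_
    refine Finset.sum_le_sum fun j _ => (Finset.abs_sum_le_sum_abs _ _).trans ?_
    refine Finset.sum_le_sum fun k _ => (Finset.abs_sum_le_sum_abs _ _).trans ?_
    exact Finset.sum_le_sum fun l _ => (abs_mul _ _).le
  refine (abs_sub _ _).trans ((add_le_add ((abs_sub _ _).trans (add_le_add
    (abs_add_le _ _) le_rfl)) le_rfl).trans ?_)
  simp only [abs_mul, abs_of_nonneg hc, abs_of_nonneg (show 0 ≤ c ^ 2 / 2 by positivity)]
  refine (add_le_add (add_le_add (add_le_add (mul_le_mul_of_nonneg_left g2 hc)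
    (mul_le_mul_of_nonneg_left g3 (by positivity)))
    (mul_le_mul_of_nonneg_left g4 (by positivity))) f1).trans (le_of_eq ?_)
  ring

end SplitData

end Expansion

/-! ### The interpolation between the sum and the Gaussian vector -/

section Interpolation

variable {d n : ℕ} {Ω : Type*}

/-- A function that dominates the norms of all the random vectors in play. -/
noncomputable def sizeFn (x : Fin n → Ω → EuclideanSpace ℝ (Fin d))
    (p : Ω × EuclideanSpace ℝ (Fin d)) : ℝ :=
  1 + ∑ i, ‖x i p.1‖ + ‖p.2‖

/-- The rotation `cos θ • W + sin θ • Y` leading from the sum `W` to the Gaussian vector `Y`. -/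
noncomputable def interp (x : Fin n → Ω → EuclideanSpace ℝ (Fin d)) (θ : ℝ)
    (p : Ω × EuclideanSpace ℝ (Fin d)) : EuclideanSpace ℝ (Fin d) :=
  Real.cos θ • ∑ i, x i p.1 + Real.sin θ • p.2

/-- The interpolating vector with the `i`-th summand left out. -/
noncomputable def interpOmit (x : Fin n → Ω → EuclideanSpace ℝ (Fin d)) (i : Fin n) (θ : ℝ)
    (p : Ω × EuclideanSpace ℝ (Fin d)) : EuclideanSpace ℝ (Fin d) :=
  Real.cos θ • ∑ j ∈ Finset.univ.erase i, x j p.1 + Real.sin θ • p.2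

lemma interpOmit_add (x : Fin n → Ω → EuclideanSpace ℝ (Fin d)) (i : Fin n) (θ : ℝ)
    (p : Ω × EuclideanSpace ℝ (Fin d)) :
    interpOmit x i θ p + Real.cos θ • x i p.1 = interp x θ p := by
  rw [interpOmit, interp, ← Finset.add_sum_erase _ _ (Finset.mem_univ i), smul_add]
  abel

lemma one_le_sizeFn (x : Fin n → Ω → EuclideanSpace ℝ (Fin d))
    (p : Ω × EuclideanSpace ℝ (Fin d)) : 1 ≤ sizeFn x p := by
  have : 0 ≤ ∑ i, ‖x i p.1‖ := Finset.sum_nonneg fun _ _ => norm_nonneg _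
  have := norm_nonneg p.2
  unfold sizeFn
  linarith

lemma norm_le_sizeFn (x : Fin n → Ω → EuclideanSpace ℝ (Fin d)) (i : Fin n)
    (p : Ω × EuclideanSpace ℝ (Fin d)) : ‖x i p.1‖ ≤ sizeFn x p := by
  have : ‖x i p.1‖ ≤ ∑ i, ‖x i p.1‖ :=
    Finset.single_le_sum (f := fun i => ‖x i p.1‖) (fun _ _ => norm_nonneg _) (Finset.mem_univ i)
  have := norm_nonneg p.2
  unfold sizeFn
  linarith

lemma one_add_norm_le_sizeFn (x : Fin n → Ω → EuclideanSpace ℝ (Fin d)) (s : Finset (Fin n))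
    (θ : ℝ) (p : Ω × EuclideanSpace ℝ (Fin d)) :
    1 + ‖Real.cos θ • ∑ i ∈ s, x i p.1 + Real.sin θ • p.2‖ ≤ sizeFn x p := by
  have h1 : ‖∑ i ∈ s, x i p.1‖ ≤ ∑ i, ‖x i p.1‖ := (norm_sum_le _ _).trans
    (Finset.sum_le_sum_of_subset_of_nonneg (Finset.subset_univ s) fun _ _ _ => norm_nonneg _)
  have h2 : ‖Real.cos θ • ∑ i ∈ s, x i p.1 + Real.sin θ • p.2‖
      ≤ ‖∑ i ∈ s, x i p.1‖ + ‖p.2‖ := by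
    refine (norm_add_le _ _).trans (add_le_add ?_ ?_) <;> rw [norm_smul]
    · exact mul_le_of_le_one_left (norm_nonneg _) (Real.abs_cos_le_one θ)
    · exact mul_le_of_le_one_left (norm_nonneg _) (Real.abs_sin_le_one θ)
  unfold sizeFn
  linarith

variable [MeasurableSpace Ω]

/-- `∑ i, E[x_i x_iᵀ]`, the covariance matrix of a sum of independent centred vectors. -/
noncomputable def covSum (P : Measure Ω) (x : Fin n → Ω → EuclideanSpace ℝ (Fin d)) :
    Matrix (Fin d) (Fin d) ℝ :=
  Matrix.of fun j k => ∑ i, ∫ ω, x i ω j * x i ω k ∂P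

/-- Independent centred random vectors with finite absolute moments of order `ρ + 4`. -/
structure SumData (P : Measure Ω) (ρ : ℝ) (x : Fin n → Ω → EuclideanSpace ℝ (Fin d)) : Prop where
  nonneg_ρ : 0 ≤ ρ
  measurable : ∀ i, Measurable (x i)
  indep : iIndepFun x P
  mean : ∀ i j, ∫ ω, x i ω j ∂P = 0
  memLp : ∀ i, MemLp (x i) (ENNReal.ofReal (ρ + 4)) P

/-- The joint law of the sample space and of an independent Gaussian vector with the covariance
matrix of the sum. -/
noncomputable abbrev jointLaw (P : Measure Ω) (x : Fin n → Ω → EuclideanSpace ℝ (Fin d)) :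
    Measure (Ω × EuclideanSpace ℝ (Fin d)) :=
  P.prod (multivariateGaussian 0 (covSum P x))

/-- Independence is kept when an independent component is adjoined to one of the variables. -/
lemma indepFun_prodMk_right {α β γ : Type*} [MeasurableSpace α] [MeasurableSpace β]
    [MeasurableSpace γ] {P : Measure Ω} [IsProbabilityMeasure P] {X : Ω → α} {Y : Ω → β}
    (hX : Measurable X) (hY : Measurable Y) (h : IndepFun X Y P) (ν : Measure γ)
    [IsProbabilityMeasure ν] :
    IndepFun (fun p : Ω × γ => X p.1) (fun p : Ω × γ => (Y p.1, p.2)) (P.prod ν) := by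
  have := Measure.isProbabilityMeasure_map (μ := P) hX.aemeasurable
  have := Measure.isProbabilityMeasure_map (μ := P) hY.aemeasurable
  rw [indepFun_iff_map_prod_eq_prod_map_map (by fun_prop) (by fun_prop)] at h ⊢
  have h1 : (P.prod ν).map (fun p : Ω × γ => X p.1) = P.map X := by
    rw [← Function.comp_def X Prod.fst, ← Measure.map_map hX measurable_fst]
    simp
  have h2 : (P.prod ν).map (fun p : Ω × γ => (Y p.1, p.2)) = (P.map Y).prod ν := by
    have := Measure.map_prod_map P ν hY (measurable_id (α := γ))
    rw [Measure.map_id] at this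
    rw [this]
    rfl
  have h3 : (P.prod ν).map (fun p : Ω × γ => ((X p.1, Y p.1), p.2))
      = ((P.map X).prod (P.map Y)).prod ν := by
    have := Measure.map_prod_map P ν (hX.prodMk hY) (measurable_id (α := γ))
    rw [Measure.map_id, h] at this
    rw [this]
    rfl
  rw [h1, h2, ← (measurePreserving_prodAssoc (P.map X) (P.map Y) ν).map_eq, ← h3,
    Measure.map_map (by fun_prop) (by fun_prop)]
  rfl

namespace SumData

variable {P : Measure Ω} {ρ : ℝ}
  {x : Fin n → Ω → EuclideanSpace ℝ (Fin d)}

lemma measurable_interp (D : SumData P ρ x) (θ : ℝ) : Measurable (interp x θ) := by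
  have := D.measurable
  unfold interp
  fun_prop

lemma measurable_interpOmit (D : SumData P ρ x) (i : Fin n) (θ : ℝ) :
    Measurable (interpOmit x i θ) := by
  have := D.measurable
  unfold interpOmit
  fun_prop

lemma order_interp (D : SumData P ρ x) {a : ℝ} (ha : 0 ≤ a)
    {q : EuclideanSpace ℝ (Fin d) → ℝ} (hq : GrowthLE a q) (θ : ℝ) :
    OrderLE (sizeFn x) a fun p => q (interp x θ p) :=
  hq.orderLE ha (D.measurable_interp θ) (one_add_norm_le_sizeFn x _ θ)

lemma order_coord (D : SumData P ρ x) (i : Fin n) (j : Fin d) :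
    OrderLE (sizeFn x) 1 fun p => x i p.1 j :=
  ⟨by have := D.measurable i; fun_prop, 1, fun p => by
    rw [one_mul, Real.rpow_one]
    exact (PiLp.norm_apply_le (x i p.1) j).trans (norm_le_sizeFn x i p)⟩

lemma order_gauss (_D : SumData P ρ x) (j : Fin d) :
    OrderLE (sizeFn x) 1 fun p => p.2 j :=
  ⟨by fun_prop, 1, fun p => by
    rw [one_mul, Real.rpow_one]
    refine (PiLp.norm_apply_le p.2 j).trans ?_
    have : 0 ≤ ∑ i, ‖x i p.1‖ := Finset.sum_nonneg fun _ _ => norm_nonneg _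
    unfold sizeFn
    linarith⟩

variable [IsProbabilityMeasure P]

lemma memLp_two (D : SumData P ρ x) (i : Fin n) (j : Fin d) : MemLp (fun ω => x i ω j) 2 P := by
  have h1 : MemLp (x i) 2 P := (D.memLp i).mono_exponent (by
    rw [show (2 : ENNReal) = ENNReal.ofReal 2 by simp]
    exact ENNReal.ofReal_le_ofReal (by linarith [D.nonneg_ρ]))
  exact h1.mono (by have := D.measurable i; exact Measurable.aestronglyMeasurable (by fun_prop))
    (Filter.Eventually.of_forall fun ω => PiLp.norm_apply_le _ _)

lemma posSemidef_covSum (D : SumData P ρ x) : (covSum P x).PosSemidef := by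
  refine Matrix.PosSemidef.of_dotProduct_mulVec_nonneg ?_ fun z => ?_
  · ext j k
    simp [covSum, mul_comm]
  · have h1 : star z ⬝ᵥ (covSum P x).mulVec z = ∑ i, ∫ ω, (∑ j, z j * x i ω j) ^ 2 ∂P := by
      have h2 : ∀ i, ∫ ω, (∑ j, z j * x i ω j) ^ 2 ∂P
          = ∑ j, ∑ k, z j * z k * ∫ ω, x i ω j * x i ω k ∂P := by
        intro i
        have h3 : ∀ ω, (∑ j, z j * x i ω j) ^ 2
            = ∑ j, ∑ k, z j * z k * (x i ω j * x i ω k) := by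
          intro ω
          rw [sq, Finset.sum_mul_sum]
          exact Finset.sum_congr rfl fun j _ => Finset.sum_congr rfl fun k _ => by ring
        have h4 : ∀ j k, Integrable (fun ω => z j * z k * (x i ω j * x i ω k)) P := fun j k =>
          ((D.memLp_two i j).integrable_mul (D.memLp_two i k)).const_mul _
        simp only [h3]
        rw [integral_finsetSum _ fun j _ => integrable_finsetSum _ fun k _ => h4 j k]
        refine Finset.sum_congr rfl fun j _ => ?_
        rw [integral_finsetSum _ fun k _ => h4 j k]
        exact Finset.sum_congr rfl fun k _ => integral_const_mul _ _
      simp only [h2]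
      rw [Finset.sum_comm]
      simp only [dotProduct, Matrix.mulVec, covSum, Matrix.of_apply, star_trivial]
      refine Finset.sum_congr rfl fun j _ => ?_
      rw [Finset.sum_comm, Finset.mul_sum]
      refine Finset.sum_congr rfl fun k _ => ?_
      rw [Finset.sum_mul, Finset.mul_sum]
      exact Finset.sum_congr rfl fun i _ => by ring
    rw [h1]
    exact Finset.sum_nonneg fun i _ => integral_nonneg fun ω => sq_nonneg _

lemma integrable_sizeFn (D : SumData P ρ x) :
    Integrable (fun p => sizeFn x p ^ (ρ + 4)) (jointLaw P x) := by
  have hρ := D.nonneg_ρ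
  have h1 : Integrable (fun ω => (1 + ∑ i, ‖x i ω‖) ^ (ρ + 4)) P := by
    have h := (memLp_const (1 : ℝ)).add
      (memLp_finsetSum Finset.univ fun i _ => (D.memLp i).norm)
    have h' := h.integrable_norm_rpow (by simp; linarith) ENNReal.ofReal_ne_top
    rw [ENNReal.toReal_ofReal (by linarith)] at h'
    refine h'.congr (Filter.Eventually.of_forall fun ω => ?_)
    simp only [Pi.add_apply, Real.norm_eq_abs]
    rw [abs_of_nonneg (by positivity)]
  have h2 := h1.mul_prod (integrable_one_add_norm_rpow
    (multivariateGaussian 0 (covSum P x)) (ρ + 4))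
  have hm : Measurable (sizeFn x) := by
    unfold sizeFn
    have := D.measurable
    fun_prop
  refine h2.mono' (Measurable.aestronglyMeasurable (by fun_prop))
    (Filter.Eventually.of_forall fun p => ?_)
  have h3 := one_le_sizeFn x p
  have h4 : 0 ≤ ∑ i, ‖x i p.1‖ := Finset.sum_nonneg fun _ _ => norm_nonneg _
  have h5 := norm_nonneg p.2
  rw [Real.norm_eq_abs, abs_of_nonneg (Real.rpow_nonneg (zero_le_one.trans h3) _),
    ← Real.mul_rpow (add_nonneg zero_le_one h4) (add_nonneg zero_le_one h5)]
  refine Real.rpow_le_rpow (zero_le_one.trans h3) ?_ (by linarith)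
  unfold sizeFn
  nlinarith

lemma integrable_of_orderLE (D : SumData P ρ x) {a : ℝ} {f : Ω × EuclideanSpace ℝ (Fin d) → ℝ}
    (hf : OrderLE (sizeFn x) a f) (ha : a ≤ ρ + 4) : Integrable f (jointLaw P x) :=
  hf.integrable (one_le_sizeFn x) D.integrable_sizeFn ha

lemma splitData (D : SumData P ρ x) (i : Fin n) {θ : ℝ} (hθ : 0 ≤ Real.cos θ) :
    SplitData (jointLaw P x) (sizeFn x) ρ (Real.cos θ) (fun p => x i p.1)
      (interpOmit x i θ) where
  nonneg_ρ := D.nonneg_ρ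
  nonneg_c := hθ
  one_le := one_le_sizeFn x
  integrable := D.integrable_sizeFn
  measurable_x := (D.measurable i).comp measurable_fst
  measurable_V := D.measurable_interpOmit i θ
  indep := by
    have h1 := (D.indep.indepFun_finsetSum_of_notMem D.measurable
      (Finset.notMem_erase i Finset.univ)).symm
    rw [Finset.sum_fn] at h1
    have h2 := indepFun_prodMk_right (D.measurable i)
      (Finset.measurable_sum _ fun j _ => D.measurable j) h1
      (multivariateGaussian 0 (covSum P x))
    have h3 := h2.comp (measurable_id)
      (show Measurable fun p : EuclideanSpace ℝ (Fin d) × EuclideanSpace ℝ (Fin d) =>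
        Real.cos θ • p.1 + Real.sin θ • p.2 by fun_prop)
    convert! h3 using 1
  mean := fun j => by
    rw [integral_fun_fst (fun ω => x i ω j), D.mean, smul_zero]
  norm_x := norm_le_sizeFn x i
  norm_V := one_add_norm_le_sizeFn x _ θ
  norm_T := fun p => by
    rw [interpOmit_add]
    exact one_add_norm_le_sizeFn x _ θ p

/-- Gaussian integration by parts along the interpolation. -/
lemma integral_gauss_mul (D : SumData P ρ x) {q : EuclideanSpace ℝ (Fin d) → ℝ}
    {q' : Fin d → EuclideanSpace ℝ (Fin d) → ℝ}
    (hq : ∀ k w, HasLineDerivAt ℝ q (q' k w) w (EuclideanSpace.single k 1))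
    (hg : GrowthLE ρ q) (hg' : ∀ k, GrowthLE ρ (q' k)) (θ : ℝ) (j : Fin d) :
    ∫ p, p.2 j * q (interp x θ p) ∂(jointLaw P x)
      = Real.sin θ * ∑ k, covSum P x j k * ∫ p, q' k (interp x θ p) ∂(jointLaw P x) := by
  have hρ := D.nonneg_ρ
  have i1 := D.integrable_of_orderLE
    ((D.order_gauss j).mul (D.order_interp hρ hg θ) (one_le_sizeFn x)) (by linarith)
  have i2 := fun k => D.integrable_of_orderLE (D.order_interp hρ (hg' k) θ) (by linarith)
  have i3 : ∀ k, Integrable (fun ω => ∫ y, q' k (interp x θ (ω, y))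
      ∂(multivariateGaussian 0 (covSum P x))) P := fun k => (i2 k).integral_prod_left
  rw [integral_prod _ i1]
  have h1 : ∀ ω, ∫ y, y j * q (interp x θ (ω, y)) ∂(multivariateGaussian 0 (covSum P x))
      = ∑ k, covSum P x j k * (Real.sin θ * ∫ y, q' k (interp x θ (ω, y))
        ∂(multivariateGaussian 0 (covSum P x))) := by
    intro ω
    set v := Real.cos θ • ∑ i, x i ω with hv
    have hgrow : ∀ f : EuclideanSpace ℝ (Fin d) → ℝ, GrowthLE ρ f →
        ∃ C, 0 ≤ C ∧ ∀ y, |f (interp x θ (ω, y))| ≤ C * (1 + ‖y‖) ^ ρ := by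
      intro f hf
      obtain ⟨C, hC⟩ := hf.bound
      have hC0 : 0 ≤ C := by simpa using (abs_nonneg _).trans (hC 0)
      refine ⟨C * (1 + ‖v‖) ^ ρ, by positivity, fun y => (hC _).trans ?_⟩
      rw [mul_assoc, ← Real.mul_rpow (by positivity) (by positivity)]
      refine mul_le_mul_of_nonneg_left (Real.rpow_le_rpow (by positivity) ?_ hρ) hC0
      have h2 : ‖interp x θ (ω, y)‖ ≤ ‖v‖ + ‖y‖ := by
        refine (norm_add_le _ _).trans (add_le_add le_rfl ?_)
        rw [norm_smul]
        exact mul_le_of_le_one_left (norm_nonneg _) (Real.abs_sin_le_one θ)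
      nlinarith [norm_nonneg v, norm_nonneg y]
    obtain ⟨C, hC0, hC⟩ := hgrow q hg
    choose C' hC'0 hC' using fun k => hgrow (q' k) (hg' k)
    have hmono : ∀ {a b : ℝ}, a ≤ b → ∀ y : EuclideanSpace ℝ (Fin d),
        a * (1 + ‖y‖) ^ ρ ≤ b * (1 + ‖y‖) ^ ρ := fun h y =>
      mul_le_mul_of_nonneg_right h (by positivity)
    have hsum : 0 ≤ ∑ k, C' k := Finset.sum_nonneg fun k _ => hC'0 k
    rw [integral_coord_mul_multivariateGaussian D.posSemidef_covSum
      (F := fun y => q (interp x θ (ω, y)))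
      (F' := fun k y => Real.sin θ * q' k (interp x θ (ω, y))) (C := C + ∑ k, C' k) (a := ρ)
      ?_ ?_ hρ ?_ ?_ j]
    · simp only [integral_const_mul]
    · intro k w
      have h3 := hasDerivAt_of_hasLineDerivAt (hq k) (v + Real.sin θ • w) 0
      unfold HasLineDerivAt
      have h4 := HasDerivAt.comp (h₂ := fun t : ℝ => q (v + Real.sin θ • w
        + t • EuclideanSpace.single k (1 : ℝ))) (0 : ℝ) (by simpa using h3)
        ((hasDerivAt_id (0 : ℝ)).mul_const (Real.sin θ))
      simp only [one_mul] at h4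
      rw [mul_comm]
      refine h4.congr_of_eventuallyEq (Filter.Eventually.of_forall fun t => ?_)
      simp only [interp, Function.comp_apply, id_eq, ← hv, smul_add, smul_smul]
      rw [add_assoc, mul_comm]
    · intro k
      have := (hg' k).continuous
      unfold interp
      fun_prop
    · exact fun y => (hC y).trans (hmono (by linarith) y)
    · intro k y
      rw [abs_mul]
      have h5 : C' k ≤ ∑ k, C' k :=
        Finset.single_le_sum (f := C') (fun k _ => hC'0 k) (Finset.mem_univ k)
      exact (mul_le_of_le_one_left (abs_nonneg _) (Real.abs_sin_le_one θ)).trans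
        ((hC' k y).trans (hmono (by linarith) y))
  simp only [h1]
  rw [integral_finsetSum _ fun k _ => ((i3 k).const_mul _).const_mul _, Finset.mul_sum]
  refine Finset.sum_congr rfl fun k _ => ?_
  rw [integral_const_mul, integral_const_mul, integral_prod _ (i2 k)]
  ring

/-- The derivative of `E q(cos θ W + sin θ Y)` is `sin θ` times a sum of one term for each
independent summand, of the kind that is expanded in `SplitData`. -/
lemma hasDerivAt_integral_interp (D : SumData P ρ x) {q : EuclideanSpace ℝ (Fin d) → ℝ}
    {q' : Fin d → EuclideanSpace ℝ (Fin d) → ℝ}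
    {q'' : Fin d → Fin d → EuclideanSpace ℝ (Fin d) → ℝ}
    (hq : ∀ j w, HasLineDerivAt ℝ q (q' j w) w (EuclideanSpace.single j 1))
    (hq' : ∀ k j w, HasLineDerivAt ℝ (q' j) (q'' k j w) w (EuclideanSpace.single k 1))
    (hg : GrowthLE (ρ + 1) q) (hg' : ∀ j, GrowthLE ρ (q' j)) (hg'' : ∀ k j, GrowthLE ρ (q'' k j))
    (θ : ℝ) :
    HasDerivAt (fun θ => ∫ p, q (interp x θ p) ∂(jointLaw P x))
      (Real.sin θ * ∑ i, (Real.cos θ * ∑ j, ∑ k, (∫ p, x i p.1 j * x i p.1 k ∂(jointLaw P x)) *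
          ∫ p, q'' k j (interp x θ p) ∂(jointLaw P x)
        - ∑ j, ∫ p, x i p.1 j * q' j (interp x θ p) ∂(jointLaw P x))) θ := by
  have hρ := D.nonneg_ρ
  have hR := one_le_sizeFn x
  let F' : ℝ → Ω × EuclideanSpace ℝ (Fin d) → ℝ := fun θ p =>
    ∑ j, (-Real.sin θ • ∑ i, x i p.1 + Real.cos θ • p.2) j * q' j (interp x θ p)
  have hdiff : ∀ p θ, HasDerivAt (fun θ => q (interp x θ p)) (F' θ p) θ := by
    intro p θ
    refine hasDerivAt_comp_of_partial hq (fun j => (hg' j).continuous) ?_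
    exact ((Real.hasDerivAt_cos θ).smul_const _).add ((Real.hasDerivAt_sin θ).smul_const _)
  choose C hC using fun j => (hg' j).bound
  have hC0 : ∀ j, 0 ≤ C j := fun j => by simpa using (abs_nonneg _).trans (hC j 0)
  have hbound : ∀ p θ, |F' θ p| ≤ (∑ j, C j) * sizeFn x p ^ (ρ + 1) := by
    intro p θ
    have hs : 0 < sizeFn x p := zero_lt_one.trans_le (hR p)
    refine (Finset.abs_sum_le_sum_abs _ _).trans ?_
    rw [Finset.sum_mul]
    refine Finset.sum_le_sum fun j _ => ?_
    rw [abs_mul, Real.rpow_add_one hs.ne', mul_comm, ← mul_assoc]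
    refine mul_le_mul ((hC j _).trans (mul_le_mul_of_nonneg_left (Real.rpow_le_rpow
      (by positivity) (one_add_norm_le_sizeFn x _ θ p) hρ) (hC0 j))) ?_ (abs_nonneg _)
      (mul_nonneg (hC0 j) (by positivity))
    refine (PiLp.norm_apply_le (-Real.sin θ • ∑ i, x i p.1 + Real.cos θ • p.2) j).trans ?_
    have h1 := one_add_norm_le_sizeFn x Finset.univ (θ + Real.pi / 2) p
    rw [Real.cos_add_pi_div_two, Real.sin_add_pi_div_two] at h1
    linarith
  have ogx : ∀ i j, OrderLE (sizeFn x) (1 + ρ) fun p => x i p.1 j * q' j (interp x θ p) :=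
    fun i j => (D.order_coord i j).mul (D.order_interp hρ (hg' j) θ) hR
  have ogy : ∀ j, OrderLE (sizeFn x) (1 + ρ) fun p => p.2 j * q' j (interp x θ p) :=
    fun j => (D.order_gauss j).mul (D.order_interp hρ (hg' j) θ) hR
  have hF' : ∀ p, F' θ p = ∑ j, (Real.cos θ * (p.2 j * q' j (interp x θ p))
      - Real.sin θ * ∑ i, x i p.1 j * q' j (interp x θ p)) := by
    intro p
    refine Finset.sum_congr rfl fun j _ => ?_
    rw [← Finset.sum_mul]
    simp
    ring
  have oF : OrderLE (sizeFn x) (1 + ρ) (F' θ) := by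
    rw [show F' θ = _ from funext hF']
    exact OrderLE.sum _ fun j _ => ((ogy j).const_mul _).sub
      ((OrderLE.sum _ fun i _ => ogx i j).const_mul _)
  have key := (hasDerivAt_integral_of_dominated_loc_of_deriv_le (μ := jointLaw P x)
    (F := fun θ p => q (interp x θ p)) (F' := F') (x₀ := θ) (s := Set.univ)
    (bound := fun p => (∑ j, C j) * sizeFn x p ^ (ρ + 1)) Filter.univ_mem
    (Filter.Eventually.of_forall fun θ =>
      (D.order_interp (by linarith) hg θ).measurable.aestronglyMeasurable)
    (D.integrable_of_orderLE (D.order_interp (by linarith) hg θ) (by linarith))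
    oF.measurable.aestronglyMeasurable
    (Filter.Eventually.of_forall fun p θ _ => hbound p θ)
    ((OrderLE.integrable (a := ρ + 1) ⟨by
        have := D.integrable_sizeFn
        have hm : Measurable (sizeFn x) := by
          unfold sizeFn
          have := D.measurable
          fun_prop
        fun_prop, 1, fun p => by
          rw [one_mul, abs_of_nonneg (Real.rpow_nonneg (zero_le_one.trans (hR p)) _)]⟩
      hR D.integrable_sizeFn (by linarith)).const_mul _)
    (Filter.Eventually.of_forall fun p θ _ => hdiff p θ)).2
  convert! key using 1
  simp only [hF']
  have i1 : ∀ j, Integrable (fun p => p.2 j * q' j (interp x θ p)) (jointLaw P x) := fun j =>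
    D.integrable_of_orderLE (ogy j) (by linarith)
  have i2 : ∀ i j, Integrable (fun p => x i p.1 j * q' j (interp x θ p)) (jointLaw P x) :=
    fun i j => D.integrable_of_orderLE (ogx i j) (by linarith)
  have i3 : ∀ j, Integrable (fun p => ∑ i, x i p.1 j * q' j (interp x θ p)) (jointLaw P x) :=
    fun j => integrable_finsetSum _ fun i _ => i2 i j
  have i4 : ∀ j, Integrable (fun p => Real.cos θ * (p.2 j * q' j (interp x θ p))
      - Real.sin θ * ∑ i, x i p.1 j * q' j (interp x θ p)) (jointLaw P x) :=
    fun j => ((i1 j).const_mul _).sub ((i3 j).const_mul _)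
  rw [integral_finsetSum _ fun j _ => i4 j]
  have h1 : ∀ j, ∫ p, (Real.cos θ * (p.2 j * q' j (interp x θ p))
      - Real.sin θ * ∑ i, x i p.1 j * q' j (interp x θ p)) ∂(jointLaw P x)
      = Real.sin θ * ∑ i, (Real.cos θ * (∑ k, (∫ p, x i p.1 j * x i p.1 k ∂(jointLaw P x)) *
          ∫ p, q'' k j (interp x θ p) ∂(jointLaw P x))
        - ∫ p, x i p.1 j * q' j (interp x θ p) ∂(jointLaw P x)) := by
    intro j
    rw [integral_sub ((i1 j).const_mul _) ((i3 j).const_mul _), integral_const_mul,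
      integral_const_mul, D.integral_gauss_mul (fun k w => hq' k j w) (hg' j)
        (fun k => hg'' k j) θ j, integral_finsetSum _ fun i _ => i2 i j,
      Finset.sum_sub_distrib, ← Finset.mul_sum, Finset.sum_comm]
    have h2 : ∀ k, covSum P x j k = ∑ i, ∫ p, x i p.1 j * x i p.1 k ∂(jointLaw P x) := by
      intro k
      simp only [covSum, Matrix.of_apply]
      refine Finset.sum_congr rfl fun i _ => ?_
      rw [integral_fun_fst (fun ω => x i ω j * x i ω k)]
      simp
    simp only [h2, Finset.sum_mul]
    ring
  simp only [h1]
  symm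
  rw [← Finset.mul_sum]
  congr 1
  rw [Finset.sum_comm]
  refine Finset.sum_congr rfl fun i _ => ?_
  rw [Finset.sum_sub_distrib, ← Finset.mul_sum]

end SumData

end Interpolation

/-! ### Moments of the interpolating vector -/

section Moments

variable {Ω : Type*} [MeasurableSpace Ω]

lemma add_rpow_le_two_rpow_mul {a b r : ℝ} (ha : 0 ≤ a) (hb : 0 ≤ b) (hr : 0 ≤ r) :
    (a + b) ^ r ≤ 2 ^ r * (a ^ r + b ^ r) := by
  have h1 : a + b ≤ 2 * max a b := by
    have := le_max_left a b
    have := le_max_right a b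
    linarith
  have h2 : (max a b) ^ r ≤ a ^ r + b ^ r := by
    rcases max_choice a b with h | h <;> rw [h]
    · exact le_add_of_nonneg_right (Real.rpow_nonneg hb r)
    · exact le_add_of_nonneg_left (Real.rpow_nonneg ha r)
  calc (a + b) ^ r ≤ (2 * max a b) ^ r := Real.rpow_le_rpow (by positivity) h1 hr
    _ = 2 ^ r * (max a b) ^ r := Real.mul_rpow (by norm_num) (le_max_of_le_left ha)
    _ ≤ _ := mul_le_mul_of_nonneg_left h2 (by positivity)

lemma convexOn_abs_rpow {r : ℝ} (hr : 1 ≤ r) : ConvexOn ℝ Set.univ fun y : ℝ => |y| ^ r := by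
  refine ⟨convex_univ, fun y _ z _ a b ha hb hab => ?_⟩
  have h1 : |a • y + b • z| ≤ a • |y| + b • |z| := by
    refine (abs_add_le _ _).trans (le_of_eq ?_)
    simp only [smul_eq_mul, abs_mul, abs_of_nonneg ha, abs_of_nonneg hb]
  exact (Real.rpow_le_rpow (abs_nonneg _) h1 (by linarith)).trans
    ((convexOn_rpow hr).2 (abs_nonneg y) (abs_nonneg z) ha hb hab)

/-- Adding an independent centred variable increases the absolute moments of order `r ≥ 1`. -/
lemma integral_abs_rpow_le_of_indepFun {P : Measure Ω} [IsProbabilityMeasure P] {X Y : Ω → ℝ}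
    {r : ℝ} (hr : 1 ≤ r) (hX : Measurable X) (hY : Measurable Y) (h : IndepFun X Y P)
    (hXint : Integrable X P) (hX0 : ∫ ω, X ω ∂P = 0)
    (hint : Integrable (fun ω => |X ω + Y ω| ^ r) P) :
    ∫ ω, |Y ω| ^ r ∂P ≤ ∫ ω, |X ω + Y ω| ^ r ∂P := by
  have := Measure.isProbabilityMeasure_map (μ := P) hX.aemeasurable
  have := Measure.isProbabilityMeasure_map (μ := P) hY.aemeasurable
  have hm : Measurable fun p : ℝ × ℝ => |p.1 + p.2| ^ r := by fun_prop
  rw [indepFun_iff_map_prod_eq_prod_map_map hX.aemeasurable hY.aemeasurable] at h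
  have h1 : Integrable (fun p : ℝ × ℝ => |p.1 + p.2| ^ r) ((P.map X).prod (P.map Y)) := by
    rw [← h, integrable_map_measure hm.aestronglyMeasurable (by fun_prop)]
    exact hint
  have h2 : ∫ ω, |X ω + Y ω| ^ r ∂P = ∫ y, ∫ z, |z + y| ^ r ∂(P.map X) ∂(P.map Y) := by
    rw [← integral_prod_symm _ h1, ← h, integral_map (by fun_prop) hm.aestronglyMeasurable]
  have h3 : ∫ ω, |Y ω| ^ r ∂P = ∫ y, |y| ^ r ∂(P.map Y) := by
    rw [integral_map hY.aemeasurable (Measurable.aestronglyMeasurable (by fun_prop))]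
  have hid : Integrable (fun z : ℝ => z) (P.map X) := by
    rw [integrable_map_measure (by fun_prop) hX.aemeasurable]
    exact hXint
  have hid0 : ∫ z, z ∂(P.map X) = 0 := by
    rw [integral_map hX.aemeasurable (by fun_prop)]
    exact hX0
  rw [h2, h3]
  refine integral_mono_of_nonneg
    (Filter.Eventually.of_forall fun y => Real.rpow_nonneg (abs_nonneg _) _)
    h1.integral_prod_right ?_
  filter_upwards [h1.prod_left_ae] with y hy
  have h4 := (convexOn_abs_rpow hr).map_integral_le (μ := P.map X) (f := fun z => z + y)
    (by
      have : Continuous fun y : ℝ => |y| ^ r :=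
        continuous_abs.rpow_const fun _ => Or.inr (by linarith)
      exact this.continuousOn) isClosed_univ (by simp)
    (hid.add (integrable_const y)) hy
  rw [integral_add hid (integrable_const y), hid0] at h4
  simpa using h4

/-- Lyapunov's inequality between the moments of order `r ≤ 2` and `2`. -/
lemma integral_abs_rpow_le_rpow_half {P : Measure Ω} [IsProbabilityMeasure P] {X : Ω → ℝ} {r : ℝ}
    (hr : 0 ≤ r) (hr2 : r ≤ 2) (hX2 : Integrable (fun ω => X ω ^ 2) P)
    (hXr : Integrable (fun ω => |X ω| ^ r) P) :
    ∫ ω, |X ω| ^ r ∂P ≤ (∫ ω, X ω ^ 2 ∂P) ^ (r / 2) := by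
  have h1 : ∀ ω, |X ω| ^ r = (X ω ^ 2) ^ (r / 2) := by
    intro ω
    rw [← sq_abs, ← Real.rpow_natCast, ← Real.rpow_mul (abs_nonneg _)]
    congr 1
    push_cast
    ring
  simp only [h1] at hXr ⊢
  exact (Real.concaveOn_rpow (p := r / 2) (by positivity) (by linarith)).le_map_integral
    (fun y _ => (Real.continuousAt_rpow_const y (r / 2) (Or.inr (by positivity))).continuousWithinAt)
    isClosed_Ici (Filter.Eventually.of_forall fun ω => sq_nonneg (X ω)) hX2 hXr

end Moments

namespace SumData

variable {d n : ℕ} {Ω : Type*} [MeasurableSpace Ω] {P : Measure Ω} {ρ : ℝ}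
  {x : Fin n → Ω → EuclideanSpace ℝ (Fin d)}

lemma order_interpOmit (D : SumData P ρ x) (i : Fin n) (θ : ℝ) (t : Fin d) :
    OrderLE (sizeFn x) 1 fun p => interpOmit x i θ p t :=
  ⟨by have := D.measurable_interpOmit i θ; fun_prop, 1, fun p => by
    rw [one_mul, Real.rpow_one]
    have h1 := PiLp.norm_apply_le (interpOmit x i θ p) t
    have h2 := one_add_norm_le_sizeFn x (Finset.univ.erase i) θ p
    rw [Real.norm_eq_abs] at h1
    unfold interpOmit at h1 ⊢
    linarith⟩

lemma order_sum (D : SumData P ρ x) (s : Finset (Fin n)) (t : Fin d) :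
    OrderLE (sizeFn x) 1 fun p => ∑ j ∈ s, x j p.1 t :=
  OrderLE.sum _ fun j _ => D.order_coord j t

variable [IsProbabilityMeasure P]

lemma integral_fst (f : Ω → ℝ) : ∫ p, f p.1 ∂(jointLaw P x) = ∫ ω, f ω ∂P := by
  rw [integral_fun_fst]
  simp

lemma integral_snd (f : EuclideanSpace ℝ (Fin d) → ℝ) :
    ∫ p, f p.2 ∂(jointLaw P x) = ∫ y, f y ∂(multivariateGaussian 0 (covSum P x)) := by
  rw [integral_fun_snd]
  simp

lemma integral_sq_sum_le (D : SumData P ρ x) (s : Finset (Fin n)) (t : Fin d) :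
    ∫ ω, (∑ i ∈ s, x i ω t) ^ 2 ∂P ≤ covSum P x t t := by
  have hm : ∀ i, Measurable fun ω => x i ω t := fun i => by
    have := D.measurable i
    fun_prop
  have hvar : ∀ {f : Ω → ℝ}, Measurable f → ∫ ω, f ω ∂P = 0 →
      Var[f; P] = ∫ ω, f ω ^ 2 ∂P := fun hf h0 =>
    variance_of_integral_eq_zero hf.aemeasurable h0
  have h1 : Var[∑ i ∈ s, fun ω => x i ω t; P] = ∑ i ∈ s, Var[fun ω => x i ω t; P] := by
    refine IndepFun.variance_sum (fun i _ => D.memLp_two i t) fun i _ j _ hij => ?_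
    exact (D.indep.indepFun hij).comp (φ := fun z : EuclideanSpace ℝ (Fin d) => z t)
      (ψ := fun z : EuclideanSpace ℝ (Fin d) => z t) (by fun_prop) (by fun_prop)
  have h2 : ∫ ω, (∑ i ∈ s, x i ω t) ∂P = 0 := by
    rw [integral_finsetSum _ fun i _ => (D.memLp_two i t).integrable (by norm_num)]
    exact Finset.sum_eq_zero fun i _ => D.mean i t
  rw [Finset.sum_fn, hvar (Finset.measurable_sum _ fun i _ => hm i) h2] at h1
  rw [h1]
  calc ∑ i ∈ s, Var[fun ω => x i ω t; P] ≤ ∑ i, Var[fun ω => x i ω t; P] :=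
        Finset.sum_le_sum_of_subset_of_nonneg (Finset.subset_univ s) fun _ _ _ => variance_nonneg _ _
    _ = covSum P x t t := by
        refine Finset.sum_congr rfl fun i _ => ?_
        rw [hvar (hm i) (D.mean i t)]
        simp only [sq]

lemma integral_coord_gauss (P : Measure Ω) (x : Fin n → Ω → EuclideanSpace ℝ (Fin d)) (t : Fin d) :
    ∫ y, y t ∂(multivariateGaussian 0 (covSum P x)) = 0 :=
  integral_multivariateGaussian_of_odd _ (F := fun y => y t) (by fun_prop) (by simp)

lemma integral_sq_interpOmit_le (D : SumData P ρ x) (i : Fin n) (θ : ℝ) (t : Fin d) :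
    ∫ p, interpOmit x i θ p t ^ 2 ∂(jointLaw P x) ≤ covSum P x t t := by
  have hρ := D.nonneg_ρ
  have hR := one_le_sizeFn x
  set a := Real.cos θ
  set b := Real.sin θ
  set Q : Ω → ℝ := fun ω => ∑ j ∈ Finset.univ.erase i, x j ω t with hQ
  have o1 : OrderLE (sizeFn x) 1 fun p => Q p.1 := D.order_sum _ t
  have o2 := D.order_gauss t
  have e : ∀ p, interpOmit x i θ p t ^ 2
      = a ^ 2 * Q p.1 ^ 2 + 2 * a * b * (Q p.1 * p.2 t) + b ^ 2 * p.2 t ^ 2 := by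
    intro p
    have : interpOmit x i θ p t = a * Q p.1 + b * p.2 t := by
      simp [interpOmit, hQ, a, b]
    rw [this]
    ring
  have hQy : ∫ p, Q p.1 * p.2 t ∂(jointLaw P x)
      = (∫ ω, Q ω ∂P) * ∫ y, y t ∂(multivariateGaussian 0 (covSum P x)) :=
    integral_prod_mul Q fun y : EuclideanSpace ℝ (Fin d) => y t
  simp only [e]
  rw [integral_add₃
    (D.integrable_of_orderLE ((o1.pow hR 2).const_mul _) (by norm_num; linarith))
    (D.integrable_of_orderLE ((o1.mul o2 hR).const_mul _) (by linarith))
    (D.integrable_of_orderLE ((o2.pow hR 2).const_mul _) (by norm_num; linarith))]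
  simp only [integral_const_mul]
  rw [integral_fst (fun ω => Q ω ^ 2), integral_snd (fun y => y t ^ 2),
    hQy, integral_coord_gauss, mul_zero, mul_zero, add_zero]
  have h1 : ∫ y, y t ^ 2 ∂(multivariateGaussian 0 (covSum P x)) = covSum P x t t := by
    rw [← variance_eval_multivariateGaussian (μ := 0) D.posSemidef_covSum t]
    exact (variance_of_integral_eq_zero (by fun_prop) (integral_coord_gauss P x t)).symm
  have h2 : ∫ ω, Q ω ^ 2 ∂P ≤ covSum P x t t := D.integral_sq_sum_le (Finset.univ.erase i) t
  rw [h1]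
  have h3 : a ^ 2 + b ^ 2 = 1 := Real.cos_sq_add_sin_sq θ
  have h4 := mul_le_mul_of_nonneg_left h2 (sq_nonneg a)
  have h5 : covSum P x t t = a ^ 2 * covSum P x t t + b ^ 2 * covSum P x t t := by
    rw [← add_mul, h3, one_mul]
  linarith

/-- The moment estimate behind the bounds. For `r ≥ 1` it follows from convexity. For `r < 1`
absolute moments are not monotone in the number of independent summands, and the comparison is made
with the Gaussian moment instead, through the second moment. -/
lemma integral_mul_box_le (D : SumData P ρ x) (i : Fin n) {θ : ℝ} (hθ : 0 ≤ Real.cos θ)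
    {r : ℝ} (hr : 0 ≤ r) (hrρ : r ≤ ρ) (t : Fin d) {u : EuclideanSpace ℝ (Fin d) → ℝ}
    (hu : Measurable u) (hu0 : ∀ z, 0 ≤ u z) (hu4 : OrderLE (sizeFn x) 4 fun p => u (x i p.1)) :
    ∫ p, u (x i p.1) * (|interpOmit x i θ p t| + |x i p.1 t|) ^ r ∂(jointLaw P x)
      ≤ 2 ^ r * (2 ^ r * (∫ ω, u (x i ω) ∂P) * (∫ ω, |∑ i, x i ω t| ^ r ∂P)
        + 2 ^ r * (∫ ω, u (x i ω) * |x i ω t| ^ r ∂P)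
        + (∫ y, |y t| ^ r ∂(multivariateGaussian 0 (covSum P x))) * ∫ ω, u (x i ω) ∂P) := by
  have hρ := D.nonneg_ρ
  have hR := one_le_sizeFn x
  have S := D.splitData i hθ
  have hU : 0 ≤ ∫ ω, u (x i ω) ∂P := integral_nonneg fun ω => hu0 _
  have oux := hu4.mul ((D.order_coord i t).abs_rpow hR hr) hR
  have i2 : Integrable (fun p => u (x i p.1) * |x i p.1 t| ^ r) (jointLaw P x) :=
    D.integrable_of_orderLE oux (by linarith)
  have e2 : ∫ p, u (x i p.1) * |x i p.1 t| ^ r ∂(jointLaw P x)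
      = ∫ ω, u (x i ω) * |x i ω t| ^ r ∂P := integral_fst fun ω => u (x i ω) * |x i ω t| ^ r
  have hUX : 0 ≤ ∫ ω, u (x i ω) * |x i ω t| ^ r ∂P :=
    integral_nonneg fun ω => mul_nonneg (hu0 _) (Real.rpow_nonneg (abs_nonneg _) _)
  have h2r : 1 ≤ (2 : ℝ) ^ r := Real.one_le_rpow (by norm_num) hr
  have hW0 : 0 ≤ ∫ ω, |∑ i, x i ω t| ^ r ∂P :=
    integral_nonneg fun ω => Real.rpow_nonneg (abs_nonneg _) _
  have hle : Integrable (fun p => u (x i p.1) *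
      (|interpOmit x i θ p t| + |x i p.1 t|) ^ r) (jointLaw P x) := by
    have o := (((D.order_interpOmit i θ t).abs.add (D.order_coord i t).abs)).abs_rpow hR hr
    have o' := hu4.mul o hR
    refine (D.integrable_of_orderLE o' (by linarith)).congr (Filter.Eventually.of_forall fun p => ?_)
    simp only
    rw [abs_of_nonneg (by positivity : 0 ≤ |interpOmit x i θ p t| + |x i p.1 t|)]
  rcases le_or_gt 1 r with hr1 | hr1
  · -- Here `|V_t| ≤ |Q| + |Y_t|` with the incomplete sum `Q`, whose moment is at most that of the
    -- complete one.
    set Q : Ω → ℝ := fun ω => ∑ j ∈ Finset.univ.erase i, x j ω t with hQ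
    have oQ : OrderLE (sizeFn x) 1 fun p => Q p.1 := D.order_sum _ t
    have i1 := D.integrable_of_orderLE (hu4.mul (oQ.abs_rpow hR hr) hR) (by linarith)
    have i3 := D.integrable_of_orderLE (hu4.mul ((D.order_gauss t).abs_rpow hR hr) hR)
      (by linarith)
    have hpt : ∀ p, u (x i p.1) * (|interpOmit x i θ p t| + |x i p.1 t|) ^ r
        ≤ 2 ^ r * 2 ^ r * (u (x i p.1) * |Q p.1| ^ r)
          + 2 ^ r * 2 ^ r * (u (x i p.1) * |x i p.1 t| ^ r)
          + 2 ^ r * (u (x i p.1) * |p.2 t| ^ r) := by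
      intro p
      have h1 : |interpOmit x i θ p t| ≤ |Q p.1| + |p.2 t| := by
        have : interpOmit x i θ p t = Real.cos θ * Q p.1 + Real.sin θ * p.2 t := by
          simp [interpOmit, hQ]
        rw [this]
        refine (abs_add_le _ _).trans (add_le_add ?_ ?_) <;> rw [abs_mul]
        · exact mul_le_of_le_one_left (abs_nonneg _) (Real.abs_cos_le_one θ)
        · exact mul_le_of_le_one_left (abs_nonneg _) (Real.abs_sin_le_one θ)
      have h2 : (|interpOmit x i θ p t| + |x i p.1 t|) ^ r
          ≤ 2 ^ r * (2 ^ r * (|Q p.1| ^ r + |x i p.1 t| ^ r) + |p.2 t| ^ r) := by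
        calc (|interpOmit x i θ p t| + |x i p.1 t|) ^ r
            ≤ ((|Q p.1| + |x i p.1 t|) + |p.2 t|) ^ r :=
              Real.rpow_le_rpow (by positivity) (by linarith) hr
          _ ≤ 2 ^ r * ((|Q p.1| + |x i p.1 t|) ^ r + |p.2 t| ^ r) :=
              add_rpow_le_two_rpow_mul (by positivity) (abs_nonneg _) hr
          _ ≤ _ := mul_le_mul_of_nonneg_left (add_le_add
              (add_rpow_le_two_rpow_mul (abs_nonneg _) (abs_nonneg _) hr) le_rfl) (by positivity)
      refine (mul_le_mul_of_nonneg_left h2 (hu0 _)).trans (le_of_eq ?_)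
      ring
    have j1 := i1.const_mul (2 ^ r * 2 ^ r)
    have j2 := i2.const_mul (2 ^ r * 2 ^ r)
    have j3 := i3.const_mul (2 ^ r)
    have h3 := integral_mono hle ((j1.add j2).add j3) hpt
    refine h3.trans ?_
    have h4 := integral_add₃ j1 j2 j3
    simp only [integral_const_mul] at h4
    refine h4.le.trans ?_
    have e1 : ∫ p, u (x i p.1) * |Q p.1| ^ r ∂(jointLaw P x)
        = (∫ ω, u (x i ω) ∂P) * ∫ ω, |Q ω| ^ r ∂P := by
      rw [integral_fst fun ω => u (x i ω) * |Q ω| ^ r]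
      have h1 := (D.indep.indepFun_finsetSum_of_notMem D.measurable
        (Finset.notMem_erase i Finset.univ)).symm
      rw [Finset.sum_fn] at h1
      have h2 := h1.comp hu (show Measurable fun z : EuclideanSpace ℝ (Fin d) => |z t| ^ r by
        fun_prop)
      have h3 := h2.integral_mul_eq_mul_integral
        (hu.comp (D.measurable i)).aestronglyMeasurable
        ((show Measurable fun z : EuclideanSpace ℝ (Fin d) => |z t| ^ r by fun_prop).comp
          (Finset.measurable_sum _ fun j _ => D.measurable j)).aestronglyMeasurable
      simpa [Function.comp_def, hQ] using h3
    have e3 : ∫ p, u (x i p.1) * |p.2 t| ^ r ∂(jointLaw P x)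
        = (∫ ω, u (x i ω) ∂P) * ∫ y, |y t| ^ r ∂(multivariateGaussian 0 (covSum P x)) :=
      integral_prod_mul (fun ω => u (x i ω)) fun y : EuclideanSpace ℝ (Fin d) => |y t| ^ r
    have hJ : ∫ ω, |Q ω| ^ r ∂P ≤ ∫ ω, |∑ i, x i ω t| ^ r ∂P := by
      have h1 := (D.indep.indepFun_finsetSum_of_notMem D.measurable
        (Finset.notMem_erase i Finset.univ)).symm
      have h2 := h1.comp (show Measurable fun z : EuclideanSpace ℝ (Fin d) => z t by fun_prop)
        (show Measurable fun z : EuclideanSpace ℝ (Fin d) => z t by fun_prop)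
      have h3 : ∀ ω, ∑ i, x i ω t = x i ω t + Q ω := fun ω =>
        (Finset.add_sum_erase _ (fun i => x i ω t) (Finset.mem_univ i)).symm
      simp only [h3]
      have hint : Integrable (fun p : Ω × EuclideanSpace ℝ (Fin d) => |x i p.1 t + Q p.1| ^ r)
          (jointLaw P x) :=
        D.integrable_of_orderLE (((D.order_coord i t).add oQ).abs_rpow hR hr) (by linarith)
      refine integral_abs_rpow_le_of_indepFun hr1 (by have := D.measurable i; fun_prop)
        (Finset.measurable_sum _ fun j _ => by have := D.measurable j; fun_prop)
        (by simpa [Function.comp_def, hQ] using h2)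
        ((D.memLp_two i t).integrable (by norm_num)) (D.mean i t) ?_
      exact hint.of_comp_fst (μ := P) (ν := multivariateGaussian 0 (covSum P x))
        (f := fun ω => |x i ω t + Q ω| ^ r) (IsProbabilityMeasure.ne_zero _)
    rw [e1, e2, e3]
    have h5 := mul_le_mul_of_nonneg_left hJ hU
    have h6 := mul_le_mul_of_nonneg_left h5 (by positivity : (0 : ℝ) ≤ 2 ^ r * 2 ^ r)
    linarith
  · -- Here `y ↦ y ^ r` is subadditive, and the variance of `V_t` is at most `Σ_tt`.
    have hpt : ∀ p, u (x i p.1) * (|interpOmit x i θ p t| + |x i p.1 t|) ^ r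
        ≤ u (x i p.1) * |interpOmit x i θ p t| ^ r + u (x i p.1) * |x i p.1 t| ^ r := by
      intro p
      rw [← mul_add]
      exact mul_le_mul_of_nonneg_left
        (Real.rpow_add_le_add_rpow (abs_nonneg _) (abs_nonneg _) hr hr1.le) (hu0 _)
    have oV := (D.order_interpOmit i θ t).abs_rpow hR hr
    have i1 := D.integrable_of_orderLE (hu4.mul oV hR) (by linarith)
    refine (integral_mono hle (i1.add i2) hpt).trans ?_
    refine (integral_add i1 i2).le.trans ?_
    rw [S.integral_mul (q := fun z => |z t| ^ r) hu (by fun_prop), e2,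
      integral_fst fun ω => u (x i ω)]
    have hV : ∫ p, |interpOmit x i θ p t| ^ r ∂(jointLaw P x)
        ≤ 2 ^ r * ∫ y, |y t| ^ r ∂(multivariateGaussian 0 (covSum P x)) := by
      refine (integral_abs_rpow_le_rpow_half hr (by linarith)
        (D.integrable_of_orderLE ((D.order_interpOmit i θ t).pow hR 2) (by norm_num; linarith))
        (D.integrable_of_orderLE oV (by linarith))).trans ?_
      refine (Real.rpow_le_rpow (integral_nonneg fun p => sq_nonneg _)
        (D.integral_sq_interpOmit_le i θ t) (by linarith)).trans ?_
      exact rpow_half_le_integral_abs_rpow D.posSemidef_covSum hr t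
    have h1 := mul_le_mul_of_nonneg_left hV hU
    have h2 : ∫ ω, u (x i ω) * |x i ω t| ^ r ∂P
        ≤ 2 ^ r * (2 ^ r * ∫ ω, u (x i ω) * |x i ω t| ^ r ∂P) := by
      nlinarith [mul_nonneg (sub_nonneg.2 h2r) hUX, mul_nonneg (sub_nonneg.2 h2r)
        (mul_nonneg (zero_le_one.trans h2r) hUX)]
    have h3 : 0 ≤ 2 ^ r * (2 ^ r * (∫ ω, u (x i ω) ∂P) * (∫ ω, |∑ i, x i ω t| ^ r ∂P)) := by
      positivity
    linarith

end SumData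

/-! ### Growth of the derivatives of the test function -/

section Growth

variable {d : ℕ}

lemma GrowthLE.mono {a b : ℝ} {q : EuclideanSpace ℝ (Fin d) → ℝ} (hq : GrowthLE a q)
    (hab : a ≤ b) : GrowthLE b q := by
  obtain ⟨C, hC⟩ := hq.bound
  have hC0 : 0 ≤ C := by simpa using (abs_nonneg _).trans (hC 0)
  exact ⟨hq.continuous, C, fun w => (hC w).trans (mul_le_mul_of_nonneg_left
    (Real.rpow_le_rpow_of_exponent_le (by linarith [norm_nonneg w]) hab) hC0)⟩

lemma norm_le_norm_of_abs_le {x y : EuclideanSpace ℝ (Fin d)} (h : ∀ t, |x t| ≤ |y t|) :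
    ‖x‖ ≤ ‖y‖ := by
  rw [EuclideanSpace.norm_eq, EuclideanSpace.norm_eq]
  refine Real.sqrt_le_sqrt (Finset.sum_le_sum fun t _ => ?_)
  simp only [Real.norm_eq_abs]
  exact pow_le_pow_left₀ (abs_nonneg _) (h t) 2

/-- Partial derivatives of polynomial growth are locally bounded, so they force continuity. -/
lemma continuous_of_partial_growth {q : EuclideanSpace ℝ (Fin d) → ℝ}
    {q' : Fin d → EuclideanSpace ℝ (Fin d) → ℝ}
    (hq : ∀ l w, HasLineDerivAt ℝ q (q' l w) w (EuclideanSpace.single l 1))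
    {C a : ℝ} (ha : 0 ≤ a) (hC : ∀ l w, |q' l w| ≤ C * (1 + ‖w‖) ^ a) : Continuous q := by
  have hC' : ∀ l w, |q' l w| ≤ |C| * (1 + ‖w‖) ^ a := fun l w =>
    (hC l w).trans (mul_le_mul_of_nonneg_right (le_abs_self C) (by positivity))
  refine continuous_iff_continuousAt.2 fun v => ?_
  have h1 : ∀ x : EuclideanSpace ℝ (Fin d), ‖x‖ ≤ 1 →
      |q (v + x) - q v| ≤ |C| * (2 + ‖v‖) ^ a * ∑ l, |x l| := by
    intro x hx
    refine abs_add_sub_le_of_partial hq v x fun w hw l => (hC' l w).trans ?_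
    refine mul_le_mul_of_nonneg_left (Real.rpow_le_rpow (by positivity) ?_ ha) (abs_nonneg C)
    have h2 : ‖w - v‖ ≤ ‖x‖ := norm_le_norm_of_abs_le hw
    have h3 : ‖w‖ ≤ ‖v‖ + ‖w - v‖ := by simpa using norm_add_le v (w - v)
    linarith
  rw [ContinuousAt, tendsto_iff_norm_sub_tendsto_zero]
  have hlim : Filter.Tendsto (fun w : EuclideanSpace ℝ (Fin d) =>
      |C| * (2 + ‖v‖) ^ a * ∑ l, |(w - v) l|) (nhds v) (nhds 0) := by
    have hcont : Continuous fun w : EuclideanSpace ℝ (Fin d) =>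
      |C| * (2 + ‖v‖) ^ a * ∑ l, |(w - v) l| := by fun_prop
    simpa using hcont.tendsto v
  refine squeeze_zero' (Filter.Eventually.of_forall fun w => norm_nonneg _) ?_ hlim
  filter_upwards [Metric.ball_mem_nhds v one_pos] with w hw
  have := h1 (w - v) (by rw [← dist_eq_norm]; exact (Metric.mem_ball.1 hw).le)
  rwa [add_sub_cancel] at this

lemma growthLE_succ_of_partial {q : EuclideanSpace ℝ (Fin d) → ℝ}
    {q' : Fin d → EuclideanSpace ℝ (Fin d) → ℝ}
    (hq : ∀ l w, HasLineDerivAt ℝ q (q' l w) w (EuclideanSpace.single l 1))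
    {C a : ℝ} (ha : 0 ≤ a) (hC : ∀ l w, |q' l w| ≤ C * (1 + ‖w‖) ^ a) : GrowthLE (a + 1) q := by
  refine ⟨continuous_of_partial_growth hq ha hC, |q 0| + |C| * d, fun w => ?_⟩
  have h1 : |q (0 + w) - q 0| ≤ |C| * (1 + ‖w‖) ^ a * ∑ l, |w l| := by
    refine abs_add_sub_le_of_partial hq 0 w fun z hz l => (hC l z).trans ?_
    refine mul_le_mul (le_abs_self C) (Real.rpow_le_rpow (by positivity) ?_ ha) (by positivity)
      (abs_nonneg C)
    have : ‖z‖ ≤ ‖w‖ := norm_le_norm_of_abs_le fun t => by simpa using hz t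
    linarith
  rw [zero_add] at h1
  have h2 : ∑ l, |w l| ≤ d * (1 + ‖w‖) := by
    calc ∑ l, |w l| ≤ ∑ _l : Fin d, (1 + ‖w‖) := Finset.sum_le_sum fun l _ => by
          have := PiLp.norm_apply_le w l
          rw [Real.norm_eq_abs] at this
          linarith
      _ = d * (1 + ‖w‖) := by simp [mul_add]
  have h3 : (1 + ‖w‖) ^ (a + 1) = (1 + ‖w‖) ^ a * (1 + ‖w‖) := by
    rw [Real.rpow_add (by positivity), Real.rpow_one]
  have h4 : 1 ≤ (1 + ‖w‖) ^ (a + 1) :=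
    Real.one_le_rpow (by linarith [norm_nonneg w]) (by linarith)
  have h5 : |C| * (1 + ‖w‖) ^ a * ∑ l, |w l| ≤ |C| * (1 + ‖w‖) ^ a * (d * (1 + ‖w‖)) :=
    mul_le_mul_of_nonneg_left h2 (by positivity)
  have h6 : |q w| ≤ |q 0| + |q w - q 0| := by
    have := abs_add_le (q 0) (q w - q 0)
    rwa [add_sub_cancel] at this
  have h7 := mul_le_mul_of_nonneg_left h4 (abs_nonneg (q 0))
  rw [add_mul]
  have h8 : |C| * d * (1 + ‖w‖) ^ (a + 1) = |C| * (1 + ‖w‖) ^ a * (d * (1 + ‖w‖)) := by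
    rw [h3]
    ring
  linarith

/-- An even test function, with bounds by multiples of `P` on its partial derivatives of order 4 and 6
with polynomial growth of order `ρ` of its derivatives, and of order `ρ + 1` of the function
itself. -/
structure TestFun (ρ A : ℝ) (B r : Fin d → ℝ) (K₄ K₆ : ℝ) (H : EuclideanSpace ℝ (Fin d) → ℝ) :
    Prop where
  even : ∀ w, H (-w) = H w
  partials : ∀ s : List (Fin d), s.length < 6 → ∀ j w,
    HasLineDerivAt ℝ (iterPartial H s) (iterPartial H (j :: s) w) w (EuclideanSpace.single j 1)
  growth_zero : GrowthLE (ρ + 1) H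
  growth : ∀ s : List (Fin d), 1 ≤ s.length → s.length < 6 → GrowthLE ρ (iterPartial H s)
  nonneg_four : 0 ≤ K₄
  nonneg_six : 0 ≤ K₆
  bound_four : ∀ s : List (Fin d), s.length = 4 → ∀ w, |iterPartial H s w| ≤ K₄ * polyDom A B r w
  bound_six : ∀ s : List (Fin d), s.length = 6 → ∀ w, |iterPartial H s w| ≤ K₆ * polyDom A B r w

lemma MemCb.mono {m m' : ℕ} {h : ℝ → ℝ} (hh : MemCb m h) (hm : m' ≤ m) : MemCb m' h :=
  ⟨fun k hk => hh.differentiable k (by omega), fun k h1 hk => hh.bounded k h1 (by omega)⟩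

lemma MemCP.mono_const {m : ℕ} {A A' : ℝ} {B r : Fin d → ℝ} {g : EuclideanSpace ℝ (Fin d) → ℝ}
    (hg : MemCP m A B r g) (hA : A ≤ A') : MemCP m A' B r g :=
  ⟨hg.nonneg_A.trans hA, hg.nonneg_B, hg.nonneg_r, hg.exists_partial, fun s h1 h2 w =>
    (hg.dominated s h1 h2 w).trans (add_le_add hA le_rfl)⟩

/-- The dominating function grows polynomially. -/
lemma polyDom_le {A ρ : ℝ} {B r : Fin d → ℝ} (hA : 0 ≤ A) (hB : ∀ t, 0 ≤ B t)
    (hr : ∀ t, 0 ≤ r t) (hρ : 0 ≤ ρ) (hrρ : ∀ t, r t ≤ ρ) (w : EuclideanSpace ℝ (Fin d)) :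
    polyDom A B r w ≤ (A + ∑ t, B t) * (1 + ‖w‖) ^ ρ := by
  have h0 : 1 ≤ 1 + ‖w‖ := by linarith [norm_nonneg w]
  have h1 : 1 ≤ (1 + ‖w‖) ^ ρ := Real.one_le_rpow h0 hρ
  rw [add_mul, Finset.sum_mul]
  refine add_le_add (le_mul_of_one_le_right hA h1) (Finset.sum_le_sum fun t _ =>
    mul_le_mul_of_nonneg_left ?_ (hB t))
  have h2 := PiLp.norm_apply_le w t
  rw [Real.norm_eq_abs] at h2
  exact (Real.rpow_le_rpow (abs_nonneg _) (by linarith) (hr t)).trans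
    (Real.rpow_le_rpow_of_exponent_le h0 (hrρ t))

lemma testFun_of_bound_four {A A' ρ : ℝ} {B r : Fin d → ℝ} {g : EuclideanSpace ℝ (Fin d) → ℝ}
    {h : ℝ → ℝ} (hg : MemCP 6 A B r g) (heven : ∀ w, g (-w) = g w) (hh : MemCb 6 h)
    (hA : A ≤ A') (hρ : 0 ≤ ρ) (hrρ : ∀ t, r t ≤ ρ)
    (h4 : ∀ s : List (Fin d), s.length = 4 → ∀ w,
      |iterPartial (fun w => h (g w)) s w| ≤ hSum 4 h * polyDom A' B r w) :
    TestFun ρ A' B r (hSum 4 h) (hSum 6 h) fun w => h (g w) := by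
  have hP : ∀ w, 0 ≤ polyDom A B r w :=
    fun w => polyDom_nonneg hg.nonneg_A hg.nonneg_B w
  have hbound : ∀ k, 1 ≤ k → k ≤ 6 → ∃ C, ∀ s : List (Fin d), s.length = k → ∀ w,
      |iterPartial (fun w => h (g w)) s w| ≤ C * (1 + ‖w‖) ^ ρ := by
    intro k h1 h6
    refine ⟨hSum k h * (1 + (A + ∑ t, B t)), fun s hs w => ?_⟩
    have h2 := abs_iterPartial_comp_le hg hh (by omega) (by omega) w (s := s)
    rw [hs] at h2
    refine h2.trans ?_
    rw [mul_assoc]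
    refine mul_le_mul_of_nonneg_left ?_ (hSum_nonneg k h)
    have h3 : polyDom A B r w ^ ((k : ℝ) / (6 : ℕ)) ≤ 1 + polyDom A B r w := by
      have hk : (k : ℝ) ≤ 6 := by exact_mod_cast h6
      refine (Real.rpow_le_rpow (hP w) (by linarith : _ ≤ 1 + polyDom A B r w)
        (by positivity)).trans ?_
      refine (Real.rpow_le_rpow_of_exponent_le (by linarith [hP w])
        (show ((k : ℝ) / (6 : ℕ)) ≤ 1 from ?_)).trans (Real.rpow_one _).le
      push_cast
      linarith
    have h5 : (1 : ℝ) ≤ (1 + ‖w‖) ^ ρ := Real.one_le_rpow (by linarith [norm_nonneg w]) hρ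
    have h6 := polyDom_le hg.nonneg_A hg.nonneg_B hg.nonneg_r hρ hrρ w
    rw [add_mul]
    linarith
  have hpart : ∀ s : List (Fin d), s.length < 6 → ∀ j w,
      HasLineDerivAt ℝ (iterPartial (fun w => h (g w)) s)
        (iterPartial (fun w => h (g w)) (j :: s) w) w (EuclideanSpace.single j 1) :=
    fun s hs j w => hasLineDerivAt_iterPartial_comp hg hh hs j w
  refine ⟨fun w => by rw [heven], hpart, ?_, fun s h1 h6 => ⟨?_, ?_⟩, hSum_nonneg 4 h,
    hSum_nonneg 6 h, h4, fun s hs w => ?_⟩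
  · obtain ⟨C, hC⟩ := hbound 1 le_rfl (by norm_num)
    exact growthLE_succ_of_partial (hpart [] (by simp)) hρ fun l w => hC [l] rfl w
  · obtain ⟨C, hC⟩ := hbound (s.length + 1) (by omega) (by omega)
    exact continuous_of_partial_growth (hpart s h6) hρ fun l w => hC (l :: s) rfl w
  · obtain ⟨C, hC⟩ := hbound s.length h1 h6.le
    exact ⟨C, hC s rfl⟩
  · have h2 := abs_iterPartial_comp_le hg hh (by omega) (by omega) w (s := s)
    rw [hs, div_self (by norm_num), Real.rpow_one] at h2
    exact h2.trans (mul_le_mul_of_nonneg_left (add_le_add hA le_rfl) (hSum_nonneg 6 h))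

lemma testFun_of_memCP_six {A ρ : ℝ} {B r : Fin d → ℝ} {g : EuclideanSpace ℝ (Fin d) → ℝ}
    {h : ℝ → ℝ} (hg : MemCP 6 A B r g) (heven : ∀ w, g (-w) = g w) (hh : MemCb 6 h)
    (hρ : 0 ≤ ρ) (hrρ : ∀ t, r t ≤ ρ) :
    TestFun ρ (max A 1) B r (hSum 4 h) (hSum 6 h) fun w => h (g w) := by
  refine testFun_of_bound_four hg heven hh (le_max_left A 1) hρ hrρ fun s hs w => ?_
  have h2 := abs_iterPartial_comp_le (hg.mono_const (le_max_left A 1)) hh (by omega)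
    (by omega) w (s := s)
  rw [hs] at h2
  refine h2.trans (mul_le_mul_of_nonneg_left ?_ (hSum_nonneg 4 h))
  -- The constant term is at least `1`, so the power `4 / 6` of the dominating function is below it.
  have h1 : 1 ≤ polyDom (max A 1) B r w := by
    have : 0 ≤ ∑ t, B t * |w t| ^ r t := Finset.sum_nonneg fun t _ =>
      mul_nonneg (hg.nonneg_B t) (Real.rpow_nonneg (abs_nonneg _) _)
    have := le_max_right A 1
    unfold polyDom
    linarith
  exact (Real.rpow_le_rpow_of_exponent_le h1 (by norm_num)).trans (Real.rpow_one _).le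

lemma testFun_of_memCP_four {A ρ : ℝ} {B r : Fin d → ℝ} {g : EuclideanSpace ℝ (Fin d) → ℝ}
    {h : ℝ → ℝ} (hg : MemCP 6 A B r g) (hg4 : MemCP 4 A B r g) (heven : ∀ w, g (-w) = g w)
    (hh : MemCb 6 h) (hρ : 0 ≤ ρ) (hrρ : ∀ t, r t ≤ ρ) :
    TestFun ρ A B r (hSum 4 h) (hSum 6 h) fun w => h (g w) := by
  refine testFun_of_bound_four hg heven hh le_rfl hρ hrρ fun s hs w => ?_
  have h2 := abs_iterPartial_comp_le hg4 (hh.mono (by norm_num)) (by omega) (by omega) w (s := s)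
  rwa [hs, div_self (by norm_num), Real.rpow_one] at h2

end Growth

/-! ### Comparison of the sum with the Gaussian vector -/

section Comparison

variable {d n : ℕ} {Ω : Type*}

/-- The value of the dominating function at the far corner of a box that contains the segment
between the interpolating vectors without and with the `i`-th summand. -/
noncomputable def boxDom (A : ℝ) (B r : Fin d → ℝ) (x : Fin n → Ω → EuclideanSpace ℝ (Fin d))
    (i : Fin n) (θ : ℝ) (p : Ω × EuclideanSpace ℝ (Fin d)) : ℝ :=
  A + ∑ t, B t * (|interpOmit x i θ p t| + |x i p.1 t|) ^ r t

lemma polyDom_le_boxDom {A : ℝ} {B r : Fin d → ℝ} (hB : ∀ t, 0 ≤ B t) (hr : ∀ t, 0 ≤ r t)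
    (x : Fin n → Ω → EuclideanSpace ℝ (Fin d)) (i : Fin n) (θ : ℝ)
    (p : Ω × EuclideanSpace ℝ (Fin d)) {w : EuclideanSpace ℝ (Fin d)}
    (hw : ∀ t, |w t - interpOmit x i θ p t| ≤ |(Real.cos θ • x i p.1) t|) :
    polyDom A B r w ≤ boxDom A B r x i θ p := by
  refine add_le_add le_rfl (Finset.sum_le_sum fun t _ => mul_le_mul_of_nonneg_left
    (Real.rpow_le_rpow (abs_nonneg _) ?_ (hr t)) (hB t))
  have h1 : |(Real.cos θ • x i p.1) t| ≤ |x i p.1 t| := by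
    rw [PiLp.smul_apply, smul_eq_mul, abs_mul]
    exact mul_le_of_le_one_left (abs_nonneg _) (Real.abs_cos_le_one θ)
  have h2 := abs_add_le (interpOmit x i θ p t) (w t - interpOmit x i θ p t)
  rw [add_sub_cancel] at h2
  linarith [hw t]

lemma interp_pi_div_two (x : Fin n → Ω → EuclideanSpace ℝ (Fin d))
    (p : Ω × EuclideanSpace ℝ (Fin d)) : interp x (Real.pi / 2) p = p.2 := by
  simp [interp]

lemma interp_zero (x : Fin n → Ω → EuclideanSpace ℝ (Fin d))
    (p : Ω × EuclideanSpace ℝ (Fin d)) : interp x 0 p = ∑ i, x i p.1 := by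
  simp [interp]

variable [MeasurableSpace Ω]

/-- A bound for the expectation of `u(x_i)` times the dominating function along the
interpolation. -/
noncomputable def rowBound (P : Measure Ω) (x : Fin n → Ω → EuclideanSpace ℝ (Fin d)) (A : ℝ)
    (B r : Fin d → ℝ) (i : Fin n) (u : EuclideanSpace ℝ (Fin d) → ℝ) : ℝ :=
  A * (∫ ω, u (x i ω) ∂P) + ∑ t, B t * (2 ^ r t *
    (2 ^ r t * (∫ ω, u (x i ω) ∂P) * (∫ ω, |∑ i, x i ω t| ^ r t ∂P)
      + 2 ^ r t * (∫ ω, u (x i ω) * |x i ω t| ^ r t ∂P)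
      + (∫ y, |y t| ^ r t ∂(multivariateGaussian 0 (covSum P x))) * ∫ ω, u (x i ω) ∂P))

namespace SumData

variable {P : Measure Ω} {ρ A : ℝ} {B r : Fin d → ℝ} {x : Fin n → Ω → EuclideanSpace ℝ (Fin d)}

lemma order_boxDom (D : SumData P ρ x) (hr : ∀ t, 0 ≤ r t) (hrρ : ∀ t, r t ≤ ρ) (i : Fin n)
    (θ : ℝ) : OrderLE (sizeFn x) ρ (boxDom A B r x i θ) := by
  have hR := one_le_sizeFn x
  have h1 : OrderLE (sizeFn x) ρ fun _ => A := by
    simpa using (OrderLE.one hR D.nonneg_ρ).const_mul A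
  refine h1.add (OrderLE.sum _ fun t _ => OrderLE.const_mul _ ?_)
  have h2 := (((D.order_interpOmit i θ t).abs.add (D.order_coord i t).abs).abs_rpow hR
    (hr t)).mono hR (hrρ t)
  convert! h2 using 2 with p
  rw [abs_of_nonneg (by positivity : 0 ≤ |interpOmit x i θ p t| + |x i p.1 t|)]

lemma order_coord_four (D : SumData P ρ x) (i : Fin n) (j k l m : Fin d) :
    OrderLE (sizeFn x) 4 (fun p => |x i p.1 j|) ∧
    OrderLE (sizeFn x) 4 (fun p => |x i p.1 j * x i p.1 k|) ∧
    OrderLE (sizeFn x) 4 (fun p => |x i p.1 j * x i p.1 k * x i p.1 l|) ∧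
    OrderLE (sizeFn x) 4 (fun p => |x i p.1 j * x i p.1 k * x i p.1 l * x i p.1 m|) := by
  have hR := one_le_sizeFn x
  have o1 := D.order_coord i j
  have o2 := o1.mul (D.order_coord i k) hR
  have o3 := o2.mul (D.order_coord i l) hR
  have o4 := o3.mul (D.order_coord i m) hR
  exact ⟨o1.abs.mono hR (by norm_num), o2.abs.mono hR (by norm_num), o3.abs.mono hR (by norm_num),
    o4.abs.mono hR (by norm_num)⟩

variable [IsProbabilityMeasure P]

lemma integral_mul_boxDom_le (D : SumData P ρ x) (hB : ∀ t, 0 ≤ B t)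
    (hr : ∀ t, 0 ≤ r t) (hrρ : ∀ t, r t ≤ ρ) (i : Fin n) {θ : ℝ} (hθ : 0 ≤ Real.cos θ)
    {u : EuclideanSpace ℝ (Fin d) → ℝ} (hu : Measurable u) (hu0 : ∀ z, 0 ≤ u z)
    (hu4 : OrderLE (sizeFn x) 4 fun p => u (x i p.1)) :
    ∫ p, u (x i p.1) * boxDom A B r x i θ p ∂(jointLaw P x) ≤ rowBound P x A B r i u := by
  have hR := one_le_sizeFn x
  have hρ := D.nonneg_ρ
  have i1 : Integrable (fun p => u (x i p.1) * A) (jointLaw P x) :=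
    (D.integrable_of_orderLE hu4 (by linarith)).mul_const A
  have i2 : ∀ t, Integrable (fun p => u (x i p.1) *
      (|interpOmit x i θ p t| + |x i p.1 t|) ^ r t) (jointLaw P x) := fun t => by
    have h2 := ((D.order_interpOmit i θ t).abs.add (D.order_coord i t).abs).abs_rpow hR (hr t)
    refine (D.integrable_of_orderLE (hu4.mul h2 hR) (by linarith [hrρ t])).congr
      (Filter.Eventually.of_forall fun p => ?_)
    simp only
    rw [abs_of_nonneg (by positivity : 0 ≤ |interpOmit x i θ p t| + |x i p.1 t|)]
  have e : ∀ p, u (x i p.1) * boxDom A B r x i θ p = u (x i p.1) * A + ∑ t, B t *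
      (u (x i p.1) * (|interpOmit x i θ p t| + |x i p.1 t|) ^ r t) := by
    intro p
    rw [boxDom, mul_add, Finset.mul_sum]
    congr 1
    exact Finset.sum_congr rfl fun t _ => by ring
  simp only [e]
  rw [integral_add i1 (integrable_finsetSum _ fun t _ => (i2 t).const_mul _),
    integral_finsetSum _ fun t _ => (i2 t).const_mul _, integral_mul_const,
    integral_fst fun ω => u (x i ω), mul_comm _ A]
  refine add_le_add le_rfl (Finset.sum_le_sum fun t _ => ?_)
  rw [integral_const_mul]
  exact mul_le_mul_of_nonneg_left
    (D.integral_mul_box_le i hθ (hr t) (hrρ t) t hu hu0 hu4) (hB t)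

lemma integral_sum_mul_boxDom_le (D : SumData P ρ x) (hB : ∀ t, 0 ≤ B t)
    (hr : ∀ t, 0 ≤ r t) (hrρ : ∀ t, r t ≤ ρ) (i : Fin n) {θ : ℝ} (hθ : 0 ≤ Real.cos θ)
    {ι : Type*} [Fintype ι] {u : ι → EuclideanSpace ℝ (Fin d) → ℝ} (hu : ∀ a, Measurable (u a))
    (hu0 : ∀ a z, 0 ≤ u a z) (hu4 : ∀ a, OrderLE (sizeFn x) 4 fun p => u a (x i p.1)) :
    ∫ p, (∑ a, u a (x i p.1)) * boxDom A B r x i θ p ∂(jointLaw P x)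
      ≤ ∑ a, rowBound P x A B r i (u a) := by
  simp only [Finset.sum_mul]
  rw [integral_finsetSum _ fun a _ => D.integrable_of_orderLE
    ((hu4 a).mul (D.order_boxDom hr hrρ i θ) (one_le_sizeFn x)) (by linarith)]
  exact Finset.sum_le_sum fun a _ => D.integral_mul_boxDom_le hB hr hrρ i hθ (hu a) (hu0 a) (hu4 a)

lemma integral_l1_mul_le (D : SumData P ρ x) (hB : ∀ t, 0 ≤ B t)
    (hr : ∀ t, 0 ≤ r t) (hrρ : ∀ t, r t ≤ ρ) (i : Fin n) {θ : ℝ} (hθ : 0 ≤ Real.cos θ) :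
    ∫ p, (∑ l, |x i p.1 l|) * boxDom A B r x i θ p ∂(jointLaw P x)
      ≤ ∑ j, rowBound P x A B r i fun z => |z j| :=
  D.integral_sum_mul_boxDom_le hB hr hrρ i hθ (u := fun j z => |z j|) (fun j => by fun_prop) (fun _ _ => abs_nonneg _)
    fun j => (D.order_coord_four i j j j j).1

lemma integral_l1_sq_mul_le (D : SumData P ρ x) (hB : ∀ t, 0 ≤ B t)
    (hr : ∀ t, 0 ≤ r t) (hrρ : ∀ t, r t ≤ ρ) (i : Fin n) {θ : ℝ} (hθ : 0 ≤ Real.cos θ) :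
    ∫ p, (∑ l, |x i p.1 l|) ^ 2 * boxDom A B r x i θ p ∂(jointLaw P x)
      ≤ ∑ j, ∑ k, rowBound P x A B r i fun z => |z j * z k| := by
  have h1 := D.integral_sum_mul_boxDom_le (A := A) hB hr hrρ i hθ
    (u := fun (a : Fin d × Fin d) z => |z a.1 * z a.2|) (fun j => by fun_prop)
    (fun _ _ => abs_nonneg _) fun a => (D.order_coord_four i a.1 a.2 a.1 a.1).2.1
  simp only [Fintype.sum_prod_type] at h1
  convert! h1 using 5 with p
  simp only [abs_mul, ← Finset.mul_sum, ← Finset.sum_mul]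
  ring

lemma integral_l1_cube_mul_le (D : SumData P ρ x) (hB : ∀ t, 0 ≤ B t)
    (hr : ∀ t, 0 ≤ r t) (hrρ : ∀ t, r t ≤ ρ) (i : Fin n) {θ : ℝ} (hθ : 0 ≤ Real.cos θ) :
    ∫ p, (∑ l, |x i p.1 l|) ^ 3 * boxDom A B r x i θ p ∂(jointLaw P x)
      ≤ ∑ j, ∑ k, ∑ l, rowBound P x A B r i fun z => |z j * z k * z l| := by
  have h1 := D.integral_sum_mul_boxDom_le (A := A) hB hr hrρ i hθ
    (u := fun (a : Fin d × Fin d × Fin d) z => |z a.1 * z a.2.1 * z a.2.2|) (fun j => by fun_prop)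
    (fun _ _ => abs_nonneg _) fun a => (D.order_coord_four i a.1 a.2.1 a.2.2 a.1).2.2.1
  simp only [Fintype.sum_prod_type] at h1
  convert! h1 using 5 with p
  simp only [abs_mul, ← Finset.mul_sum, ← Finset.sum_mul]
  ring

lemma integral_l1_fourth_mul_le (D : SumData P ρ x) (hB : ∀ t, 0 ≤ B t)
    (hr : ∀ t, 0 ≤ r t) (hrρ : ∀ t, r t ≤ ρ) (i : Fin n) {θ : ℝ} (hθ : 0 ≤ Real.cos θ) :
    ∫ p, (∑ l, |x i p.1 l|) ^ 4 * boxDom A B r x i θ p ∂(jointLaw P x)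
      ≤ ∑ j, ∑ k, ∑ l, ∑ m, rowBound P x A B r i fun z => |z j * z k * z l * z m| := by
  have h1 := D.integral_sum_mul_boxDom_le (A := A) hB hr hrρ i hθ
    (u := fun (a : Fin d × Fin d × Fin d × Fin d) z => |z a.1 * z a.2.1 * z a.2.2.1 * z a.2.2.2|)
    (fun j => by fun_prop) (fun _ _ => abs_nonneg _)
    fun a => (D.order_coord_four i a.1 a.2.1 a.2.2.1 a.2.2.2).2.2.2
  simp only [Fintype.sum_prod_type] at h1
  convert! h1 using 5 with p
  simp only [abs_mul, ← Finset.mul_sum, ← Finset.sum_mul]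
  ring

end SumData

/-- The remainder of the first order expansion, summed over the summands. -/
noncomputable def thirdBound (P : Measure Ω) (x : Fin n → Ω → EuclideanSpace ℝ (Fin d)) (A : ℝ)
    (B r : Fin d → ℝ) : ℝ :=
  ∑ i, ((∑ j, ∑ k, |∫ ω, x i ω j * x i ω k ∂P| * ∑ l, rowBound P x A B r i fun z => |z l|)
    + 1 / 2 * ∑ j, ∑ k, ∑ l, rowBound P x A B r i fun z => |z j * z k * z l|)

/-- The remainder of the second order expansion, summed over the summands. -/
noncomputable def fourthBound (P : Measure Ω) (x : Fin n → Ω → EuclideanSpace ℝ (Fin d)) (A : ℝ)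
    (B r : Fin d → ℝ) : ℝ :=
  ∑ i, (1 / 2 * (∑ j, ∑ k, |∫ ω, x i ω j * x i ω k ∂P| *
      ∑ l, ∑ m, rowBound P x A B r i fun z => |z l * z m|)
    + 1 / 2 * (∑ j, ∑ k, ∑ l, |∫ ω, x i ω j * x i ω k * x i ω l ∂P| *
      ∑ m, rowBound P x A B r i fun z => |z m|)
    + 1 / 6 * ∑ j, ∑ k, ∑ l, ∑ m, rowBound P x A B r i fun z => |z j * z k * z l * z m|)

namespace SumData

variable {P : Measure Ω} [IsProbabilityMeasure P] {ρ A K₄ K₆ : ℝ} {B r : Fin d → ℝ}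
  {x : Fin n → Ω → EuclideanSpace ℝ (Fin d)} {H : EuclideanSpace ℝ (Fin d) → ℝ}

/-- The third order derivatives of an even function are odd, so their Gaussian expectations vanish,
and along the interpolation their expectations are again small. -/
lemma abs_integral_third_le (D : SumData P ρ x) (T : TestFun ρ A B r K₄ K₆ H) (hB : ∀ t, 0 ≤ B t)
    (hr : ∀ t, 0 ≤ r t) (hrρ : ∀ t, r t ≤ ρ) {s : List (Fin d)} (hs : s.length = 3)
    {θ : ℝ} (hθ : θ ∈ Set.Icc 0 (Real.pi / 2)) :
    |∫ p, iterPartial H s (interp x θ p) ∂(jointLaw P x)|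
      ≤ Real.cos θ ^ 3 * (K₆ * thirdBound P x A B r / 3) := by
  have hρ := D.nonneg_ρ
  have hend : ∫ p, iterPartial H s (interp x (Real.pi / 2) p) ∂(jointLaw P x) = 0 := by
    simp only [interp_pi_div_two]
    rw [integral_snd (fun y => iterPartial H s y)]
    refine integral_multivariateGaussian_of_odd _
      (T.growth s (by omega) (by omega)).continuous.measurable fun w => ?_
    rw [iterPartial_neg T.even, hs]
    norm_num
  have hderiv := D.hasDerivAt_integral_interp (q := iterPartial H s)
    (q' := fun j => iterPartial H (j :: s)) (q'' := fun k j => iterPartial H (k :: j :: s))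
    (fun j w => T.partials s (by omega) j w)
    (fun k j w => T.partials (j :: s) (by simp [hs]) k w)
    ((T.growth s (by omega) (by omega)).mono (by linarith))
    (fun j => T.growth _ (by simp) (by simp [hs]))
    (fun k j => T.growth _ (by simp) (by simp [hs]))
  have hBd : ∀ t, HasDerivAt (fun t => -(Real.cos t ^ 3 * (K₆ * thirdBound P x A B r / 3)))
      (Real.sin t * Real.cos t ^ 2 * (K₆ * thirdBound P x A B r)) t := by
    intro t
    have h1 := (((Real.hasDerivAt_cos t).pow 3).mul_const
      (K₆ * thirdBound P x A B r / 3)).neg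
    convert! h1 using 1
    simp
    ring
  have key := abs_sub_le_of_abs_deriv_le hθ.2 hderiv hBd fun t ht => ?_
  · rw [hend, zero_sub, abs_neg] at key
    simpa using key
  have hc : 0 ≤ Real.cos t := Real.cos_nonneg_of_mem_Icc
    ⟨by linarith [Real.pi_pos, ht.1, hθ.1], ht.2⟩
  have hsn : 0 ≤ Real.sin t := Real.sin_nonneg_of_mem_Icc
    ⟨by linarith [ht.1, hθ.1], by linarith [ht.2, Real.pi_pos]⟩
  rw [abs_mul, abs_of_nonneg hsn, mul_assoc]
  refine mul_le_mul_of_nonneg_left ((Finset.abs_sum_le_sum_abs _ _).trans ?_) hsn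
  rw [thirdBound, Finset.mul_sum, Finset.mul_sum]
  refine Finset.sum_le_sum fun i _ => ?_
  have hstep := (D.splitData i hc).abs_step_le_of_third (q' := fun j => iterPartial H (j :: s))
    (q'' := fun k j => iterPartial H (k :: j :: s))
    (q3 := fun l k j => iterPartial H (l :: k :: j :: s))
    (fun k j w => T.partials (j :: s) (by simp [hs]) k w)
    (fun l k j w => T.partials (k :: j :: s) (by simp [hs]) l w)
    (fun j => T.growth _ (by simp) (by simp [hs]))
    (fun k j => T.growth _ (by simp) (by simp [hs]))
    (K := K₆) (D.order_boxDom (A := A) (B := B) hr hrρ i t)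
    (fun p w hw l k j => (T.bound_six _ (by simp [hs]) w).trans
      (mul_le_mul_of_nonneg_left (polyDom_le_boxDom hB hr x i t p hw) T.nonneg_six))
  have e2 : ∀ j k, ∫ p, x i p.1 j * x i p.1 k ∂(jointLaw P x) = ∫ ω, x i ω j * x i ω k ∂P :=
    fun j k => integral_fst fun ω => x i ω j * x i ω k
  simp only [interpOmit_add, e2] at hstep ⊢
  refine hstep.trans ?_
  rw [mul_assoc]
  refine mul_le_mul_of_nonneg_left (mul_le_mul_of_nonneg_left (add_le_add ?_ ?_) T.nonneg_six)
    (sq_nonneg _)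
  · exact Finset.sum_le_sum fun j _ => Finset.sum_le_sum fun k _ => mul_le_mul_of_nonneg_left
      (D.integral_l1_mul_le hB hr hrρ i hc) (abs_nonneg _)
  · exact mul_le_mul_of_nonneg_left (D.integral_l1_cube_mul_le hB hr hrρ i hc) (by norm_num)

lemma abs_integral_sub_le (D : SumData P ρ x) (T : TestFun ρ A B r K₄ K₆ H) (hB : ∀ t, 0 ≤ B t)
    (hr : ∀ t, 0 ≤ r t) (hrρ : ∀ t, r t ≤ ρ) :
    |∫ ω, H (∑ i, x i ω) ∂P - ∫ y, H y ∂(multivariateGaussian 0 (covSum P x))|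
      ≤ K₄ * fourthBound P x A B r / 4
        + K₆ * (∑ i, ∑ j, ∑ k, ∑ l, |∫ ω, x i ω j * x i ω k * x i ω l ∂P|)
          * thirdBound P x A B r / 36 := by
  have hρ := D.nonneg_ρ
  set E₃ := ∑ i, ∑ j, ∑ k, ∑ l, |∫ ω, x i ω j * x i ω k * x i ω l ∂P| with hE₃
  have hderiv := D.hasDerivAt_integral_interp (q := H)
    (q' := fun j => iterPartial H [j]) (q'' := fun k j => iterPartial H [k, j])
    (fun j w => T.partials [] (by simp) j w) (fun k j w => T.partials [j] (by simp) k w)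
    T.growth_zero (fun j => T.growth _ (by simp) (by simp))
    (fun k j => T.growth _ (by simp) (by simp))
  have hBd : ∀ t, HasDerivAt (fun t => -(Real.cos t ^ 4 * (K₄ * fourthBound P x A B r / 4)
        + Real.cos t ^ 6 * (K₆ * E₃ * thirdBound P x A B r / 36)))
      (Real.sin t * (Real.cos t ^ 3 * (K₄ * fourthBound P x A B r)
        + Real.cos t ^ 2 / 2 * (E₃ * (Real.cos t ^ 3 * (K₆ * thirdBound P x A B r / 3))))) t := by
    intro t
    have h1 := ((((Real.hasDerivAt_cos t).pow 4).mul_const (K₄ * fourthBound P x A B r / 4)).add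
      (((Real.hasDerivAt_cos t).pow 6).mul_const (K₆ * E₃ * thirdBound P x A B r / 36))).neg
    convert! h1 using 1
    simp
    ring
  have key := abs_sub_le_of_abs_deriv_le (by positivity : 0 ≤ Real.pi / 2) hderiv hBd
    fun t ht => ?_
  · simp only [interp_pi_div_two, interp_zero] at key
    rw [integral_snd (fun y => H y), integral_fst (fun ω => H (∑ i, x i ω)), abs_sub_comm] at key
    simpa [add_comm] using key
  have hc : 0 ≤ Real.cos t := Real.cos_nonneg_of_mem_Icc ⟨by linarith [Real.pi_pos, ht.1], ht.2⟩
  have hsn : 0 ≤ Real.sin t := Real.sin_nonneg_of_mem_Icc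
    ⟨ht.1, by linarith [ht.2, Real.pi_pos]⟩
  rw [abs_mul, abs_of_nonneg hsn]
  refine mul_le_mul_of_nonneg_left ((Finset.abs_sum_le_sum_abs _ _).trans ?_) hsn
  rw [fourthBound, hE₃, Finset.mul_sum, Finset.mul_sum, Finset.sum_mul, Finset.mul_sum,
    ← Finset.sum_add_distrib]
  refine Finset.sum_le_sum fun i _ => ?_
  have hstep := (D.splitData i hc).abs_step_le_of_fourth (q' := fun j => iterPartial H [j])
    (q'' := fun k j => iterPartial H [k, j]) (q3 := fun l k j => iterPartial H [l, k, j])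
    (q4 := fun m l k j => iterPartial H [m, l, k, j])
    (fun k j w => T.partials [j] (by simp) k w) (fun l k j w => T.partials [k, j] (by simp) l w)
    (fun m l k j w => T.partials [l, k, j] (by simp) m w)
    (fun j => T.growth _ (by simp) (by simp)) (fun k j => T.growth _ (by simp) (by simp))
    (fun l k j => T.growth _ (by simp) (by simp))
    (K := K₄) (D.order_boxDom (A := A) (B := B) hr hrρ i t)
    (fun p w hw m l k j => (T.bound_four _ (by simp) w).trans
      (mul_le_mul_of_nonneg_left (polyDom_le_boxDom hB hr x i t p hw) T.nonneg_four))
  have e2 : ∀ j k, ∫ p, x i p.1 j * x i p.1 k ∂(jointLaw P x) = ∫ ω, x i ω j * x i ω k ∂P :=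
    fun j k => integral_fst fun ω => x i ω j * x i ω k
  have e3 : ∀ j k l, ∫ p, x i p.1 j * x i p.1 k * x i p.1 l ∂(jointLaw P x)
      = ∫ ω, x i ω j * x i ω k * x i ω l ∂P :=
    fun j k l => integral_fst fun ω => x i ω j * x i ω k * x i ω l
  simp only [interpOmit_add, e2, e3] at hstep ⊢
  refine hstep.trans (add_le_add ?_ (mul_le_mul_of_nonneg_left ?_ (by positivity)))
  · rw [mul_assoc]
    refine mul_le_mul_of_nonneg_left (mul_le_mul_of_nonneg_left
      (add_le_add (add_le_add ?_ ?_) ?_) T.nonneg_four) (pow_nonneg hc 3)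
    · exact mul_le_mul_of_nonneg_left (Finset.sum_le_sum fun j _ => Finset.sum_le_sum fun k _ =>
        mul_le_mul_of_nonneg_left (D.integral_l1_sq_mul_le hB hr hrρ i hc) (abs_nonneg _))
        (by norm_num)
    · exact mul_le_mul_of_nonneg_left (Finset.sum_le_sum fun j _ => Finset.sum_le_sum fun k _ =>
        Finset.sum_le_sum fun l _ => mul_le_mul_of_nonneg_left
          (D.integral_l1_mul_le hB hr hrρ i hc) (abs_nonneg _)) (by norm_num)
    · exact mul_le_mul_of_nonneg_left (D.integral_l1_fourth_mul_le hB hr hrρ i hc) (by norm_num)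
  · simp only [Finset.sum_mul]
    exact Finset.sum_le_sum fun j _ => Finset.sum_le_sum fun k _ => Finset.sum_le_sum fun l _ =>
      mul_le_mul_of_nonneg_left (D.abs_integral_third_le T hB hr hrρ (s := [l, k, j]) rfl ht)
        (abs_nonneg _)

end SumData

end Comparison

/-! ### Normalized rows and the bound in the original moments -/

section Rows

variable {d n : ℕ} {Ω : Type*}

/-- The `i`-th row of `X`, divided by `√n`. -/
noncomputable def scaledRow (X : Fin n → Fin d → Ω → ℝ) (i : Fin n) (ω : Ω) :
    EuclideanSpace ℝ (Fin d) :=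
  WithLp.toLp 2 fun j => (√(n : ℝ))⁻¹ * X i j ω

lemma scaledRow_apply (X : Fin n → Fin d → Ω → ℝ) (i : Fin n) (ω : Ω) (j : Fin d) :
    scaledRow X i ω j = (√(n : ℝ))⁻¹ * X i j ω := rfl

lemma blockSum_apply (X : Fin n → Fin d → Ω → ℝ) (ω : Ω) (j : Fin d) :
    blockSum X ω j = ∑ i, scaledRow X i ω j := by
  simp only [scaledRow_apply, ← Finset.mul_sum]
  rfl

lemma sum_scaledRow (X : Fin n → Fin d → Ω → ℝ) (ω : Ω) :
    ∑ i, scaledRow X i ω = blockSum X ω := by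
  ext j
  simp [blockSum_apply]

variable [MeasurableSpace Ω] {P : Measure Ω} {X : Fin n → Fin d → Ω → ℝ}

lemma sumData_scaledRow {ρ : ℝ} (hρ : 0 ≤ ρ)
    (hX : ∀ i j, Measurable (X i j))
    (hindep : iIndepFun (fun (i : Fin n) (ω : Ω) (j : Fin d) => X i j ω) P)
    (hmean : ∀ i j, ∫ ω, X i j ω ∂P = 0)
    (hmom : ∀ i j, Integrable (fun ω => |X i j ω| ^ (ρ + 4)) P) :
    SumData P ρ (scaledRow X) where
  nonneg_ρ := hρ
  measurable i := by
    unfold scaledRow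
    fun_prop
  indep := hindep.comp (fun _ (v : Fin d → ℝ) => (WithLp.toLp 2 fun j => (√(n : ℝ))⁻¹ * v j :
    EuclideanSpace ℝ (Fin d))) fun i => by fun_prop
  mean i j := by
    simp only [scaledRow_apply]
    rw [integral_const_mul, hmean, mul_zero]
  memLp i := by
    refine MemLp.of_eval_piLp fun j => ?_
    refine MemLp.const_mul ?_ _
    refine (integrable_norm_rpow_iff (hX i j).aestronglyMeasurable (by simp; linarith)
      ENNReal.ofReal_ne_top).1 ?_
    rw [ENNReal.toReal_ofReal (by linarith)]
    exact hmom i j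

lemma covSum_scaledRow [IsProbabilityMeasure P] {ρ : ℝ} (D : SumData P ρ (scaledRow X)) :
    covSum P (scaledRow X) = blockCov P X := by
  ext j k
  have h1 : ∀ i i', cov[fun ω => scaledRow X i ω j, fun ω => scaledRow X i' ω k; P]
      = if i = i' then ∫ ω, scaledRow X i ω j * scaledRow X i ω k ∂P else 0 := by
    intro i i'
    split_ifs with h
    · subst h
      rw [covariance_eq_sub (D.memLp_two i j) (D.memLp_two i k), D.mean, zero_mul, sub_zero]
      rfl
    · have h2 := (D.indep.indepFun h).comp (φ := fun z : EuclideanSpace ℝ (Fin d) => z j)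
        (ψ := fun z : EuclideanSpace ℝ (Fin d) => z k) (by fun_prop) (by fun_prop)
      exact h2.covariance_eq_zero (D.memLp_two i j) (D.memLp_two i' k)
  simp only [blockCov, covSum, Matrix.of_apply, blockSum_apply]
  rw [covariance_fun_sum_fun_sum (fun i => D.memLp_two i j) (fun i => D.memLp_two i k)]
  simp [h1]

lemma rowBound_scaledRow (hn : 0 < n) {A : ℝ} {B r ζ : Fin d → ℝ}
    (hζ : ∀ t, ∫ y, |y t| ^ r t ∂(multivariateGaussian 0 (covSum P (scaledRow X))) = ζ t)
    (i : Fin n) {u : EuclideanSpace ℝ (Fin d) → ℝ} {v : Ω → ℝ} {κ : ℝ}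
    (huv : ∀ ω, u (scaledRow X i ω) = κ * |v ω|) :
    rowBound P (scaledRow X) A B r i u = κ * momentBracket P X A B r ζ 2 1 i v := by
  have hn' : (0 : ℝ) < n := by exact_mod_cast hn
  have h1 : ∀ t ω, κ * |v ω| * |scaledRow X i ω t| ^ r t
      = κ * (1 / (n : ℝ) ^ (r t / 2) * (|v ω| * |X i t ω| ^ r t)) := by
    intro t ω
    have h2 : (√(n : ℝ)) ^ r t = (n : ℝ) ^ (r t / 2) := by
      rw [Real.sqrt_eq_rpow, ← Real.rpow_mul hn'.le]
      congr 1
      ring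
    rw [scaledRow_apply, abs_mul, abs_of_nonneg (by positivity : 0 ≤ (√(n : ℝ))⁻¹),
      Real.mul_rpow (by positivity) (abs_nonneg _), Real.inv_rpow (by positivity), h2]
    ring
  simp only [rowBound, momentBracket, huv, h1, hζ, ← blockSum_apply, integral_const_mul]
  rw [mul_add, Finset.mul_sum]
  refine congrArg₂ _ (by ring) (Finset.sum_congr rfl fun t _ => by ring)

lemma momentBracket_nonneg {A : ℝ} {B r ζ : Fin d → ℝ} {c κ : ℝ} (hA : 0 ≤ A) (hB : ∀ t, 0 ≤ B t)
    (hζ : ∀ t, 0 ≤ ζ t) (hc : 0 ≤ c) (hκ : 0 ≤ κ) (i : Fin n) (u : Ω → ℝ) :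
    0 ≤ momentBracket P X A B r ζ c κ i u := by
  have h1 : 0 ≤ ∫ ω, |u ω| ∂P := integral_nonneg fun ω => abs_nonneg _
  have h2 : ∀ t, 0 ≤ ∫ ω, |blockSum X ω t| ^ r t ∂P := fun t =>
    integral_nonneg fun ω => Real.rpow_nonneg (abs_nonneg _) _
  have h3 : ∀ t, 0 ≤ ∫ ω, |u ω| * |X i t ω| ^ r t ∂P := fun t =>
    integral_nonneg fun ω => mul_nonneg (abs_nonneg _) (Real.rpow_nonneg (abs_nonneg _) _)
  refine add_nonneg (mul_nonneg hA h1) (Finset.sum_nonneg fun t _ => ?_)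
  have := hB t
  have := hζ t
  have := h2 t
  have := h3 t
  positivity

lemma momentBracket_le {A : ℝ} {B r ζ : Fin d → ℝ} (hB : ∀ t, 0 ≤ B t) (hr : ∀ t, 0 ≤ r t)
    (hζ : ∀ t, 0 ≤ ζ t) (i : Fin n) (u : Ω → ℝ) :
    momentBracket P X A B r ζ 2 1 i u ≤ momentBracket P X A B r ζ 3 2 i u := by
  have h1 : 0 ≤ ∫ ω, |u ω| ∂P := integral_nonneg fun ω => abs_nonneg _
  have h2 : ∀ t, 0 ≤ ∫ ω, |blockSum X ω t| ^ r t ∂P := fun t =>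
    integral_nonneg fun ω => Real.rpow_nonneg (abs_nonneg _) _
  have h3 : ∀ t, 0 ≤ ∫ ω, |u ω| * |X i t ω| ^ r t ∂P := fun t =>
    integral_nonneg fun ω => mul_nonneg (abs_nonneg _) (Real.rpow_nonneg (abs_nonneg _) _)
  refine add_le_add le_rfl (Finset.sum_le_sum fun t _ => ?_)
  have := hB t
  have := hζ t
  have := h2 t
  have := h3 t
  refine mul_le_mul (mul_le_mul_of_nonneg_right
    (Real.rpow_le_rpow (by norm_num) (by norm_num) (hr t)) (hB t)) ?_ (by positivity)
    (by positivity)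
  refine add_le_add le_rfl (mul_le_mul_of_nonneg_right
    (mul_le_mul_of_nonneg_right (by norm_num) (hζ t)) h1)

/-- The bound of the interpolation argument, in the notation of the original variables. -/
lemma bound_scaledRow_le_boundM (hn : 0 < n) {A : ℝ} {B r ζ : Fin d → ℝ} (hA : 0 ≤ A)
    (hB : ∀ t, 0 ≤ B t) (hr : ∀ t, 0 ≤ r t)
    (hζ : ∀ t, ∫ y, |y t| ^ r t ∂(multivariateGaussian 0 (covSum P (scaledRow X))) = ζ t)
    (h : ℝ → ℝ) :
    hSum 4 h * fourthBound P (scaledRow X) A B r / 4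
      + hSum 6 h * (∑ i, ∑ j, ∑ k, ∑ l,
          |∫ ω, scaledRow X i ω j * scaledRow X i ω k * scaledRow X i ω l ∂P|)
        * thirdBound P (scaledRow X) A B r / 36 ≤ boundM P X A B r ζ h := by
  have hn' : (0 : ℝ) < n := by exact_mod_cast hn
  have hζ0 : ∀ t, 0 ≤ ζ t := fun t => by
    rw [← hζ t]
    exact integral_nonneg fun y => Real.rpow_nonneg (abs_nonneg _) _
  have hh4 := hSum_nonneg 4 h
  have hh6 := hSum_nonneg 6 h
  set s : ℝ := (√(n : ℝ))⁻¹ with hs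
  have hs0 : 0 ≤ s := by positivity
  have hs2 : s ^ 2 = 1 / n := by
    rw [hs, inv_pow, Real.sq_sqrt hn'.le, one_div]
  have hs4 : s ^ 4 = 1 / (n : ℝ) ^ 2 := by
    rw [show s ^ 4 = (s ^ 2) ^ 2 by ring, hs2, div_pow, one_pow]
  have hs6 : s ^ 6 = 1 / (n : ℝ) ^ 3 := by
    rw [show s ^ 6 = (s ^ 2) ^ 3 by ring, hs2, div_pow, one_pow]
  have e2 : ∀ i j k, |∫ ω, scaledRow X i ω j * scaledRow X i ω k ∂P|
      = s ^ 2 * |∫ ω, X i j ω * X i k ω ∂P| := by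
    intro i j k
    have : ∀ ω, scaledRow X i ω j * scaledRow X i ω k = s ^ 2 * (X i j ω * X i k ω) := fun ω => by
      simp only [scaledRow_apply, ← hs]
      ring
    simp only [this, integral_const_mul]
    rw [abs_mul, abs_of_nonneg (by positivity)]
  have e3 : ∀ i j k l, |∫ ω, scaledRow X i ω j * scaledRow X i ω k * scaledRow X i ω l ∂P|
      = s ^ 3 * |∫ ω, X i j ω * X i k ω * X i l ω ∂P| := by
    intro i j k l
    have : ∀ ω, scaledRow X i ω j * scaledRow X i ω k * scaledRow X i ω l
        = s ^ 3 * (X i j ω * X i k ω * X i l ω) := fun ω => by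
      simp only [scaledRow_apply, ← hs]
      ring
    simp only [this, integral_const_mul]
    rw [abs_mul, abs_of_nonneg (by positivity)]
  have r1 : ∀ i j, rowBound P (scaledRow X) A B r i (fun z => |z j|)
      = s * momentBracket P X A B r ζ 2 1 i (fun ω => X i j ω) := fun i j =>
    rowBound_scaledRow hn hζ i fun ω => by
      simp only [scaledRow_apply, ← hs, abs_mul, abs_of_nonneg hs0]
  have r2 : ∀ i j k, rowBound P (scaledRow X) A B r i (fun z => |z j * z k|)
      = s ^ 2 * momentBracket P X A B r ζ 2 1 i (fun ω => X i j ω * X i k ω) := fun i j k =>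
    rowBound_scaledRow hn hζ i fun ω => by
      simp only [scaledRow_apply, ← hs, abs_mul, abs_of_nonneg hs0]
      ring
  have r3 : ∀ i j k l, rowBound P (scaledRow X) A B r i (fun z => |z j * z k * z l|)
      = s ^ 3 * momentBracket P X A B r ζ 2 1 i (fun ω => X i j ω * X i k ω * X i l ω) :=
    fun i j k l => rowBound_scaledRow hn hζ i fun ω => by
      simp only [scaledRow_apply, ← hs, abs_mul, abs_of_nonneg hs0]
      ring
  have r4 : ∀ i j k l m, rowBound P (scaledRow X) A B r i (fun z => |z j * z k * z l * z m|)
      = s ^ 4 * momentBracket P X A B r ζ 2 1 i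
        (fun ω => X i j ω * X i k ω * X i l ω * X i m ω) :=
    fun i j k l m => rowBound_scaledRow hn hζ i fun ω => by
      simp only [scaledRow_apply, ← hs, abs_mul, abs_of_nonneg hs0]
      ring
  have hmb : ∀ i u, 0 ≤ momentBracket P X A B r ζ 2 1 i u := fun i u =>
    momentBracket_nonneg hA hB hζ0 (by norm_num) (by norm_num) i u
  have hmono := fun i u => momentBracket_le (P := P) (X := X) (A := A) hB hr hζ0 i u
  have key4 : fourthBound P (scaledRow X) A B r ≤ s ^ 4 / 6 * ∑ i, ∑ j, ∑ k, ∑ l, ∑ m,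
      (momentBracket P X A B r ζ 2 1 i (fun ω => X i j ω * X i k ω * X i l ω * X i m ω)
        + 9 * |∫ ω, X i j ω * X i k ω ∂P| *
            momentBracket P X A B r ζ 2 1 i (fun ω => X i l ω * X i m ω)
        + 3 * |∫ ω, X i j ω * X i k ω * X i l ω ∂P| *
            momentBracket P X A B r ζ 2 1 i (fun ω => X i m ω)) := by
    simp only [fourthBound, e2, e3, r1, r2, r4, Finset.mul_sum, ← Finset.sum_add_distrib]
    refine Finset.sum_le_sum fun i _ => Finset.sum_le_sum fun j _ => Finset.sum_le_sum fun k _ =>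
      Finset.sum_le_sum fun l _ => Finset.sum_le_sum fun m _ => ?_
    -- The coefficient `3` of the middle term would be enough; the stated bound has `9`.
    have h1 : 0 ≤ s ^ 4 * (|∫ ω, X i j ω * X i k ω ∂P| *
        momentBracket P X A B r ζ 2 1 i (fun ω => X i l ω * X i m ω)) :=
      mul_nonneg (by positivity) (mul_nonneg (abs_nonneg _) (hmb _ _))
    linarith
  have key3 : thirdBound P (scaledRow X) A B r ≤ s ^ 3 / 2 * ∑ i, ∑ j, ∑ k, ∑ l,
        (momentBracket P X A B r ζ 3 2 i (fun ω => X i j ω * X i k ω * X i l ω)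
          + 2 * |∫ ω, X i j ω * X i k ω ∂P| *
              momentBracket P X A B r ζ 3 2 i (fun ω => X i l ω)) := by
    simp only [thirdBound, e2, r1, r3, Finset.mul_sum, ← Finset.sum_add_distrib]
    refine Finset.sum_le_sum fun i _ => Finset.sum_le_sum fun j _ => Finset.sum_le_sum fun k _ =>
      Finset.sum_le_sum fun l _ => ?_
    have h1 := mul_le_mul_of_nonneg_left (hmono i fun ω => X i j ω * X i k ω * X i l ω)
      (by positivity : 0 ≤ s ^ 3 / 2)
    have h2 := mul_le_mul_of_nonneg_left (hmono i fun ω => X i l ω)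
      (by positivity : 0 ≤ s ^ 3 * |∫ ω, X i j ω * X i k ω ∂P|)
    linarith
  have hE : ∑ i, ∑ j, ∑ k, ∑ l,
        |∫ ω, scaledRow X i ω j * scaledRow X i ω k * scaledRow X i ω l ∂P|
      = s ^ 3 * ∑ i, ∑ j, ∑ k, ∑ l, |∫ ω, X i j ω * X i k ω * X i l ω ∂P| := by
    simp only [e3, ← Finset.mul_sum]
  rw [hE, boundM]
  refine add_le_add ?_ ?_
  · have h1 := mul_le_mul_of_nonneg_left key4 hh4
    rw [hs4] at h1
    refine (div_le_div_of_nonneg_right h1 (by norm_num)).trans (le_of_eq ?_)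
    field_simp
    ring
  · simp only [← Finset.sum_mul]
    have hE0 : 0 ≤ ∑ i, ∑ j, ∑ k, ∑ l, |∫ ω, X i j ω * X i k ω * X i l ω ∂P| :=
      Finset.sum_nonneg fun _ _ => Finset.sum_nonneg fun _ _ => Finset.sum_nonneg fun _ _ =>
        Finset.sum_nonneg fun _ _ => abs_nonneg _
    have h1 := mul_le_mul_of_nonneg_left key3 (mul_nonneg hh6 (mul_nonneg (pow_nonneg hs0 3) hE0))
    refine (div_le_div_of_nonneg_right h1 (by norm_num)).trans (le_of_eq ?_)
    have h2 : (1 : ℝ) / (72 * (n : ℝ) ^ 3) = s ^ 3 * s ^ 3 / 72 := by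
      rw [← pow_add, hs6]
      field_simp
    rw [div_eq_mul_one_div (hSum 6 h), h2]
    ring

end Rows

end EvenStein

theorem mainTheorem3 {Ω Ω' : Type*} [MeasurableSpace Ω] [MeasurableSpace Ω']
    (P : Measure Ω) [IsProbabilityMeasure P] (P' : Measure Ω') [IsProbabilityMeasure P']
    (n d : ℕ) (hn : 0 < n)
    (X : Fin n → Fin d → Ω → ℝ) (hX : ∀ i j, Measurable (X i j))
    (hindep : iIndepFun (fun (i : Fin n) (ω : Ω) (j : Fin d) => X i j ω) P)
    (hmean : ∀ i j, ∫ ω, X i j ω ∂P = 0)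
    (Z : Ω' → EuclideanSpace ℝ (Fin d))
    (hZ : HasLaw Z (stdGaussian (EuclideanSpace ℝ (Fin d))) P')
    (A : ℝ) (B r : Fin d → ℝ)
    (hmom : ∀ i j k, Integrable (fun ω => |X i j ω| ^ (r k + 4)) P)
    (g : EuclideanSpace ℝ (Fin d) → ℝ) (hg : EvenStein.MemCP 6 A B r g)
    (hgeven : ∀ w, g (-w) = g w)
    (h : ℝ → ℝ) (hh : EvenStein.MemCb 6 h) :
    let Y : Ω' → EuclideanSpace ℝ (Fin d) :=
      fun ω => EvenStein.sqrtMul (EvenStein.blockCov P X) (Z ω)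
    let ζ : Fin d → ℝ := fun t => ∫ ω, |Y ω t| ^ r t ∂P'
    let Δ : ℝ := |(∫ ω, h (g (EvenStein.blockSum X ω)) ∂P) - ∫ ω, h (g (Y ω)) ∂P'|
    Integrable (fun ω => h (g (EvenStein.blockSum X ω))) P ∧
    Integrable (fun ω => h (g (Y ω))) P' ∧
    Δ ≤ EvenStein.boundM P X (max A 1) B r ζ h ∧
    (EvenStein.MemCP 4 A B r g → Δ ≤ EvenStein.boundM P X A B r ζ h) := by
  open EvenStein in
  intro Y ζ Δ
  -- One growth exponent that dominates all the `r t`; in dimension `0` there are none.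
  obtain ⟨ρ, hρ, hrρ, hmomρ⟩ : ∃ ρ : ℝ, 0 ≤ ρ ∧ (∀ t, r t ≤ ρ) ∧
      ∀ i j, Integrable (fun ω => |X i j ω| ^ (ρ + 4)) P := by
    rcases isEmpty_or_nonempty (Fin d) with hd | hd
    · exact ⟨0, le_rfl, fun t => hd.elim t, fun i j => hd.elim j⟩
    · obtain ⟨k, hk⟩ := Finite.exists_max r
      exact ⟨r k, hg.nonneg_r k, hk, fun i j => hmom i j k⟩
  have D := sumData_scaledRow hρ hX hindep hmean hmomρ
  have hcov := covSum_scaledRow D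
  have hY : HasLaw Y (multivariateGaussian 0 (covSum P (scaledRow X))) P' := by
    rw [hcov, ← map_sqrtMul_stdGaussian]
    exact HasLaw.comp ⟨(continuous_sqrtMul _).measurable.aemeasurable, rfl⟩ hZ
  have T := testFun_of_memCP_six hg hgeven hh hρ hrρ
  have hHm : Measurable fun w => h (g w) := T.growth_zero.continuous.measurable
  have hζ : ∀ t, ∫ y, |y t| ^ r t ∂(multivariateGaussian 0 (covSum P (scaledRow X))) = ζ t :=
    fun t => (hY.integral_comp (f := fun y => |y t| ^ r t)
      (Measurable.aestronglyMeasurable (by fun_prop))).symm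
  have hHY : ∫ y, h (g y) ∂(multivariateGaussian 0 (covSum P (scaledRow X)))
      = ∫ ω, h (g (Y ω)) ∂P' :=
    (hY.integral_comp hHm.aestronglyMeasurable).symm
  have hmain : ∀ A', 0 ≤ A' → TestFun ρ A' B r (hSum 4 h) (hSum 6 h) (fun w => h (g w)) →
      Δ ≤ boundM P X A' B r ζ h := by
    intro A' hA' T'
    have h1 := D.abs_integral_sub_le T' hg.nonneg_B hg.nonneg_r hrρ
    simp only [sum_scaledRow, hHY] at h1
    exact h1.trans (bound_scaledRow_le_boundM hn hA' hg.nonneg_B hg.nonneg_r hζ h)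
  refine ⟨?_, ?_, hmain _ (le_max_of_le_right zero_le_one) T, fun hg4 =>
    hmain _ hg.nonneg_A (testFun_of_memCP_four hg hg4 hgeven hh hρ hrρ)⟩
  · have h1 := D.integrable_of_orderLE (D.order_interp (by linarith) T.growth_zero 0)
      (by linarith)
    simp only [interp_zero, sum_scaledRow] at h1
    exact h1.of_comp_fst (μ := P) (f := fun ω => h (g (blockSum X ω)))
      (IsProbabilityMeasure.ne_zero _)
  · obtain ⟨C, hC⟩ := T.growth_zero.bound
    have h1 := integrable_of_growth (multivariateGaussian 0 (covSum P (scaledRow X))) hHm hC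
    rw [← hY.map_eq] at h1
    exact h1.comp_aemeasurable hY.aemeasurable
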